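/- All signals are real random processes indexed by $t\in\mathbb{Z}$ on one probability space. $\mathcal{RH}_\infty$ denotes the set of proper real-rational transfer functions $\mathbb{G}(z)=\sum_{k\ge 0} g_k z^{-k}$ all of whose poles satisfy $|z|<1$, acting on a process $X$ by $(\mathbb{G}X)_t=\sum_{k\ge0}g_kX_{t-k}$; $\mathbb{G}$ is strictly proper if its numerator has smaller degree than its denominator. Logarithms are in base 2. Let $W=\mathbb{H}e$, where $\mathbb{H}\in\mathcal{RH}_\infty$ (not necessarily minimum phase) and $e$ is white Gaussian noise with zero mean and unit variance, and assume that $\mathbb{S}_w(e^{j\theta})=|\mathbb{H}(e^{j\theta})|^2>0$ for all $\theta\in[-\pi,\pi)$. Let $V$ be a zero-mean stationary Gaussian process, independent of $W$, with power spectral density $\mathbb{S}_v\ge 0$, integrable on $[-\pi,\pi]$, i.e. $\mathbb{E}[V_sV_t]=\frac{1}{2\pi}\int_{-\pi}^{\pi}\mathbb{S}_v(e^{j\theta})e^{j(s-t)\theta}\,d\theta$. Let $\mathbb{Q},\mathbb{Q}_v\in\mathcal{RH}_\infty$ with $\mathbb{Q}$ strictly proper. Consider the stationary closed loop formed by the channel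 $Y=U+W$ and the controller $U=\mathbb{K}_vV+\mathbb{K}Y$ with $[\mathbb{K}_v,\mathbb{K}]=(1+\mathbb{Q})^{-1}[\mathbb{Q}_v,\mathbb{Q}]$, the controller equation being understood as $(1+\mathbb{Q})U=\mathbb{Q}_vV+\mathbb{Q}Y$ almost surely at every time $t\in\mathbb{Z}$, with all the filtered series convergent. For $T\ge1$ let $$I(U^T\to Y^T)=\sum_{i=1}^{T}I(U^i;Y_i\mid Y^{i-1}),\qquad U^i=(U_1,\dots,U_i),\quad Y^{i}=(Y_1,\dots,Y_{i}),$$ where $I(\cdot\,;\cdot\mid\cdot)$ is conditional mutual information in bits. Then $I(U^T\to Y^T)$ is finite for every $T$, the two integrals below converge absolutely, and $$\lim_{T\to\infty}\frac1T I(U^T\to Y^T)=\frac{1}{4\pi}\int_{-\pi}^{\pi}\log\left(\frac{|\mathbb{Q}_v(e^{j\theta})|^2\,\mathbb{S}_v(e^{j\theta})}{\mathbb{S}_w(e^{j\theta})}+|1+\mathbb{Q}(e^{j\theta})|^2\right)d\theta,$$ $$\lim_{T\to\infty}\frac1T\sum_{t=1}^{T}U_t^2=\frac{1}{2\pi}\int_{-\pi}^{\pi}\left(|\mathbb{Q}(e^{j\theta})|^2\,\mathbb{S}_w(e^{j\theta})+|\mathbb{Q}_v(e^{j\theta})|^2\,\mathbb{S}_v(e^{j\theta})\right)d\theta\quad\text{almost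 surely;}$$ moreover each $U_t$ has finite second moment, and $\lim_{T\to\infty}\frac1T\sum_{t=1}^{T}\mathbb{E}[U_t^2]$ equals the same value. -/

import Mathlib

open MeasureTheory ProbabilityTheory Filter Topology
open scoped ENNReal

noncomputable section

namespace GaussianFeedback

/-! ### Real-rational transfer functions in the `z`-domain -/

/-- `G ∈ RH_∞ = RH_2`: a real-rational transfer function in `z` that is proper (causal) and whose
poles all lie strictly inside the unit disc. -/
structure IsRHInf (G : RatFunc ℝ) : Prop where
  proper : G.num.degree ≤ G.denom.degree
  stable : ∀ z : ℂ, Polynomial.aeval z G.denom = 0 → ‖z‖ < 1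

/-- A strictly proper (strictly causal) transfer function; `G = 0` is included. -/
def IsStrictlyProper (G : RatFunc ℝ) : Prop :=
  G.num.degree < G.denom.degree

/-- The impulse response `g₀, g₁, …` of a proper transfer function `G = N / D`, that is, the
coefficients of its expansion `G(z) = ∑_{k ≥ 0} g_k z^{-k}` at infinity. With `x = z⁻¹` and
`d = deg D`, this is the power series of `x^d N(1/x) / (x^d D(1/x))`, whose denominator has
constant coefficient `1`. -/
def impulse (G : RatFunc ℝ) (k : ℕ) : ℝ :=
  PowerSeries.coeff k
    ((Polynomial.reflect G.denom.natDegree G.num : PowerSeries ℝ) *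
      (Polynomial.reverse G.denom : PowerSeries ℝ)⁻¹)

/-- The frequency response `G(e^{jθ})`. -/
def freqResp (G : RatFunc ℝ) (θ : ℝ) : ℂ :=
  RatFunc.eval (algebraMap ℝ ℂ) (Complex.exp (θ * Complex.I)) G

/-- `|G(e^{jθ})|²`. -/
def gainSq (G : RatFunc ℝ) (θ : ℝ) : ℝ :=
  ‖freqResp G θ‖ ^ 2

/-! ### Processes -/

variable {Ω : Type*} [MeasurableSpace Ω]

/-- `Z = G X`: the two-sided process `Z` is the output of the causal filter `G` driven by the
two-sided process `X`, i.e. `Z_t = ∑_{k ≥ 0} g_k X_{t-k}` almost surely, for every `t`. -/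
def IsFilterOutput (P : Measure Ω) (G : RatFunc ℝ) (X Z : ℤ → Ω → ℝ) : Prop :=
  ∀ t : ℤ, ∀ᵐ ω ∂P, HasSum (fun k : ℕ ↦ impulse G k * X (t - k) ω) (Z t ω)

/-- White Gaussian noise with zero mean and unit variance. -/
structure IsWhiteGaussianNoise (P : Measure Ω) (e : ℤ → Ω → ℝ) : Prop where
  measurable : ∀ t, Measurable (e t)
  indep : iIndepFun e P
  law : ∀ t, P.map (e t) = gaussianReal 0 1

/-- `W` is the output of the filter `H` driven by white Gaussian noise of zero mean and unit
variance. Its power spectral density is `|H(e^{jθ})|²`. -/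
def IsFilteredGaussianNoise (P : Measure Ω) (H : RatFunc ℝ) (W : ℤ → Ω → ℝ) : Prop :=
  (∀ t, Measurable (W t)) ∧ ∃ e : ℤ → Ω → ℝ, IsWhiteGaussianNoise P e ∧ IsFilterOutput P H e W

/-- `V` is a real, zero-mean, stationary Gaussian process with power spectral density `S`:
`Cov(V_s, V_t) = (1/2π) ∫_{-π}^{π} S(θ) e^{j(s-t)θ} dθ`, with `S ≥ 0` integrable. -/
structure IsGaussianWithPSD (P : Measure Ω) (S : ℝ → ℝ) (V : ℤ → Ω → ℝ) : Prop where
  measurable : ∀ t, Measurable (V t)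
  gaussian : IsGaussianProcess V P
  mean_zero : ∀ t, ∫ ω, V t ω ∂P = 0
  psd_nonneg : ∀ θ ∈ Set.Icc (-Real.pi) Real.pi, 0 ≤ S θ
  psd_integrable : IntervalIntegrable S volume (-Real.pi) Real.pi
  cov_eq : ∀ s t : ℤ, ((∫ ω, V s ω * V t ω ∂P : ℝ) : ℂ) =
    (1 / (2 * Real.pi)) * ∫ θ in (-Real.pi)..Real.pi,
      (S θ : ℂ) * Complex.exp (((s - t : ℤ) : ℂ) * θ * Complex.I)

/-- The closed loop formed by the channel `Y = U + W` and the two-degree-of-freedom controller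
`U = K_v V + K Y`, `[K_v, K] = (1 + Q)⁻¹ [Q_v, Q]`. The controller may itself be unstable; as usual,
it is understood through its stable factors, i.e. the input `U` solves
`(1 + Q) U = Q_v V + Q Y`, all the filtered signals being well defined. -/
structure IsYoulaLoop (P : Measure Ω) (Q Qv : RatFunc ℝ) (W V U Y : ℤ → Ω → ℝ) : Prop where
  measurable_input : ∀ t, Measurable (U t)
  channel : ∀ t ω, Y t ω = U t ω + W t ω
  controller : ∀ t : ℤ, ∀ᵐ ω ∂P, ∃ a b c : ℝ,
    HasSum (fun k : ℕ ↦ impulse Q k * U (t - k) ω) a ∧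
    HasSum (fun k : ℕ ↦ impulse Qv k * V (t - k) ω) b ∧
    HasSum (fun k : ℕ ↦ impulse Q k * Y (t - k) ω) c ∧
    U t ω + a = b + c

/-! ### Directed information -/

/-- Conditional mutual information `I(A; B | C)`, in bits: the Kullback-Leibler divergence of the
joint law of `(C, A, B)` from the law under which `A` and `B` are conditionally independent
given `C`, with the same conditional marginals. -/
def condMutualInfo {α β γ : Type*} [MeasurableSpace α] [StandardBorelSpace α] [Nonempty α]
    [MeasurableSpace β] [StandardBorelSpace β] [Nonempty β] [MeasurableSpace γ]
    (P : Measure Ω) [IsFiniteMeasure P] (A : Ω → α) (B : Ω → β) (C : Ω → γ) : ℝ≥0∞ :=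
  InformationTheory.klDiv (P.map fun ω ↦ (C ω, (A ω, B ω)))
    ((P.map C) ⊗ₘ (condDistrib A C P ×ₖ condDistrib B C P)) / ENNReal.ofReal (Real.log 2)

/-- The block `X^n = (X_1, …, X_n)`. -/
def block (X : ℤ → Ω → ℝ) (n : ℕ) (ω : Ω) : Fin n → ℝ :=
  fun i ↦ X ((i : ℕ) + 1) ω

/-- Directed information `I(U^T → Y^T) = ∑_{i=1}^T I(U^i; Y_i | Y^{i-1})`, in bits
(the summation index is `n = i - 1`). -/
def directedInfo (P : Measure Ω) [IsFiniteMeasure P] (U Y : ℤ → Ω → ℝ) (T : ℕ) : ℝ≥0∞ :=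
  ∑ n ∈ Finset.range T, condMutualInfo P (block U (n + 1)) (Y ((n : ℤ) + 1)) (block Y n)

end GaussianFeedback

end

/-! Since Y = U + W, subtracting Q U from both sides of (1+Q)U = Q_v V + Q Y leaves U = Q_v V + Q W
almost surely, and hence Y = Q_v V + (1+Q)W, whether or not the controller itself is stable. All
signals then lie in one closed Gaussian subspace of L², as f + g for the input and f + g + w for the
output, with f = Q_v V orthogonal to the noise w and g = Q w (`IsYoulaLoop.exists_signals`). In such
a space orthogonality is independence, so I(U^i; Y_i | Y^{i-1}) is half the log-ratio of two
least-squares errors for Y_i: from Y^{i-1} alone, and from Y^{i-1} together with U^i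
(`IsGaussSpace.exists_condMutualInfo_eq`).

The first error tends to exp ∫ log S_y, with S_y = |Q_v|² S_v + |1+Q|² S_w, by the theorem of Szegő
and Kolmogorov (`HasSpectrum.tendsto_errorVar`). The second tends to exp ∫ log S_w
(`HasSpectrum.tendsto_errorVar_output`). Knowing U and Y means knowing W = Y - U back to time 1, so
finite predictors of W bound this error above. The inputs may also reveal noise older than time 1,
but strict properness keeps the current sample W_i out of them, so the error of predicting W_i from
its infinite past bounds it below. Cesàro averaging of the convergent terms gives the rate
(`IsGaussSpace.tendsto_directedInfo`). No spectral factor of W is used, so H need not be minimum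
phase.

In Szegő's theorem the lower bound is Jensen's inequality together with the fact that a monic
polynomial has Mahler measure at least 1 (`exp_integral_log_le_of_monic`). For the upper bound
(`exists_polynomial_integral_le`), testing a lower bound r of all prediction errors on exponentials
of polynomials gives r ≤ e^{-∫G} ∫ e^G S. This extends from trigonometric polynomials to bounded
measurable G, and G is then taken to be -log S, truncated.

For the power, U is stationary and Gaussian with a spectral density, so its covariances vanish at
infinity by Riemann–Lebesgue. The covariances of the squares are proportional to the squares of
these, so the averages of U_t² converge in L². A maximal inequality upgrades this to almost sure
convergence (`ae_tendsto_birkhoffAverage_zero`, `IsGaussSpace.ae_tendsto_average_sq`). -/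

noncomputable section

namespace GaussianFeedback

open scoped NNReal

/-! ### Absolutely summable power series -/

/-- A power series with absolutely summable coefficients. -/
def AbsSummable (f : PowerSeries ℂ) : Prop := Summable fun k ↦ ‖PowerSeries.coeff k f‖

/-- The value of a power series at a complex number. -/
def psEval (x : ℂ) (f : PowerSeries ℂ) : ℂ := ∑' k, PowerSeries.coeff k f * x ^ k

lemma AbsSummable.summable_norm_mul_pow {f : PowerSeries ℂ} (hf : AbsSummable f) {x : ℂ}
    (hx : ‖x‖ ≤ 1) : Summable fun k ↦ ‖PowerSeries.coeff k f * x ^ k‖ := by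
  refine Summable.of_nonneg_of_le (fun _ ↦ norm_nonneg _) (fun k ↦ ?_) hf
  rw [norm_mul, norm_pow]
  exact mul_le_of_le_one_right (norm_nonneg _) (pow_le_one₀ (norm_nonneg _) hx)

lemma AbsSummable.mul {f g : PowerSeries ℂ} (hf : AbsSummable f) (hg : AbsSummable g) :
    AbsSummable (f * g) := by
  have := summable_norm_sum_mul_antidiagonal_of_summable_norm hf hg
  simpa only [AbsSummable, PowerSeries.coeff_mul] using this

lemma psEval_mul {f g : PowerSeries ℂ} (hf : AbsSummable f) (hg : AbsSummable g) {x : ℂ}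
    (hx : ‖x‖ ≤ 1) : psEval x (f * g) = psEval x f * psEval x g := by
  rw [psEval, psEval, psEval, tsum_mul_tsum_eq_tsum_sum_antidiagonal_of_summable_norm
    (hf.summable_norm_mul_pow hx) (hg.summable_norm_mul_pow hx)]
  refine tsum_congr fun n ↦ ?_
  rw [PowerSeries.coeff_mul, Finset.sum_mul]
  refine Finset.sum_congr rfl fun p hp ↦ ?_
  rw [← (Finset.HasAntidiagonal.mem_antidiagonal.mp hp : p.1 + p.2 = n), pow_add]
  ring

lemma absSummable_polynomial (p : Polynomial ℂ) : AbsSummable (p : PowerSeries ℂ) := by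
  refine summable_of_ne_finset_zero (s := p.support) fun k hk ↦ ?_
  simpa using hk

lemma psEval_polynomial (x : ℂ) (p : Polynomial ℂ) : psEval x (p : PowerSeries ℂ) = p.eval x := by
  rw [psEval, tsum_eq_sum (s := p.support) fun k hk ↦ by simp_all, Polynomial.eval_eq_sum,
    Polynomial.sum]
  simp

lemma absSummable_geom {a : ℂ} (ha : ‖a‖ < 1) : AbsSummable (PowerSeries.mk fun k ↦ a ^ k) := by
  simpa [AbsSummable] using summable_geometric_of_lt_one (norm_nonneg a) ha

/-- One root at a time: the reverse of X - a is 1 - aX, inverted by the geometric series of ratio a,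
and absolutely summable series are closed under Cauchy products. -/
lemma exists_absSummable_inverse_prod (s : Multiset ℂ) (hs : ∀ a ∈ s, ‖a‖ < 1) :
    ∃ E : PowerSeries ℂ, AbsSummable E ∧
      ((s.map fun a ↦ Polynomial.X - Polynomial.C a).prod.reverse : PowerSeries ℂ) * E = 1 := by
  induction s using Multiset.induction_on with
  | empty =>
    refine ⟨1, ?_, ?_⟩
    · simpa using absSummable_polynomial 1
    · simpa using congrArg (Polynomial.coeToPowerSeries.ringHom (R := ℂ)) (Polynomial.reverse_C 1)
  | cons a s ih =>
    obtain ⟨E, hE, h1⟩ := ih fun b hb ↦ hs b (Multiset.mem_cons_of_mem hb)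
    refine ⟨PowerSeries.mk (fun k ↦ a ^ k) * E,
      (absSummable_geom (hs a (Multiset.mem_cons_self a s))).mul hE, ?_⟩
    rw [Multiset.map_cons, Multiset.prod_cons, Polynomial.reverse_mul_of_domain]
    have h2 : ((Polynomial.X - Polynomial.C a).reverse : PowerSeries ℂ)
        * PowerSeries.mk (fun k ↦ a ^ k) = 1 := by
      have : (Polynomial.X - Polynomial.C a).reverse = 1 - Polynomial.C a * Polynomial.X := by
        rw [Polynomial.reverse, Polynomial.natDegree_X_sub_C, Polynomial.reflect_sub,
          Polynomial.reflect_C]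
        have := Polynomial.reflect_monomial (R := ℂ) 1 1
        simp only [pow_one] at this
        rw [this]; simp [Polynomial.revAt_le]
      rw [this]
      ext n
      cases n with
      | zero => simp
      | succ n =>
        simp [sub_mul, mul_assoc, PowerSeries.coeff_succ_X_mul, PowerSeries.coeff_one, pow_succ']
    rw [Polynomial.coe_mul]
    calc _ = (((Polynomial.X - Polynomial.C a).reverse : PowerSeries ℂ)
        * PowerSeries.mk (fun k ↦ a ^ k)) *
        (((s.map fun a ↦ Polynomial.X - Polynomial.C a).prod.reverse : PowerSeries ℂ) * E) := by
          ring
      _ = 1 := by rw [h1, h2, mul_one]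

/-! ### Impulse responses of stable transfer functions -/

/-- The impulse response as a complex power series. -/
def impulseSeries (G : RatFunc ℝ) : PowerSeries ℂ := PowerSeries.mk fun k ↦ (impulse G k : ℂ)

/-- The defining quotient with its denominator cleared. The reversed denominator is invertible as a
power series because a monic denominator makes its constant coefficient 1. -/
lemma reverse_denom_mul_impulseSeries (G : RatFunc ℝ) :
    (((G.denom.map (algebraMap ℝ ℂ)).reverse : Polynomial ℂ) : PowerSeries ℂ) * impulseSeries G =
      ((Polynomial.reflect G.denom.natDegree (G.num.map (algebraMap ℝ ℂ)) : Polynomial ℂ) :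
        PowerSeries ℂ) := by
  have h0 : PowerSeries.constantCoeff (Polynomial.reverse G.denom : PowerSeries ℝ) ≠ 0 := by
    simp [← PowerSeries.coeff_zero_eq_constantCoeff_apply, (RatFunc.monic_denom G).leadingCoeff]
  have h1 : impulseSeries G = PowerSeries.map (algebraMap ℝ ℂ)
      ((Polynomial.reflect G.denom.natDegree G.num : PowerSeries ℝ) *
      (Polynomial.reverse G.denom : PowerSeries ℝ)⁻¹) := by
    ext k
    rw [PowerSeries.coeff_map]
    simp [impulseSeries, impulse]
  have h2 : (((G.denom.map (algebraMap ℝ ℂ)).reverse : Polynomial ℂ) : PowerSeries ℂ) =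
      PowerSeries.map (algebraMap ℝ ℂ) (Polynomial.reverse G.denom : PowerSeries ℝ) := by
    rw [Polynomial.reverse, Polynomial.natDegree_map, Polynomial.reflect_map]
    exact Polynomial.polynomial_map_coe
  rw [h1, h2, ← map_mul, mul_left_comm, PowerSeries.mul_inv_cancel _ h0, mul_one,
    ← Polynomial.polynomial_map_coe, Polynomial.reflect_map]

/-- Over ℂ the denominator splits into factors X - a with |a| < 1, so its reverse has an absolutely
summable inverse. -/
lemma IsRHInf.absSummable {G : RatFunc ℝ} (hG : IsRHInf G) : AbsSummable (impulseSeries G) := by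
  set D := G.denom.map (algebraMap ℝ ℂ) with hD
  have hmon : D.Monic := (RatFunc.monic_denom G).map _
  obtain ⟨E, hE, h1⟩ := exists_absSummable_inverse_prod D.roots fun a ha ↦ hG.stable a (by
    have := (Polynomial.mem_roots hmon.ne_zero).mp ha
    rwa [Polynomial.IsRoot, hD, Polynomial.eval_map_algebraMap] at this)
  have hsp : D = (D.roots.map fun a ↦ Polynomial.X - Polynomial.C a).prod := by
    have := (IsAlgClosed.splits D).eq_prod_roots
    rwa [hmon.leadingCoeff, map_one, one_mul] at this
  rw [← hsp] at h1
  have h2 := reverse_denom_mul_impulseSeries G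
  have h3 : impulseSeries G = E * ((Polynomial.reflect G.denom.natDegree
      (G.num.map (algebraMap ℝ ℂ)) : Polynomial ℂ) : PowerSeries ℂ) := by
    rw [← h2, ← mul_assoc, mul_comm E, h1, one_mul]
  rw [h3]
  exact hE.mul (absSummable_polynomial _)

lemma IsRHInf.summable_impulse {G : RatFunc ℝ} (hG : IsRHInf G) :
    Summable fun k ↦ |impulse G k| := by
  simpa [AbsSummable, impulseSeries] using hG.absSummable

lemma IsRHInf.aeval_denom_ne_zero {G : RatFunc ℝ} (hG : IsRHInf G) {z : ℂ} (hz : ‖z‖ = 1) :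
    Polynomial.aeval z G.denom ≠ 0 :=
  fun h ↦ (hG.stable z h).ne hz

lemma freqResp_eq_div (G : RatFunc ℝ) (θ : ℝ) :
    freqResp G θ = Polynomial.aeval (Complex.exp (θ * Complex.I)) G.num /
      Polynomial.aeval (Complex.exp (θ * Complex.I)) G.denom := rfl

lemma IsRHInf.hasSum_freqResp {G : RatFunc ℝ} (hG : IsRHInf G) (θ : ℝ) :
    HasSum (fun k : ℕ ↦ (impulse G k : ℂ) * Complex.exp (-(k * θ * Complex.I))) (freqResp G θ) := by
  set z := Complex.exp (θ * Complex.I) with hz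
  have hz1 : ‖z‖ = 1 := Complex.norm_exp_ofReal_mul_I θ
  have hz0 : z ≠ 0 := Complex.exp_ne_zero _
  have hx : ‖z⁻¹‖ ≤ 1 := by simp [hz1]
  have hs := (hG.absSummable.summable_norm_mul_pow hx).of_norm.hasSum
  change HasSum _ (psEval z⁻¹ _) at hs
  have hval : psEval z⁻¹ (impulseSeries G) = freqResp G θ := by
    have h := congrArg (psEval z⁻¹) (reverse_denom_mul_impulseSeries G)
    rw [psEval_mul (absSummable_polynomial _) hG.absSummable hx, psEval_polynomial,
      psEval_polynomial] at h
    -- Properness lets numerator and denominator be reflected at the same degree; the common power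
    -- of z then cancels in the quotient.
    have hN : G.num.natDegree ≤ G.denom.natDegree := Polynomial.natDegree_le_natDegree hG.proper
    let _ := invertibleOfNonzero hz0
    have e1 := Polynomial.eval₂_reverse_mul_pow (RingHom.id ℂ) z (G.denom.map (algebraMap ℝ ℂ))
    have e2 := Polynomial.eval₂_reflect_mul_pow (RingHom.id ℂ) z G.denom.natDegree
      (G.num.map (algebraMap ℝ ℂ)) (by rwa [Polynomial.natDegree_map])
    rw [invOf_eq_inv, Polynomial.natDegree_map] at e1
    rw [invOf_eq_inv] at e2
    rw [Polynomial.eval₂_id, Polynomial.eval₂_id, Polynomial.eval_map_algebraMap] at e1 e2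
    rw [freqResp_eq_div, eq_div_iff (hG.aeval_denom_ne_zero hz1), ← hz, ← e1, ← e2, ← h]
    ring
  rw [hval] at hs
  convert hs using 2 with k
  rw [impulseSeries, PowerSeries.coeff_mk, hz, ← Complex.exp_neg, ← Complex.exp_nat_mul]
  congr 2
  ring

lemma IsStrictlyProper.impulse_zero {G : RatFunc ℝ} (hG : IsStrictlyProper G) :
    impulse G 0 = 0 := by
  have : G.num.coeff G.denom.natDegree = 0 := by
    rw [Polynomial.coeff_eq_zero_of_degree_lt]
    exact hG.trans_le Polynomial.degree_le_natDegree
  rw [impulse, PowerSeries.coeff_mul]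
  simp [Polynomial.coeff_reflect, this]

lemma IsRHInf.continuous_freqResp {G : RatFunc ℝ} (hG : IsRHInf G) : Continuous (freqResp G) := by
  simp only [funext (freqResp_eq_div G)]
  refine Continuous.div ?_ ?_ fun θ ↦ hG.aeval_denom_ne_zero (Complex.norm_exp_ofReal_mul_I θ)
  · exact (Polynomial.continuous_aeval _).comp (by fun_prop)
  · exact (Polynomial.continuous_aeval _).comp (by fun_prop)

lemma IsRHInf.continuous_gainSq {G : RatFunc ℝ} (hG : IsRHInf G) : Continuous (gainSq G) :=
  hG.continuous_freqResp.norm.pow 2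

/-! ### Normalized Lebesgue measure on `(-π, π]` -/

/-- The normalized Lebesgue measure on `(-π, π]`. -/
def circ : Measure ℝ :=
  ENNReal.ofReal (1 / (2 * Real.pi)) • volume.restrict (Set.Ioc (-Real.pi) Real.pi)

instance : IsProbabilityMeasure circ := by
  refine ⟨?_⟩
  rw [circ, Measure.smul_apply, Measure.restrict_apply_univ, Real.volume_Ioc, smul_eq_mul,
    ← ENNReal.ofReal_mul (by positivity)]
  have := Real.pi_pos
  rw [show 1 / (2 * Real.pi) * (Real.pi - -Real.pi) = 1 by field_simp; ring, ENNReal.ofReal_one]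

lemma ae_circ_iff {p : ℝ → Prop} :
    (∀ᵐ θ ∂circ, p θ) ↔ ∀ᵐ θ ∂volume.restrict (Set.Ioc (-Real.pi) Real.pi), p θ := by
  have := Real.pi_pos
  rw [circ, Measure.ae_ennreal_smul_measure_iff]
  simp [this]

lemma ae_circ_of_forall {p : ℝ → Prop} (h : ∀ θ ∈ Set.Ioc (-Real.pi) Real.pi, p θ) :
    ∀ᵐ θ ∂circ, p θ :=
  ae_circ_iff.mpr <| (ae_restrict_iff' measurableSet_Ioc).mpr (ae_of_all _ h)

lemma integrable_circ_iff {E : Type*} [NormedAddCommGroup E] {f : ℝ → E} :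
    Integrable f circ ↔ IntervalIntegrable f volume (-Real.pi) Real.pi := by
  have := Real.pi_pos
  rw [intervalIntegrable_iff_integrableOn_Ioc_of_le (by linarith), circ,
    integrable_smul_measure (by simp [this]) ENNReal.ofReal_ne_top, IntegrableOn]

lemma integral_circ {E : Type*} [NormedAddCommGroup E] [NormedSpace ℝ E] (f : ℝ → E) :
    ∫ θ, f θ ∂circ = (1 / (2 * Real.pi)) • ∫ θ in (-Real.pi)..Real.pi, f θ := by
  have := Real.pi_pos
  rw [intervalIntegral.integral_of_le (by linarith), circ, integral_smul_measure,
    ENNReal.toReal_ofReal (by positivity)]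

lemma integral_circ_exp (n : ℤ) :
    ∫ θ, Complex.exp (n * θ * Complex.I) ∂circ = if n = 0 then 1 else 0 := by
  split_ifs with hn
  · simp [hn]
  · have h0 : (n * Complex.I : ℂ) ≠ 0 := by simp [hn]
    rw [integral_circ]
    have : ∀ θ : ℝ, Complex.exp (n * θ * Complex.I) = Complex.exp ((n * Complex.I) * θ) := by
      intro θ; congr 1; ring
    simp_rw [this]
    rw [integral_exp_mul_complex h0]
    have h1 : Complex.exp (n * Complex.I * (Real.pi : ℝ)) =
        Complex.exp (n * Complex.I * ((-Real.pi : ℝ) : ℂ)) := by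
      rw [Complex.exp_eq_exp_iff_exists_int]
      exact ⟨n, by push_cast; ring⟩
    rw [h1]; simp

lemma integrable_circ_of_continuous {E : Type*} [NormedAddCommGroup E] {f : ℝ → E}
    (hf : Continuous f) : Integrable f circ :=
  integrable_circ_iff.mpr (hf.intervalIntegrable _ _)

/-! ### Mahler measure -/

/-- The point `e^{iθ}` of the unit circle. -/
def cis (θ : ℝ) : ℂ := Complex.exp (θ * Complex.I)

lemma continuous_cis : Continuous cis := by unfold cis; fun_prop

lemma norm_cis (θ : ℝ) : ‖cis θ‖ = 1 := Complex.norm_exp_ofReal_mul_I θ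

lemma circleMap_eq_cis (θ : ℝ) : circleMap 0 1 θ = cis θ := by simp [circleMap, cis]

lemma cis_periodic : Function.Periodic cis (2 * Real.pi) := by
  intro θ; simp only [← circleMap_eq_cis]; exact periodic_circleMap 0 1 θ

lemma integrable_log_norm_eval_cis (p : Polynomial ℂ) :
    Integrable (fun θ ↦ Real.log ‖p.eval (cis θ)‖) circ := by
  have h := p.intervalIntegrable_mahlerMeasure
  simp only [circleMap_eq_cis] at h
  have hp : Function.Periodic (fun θ ↦ Real.log ‖p.eval (cis θ)‖) (2 * Real.pi) :=
    cis_periodic.comp fun z ↦ Real.log ‖p.eval z‖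
  exact integrable_circ_iff.mpr <| hp.intervalIntegrable₀ (by simp [Real.pi_ne_zero]) h _ _

/-- By Jensen's formula the Mahler measure of a monic polynomial is the product of max(1, |root|),
hence at least 1. Periodicity moves the interval from [0, 2π] to [-π, π]. -/
lemma integral_log_norm_eval_cis_nonneg {p : Polynomial ℂ} (hp : p.Monic) :
    0 ≤ ∫ θ, Real.log ‖p.eval (cis θ)‖ ∂circ := by
  have h := Polynomial.one_le_mahlerMeasure_of_one_le_norm_leadingCoeff (p := p)
    (by simp [hp.leadingCoeff])
  rw [Polynomial.mahlerMeasure_def_of_ne_zero hp.ne_zero, Real.one_le_exp_iff] at h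
  simp only [circleMap_eq_cis] at h
  have hper : Function.Periodic (fun θ ↦ Real.log ‖p.eval (cis θ)‖) (2 * Real.pi) :=
    cis_periodic.comp fun z ↦ Real.log ‖p.eval z‖
  have h2 := hper.intervalIntegral_add_eq (-Real.pi) 0
  rw [integral_circ, smul_eq_mul, one_div]
  rw [show -Real.pi + 2 * Real.pi = Real.pi by ring, zero_add] at h2
  rwa [h2]

/-- There are finitely many roots, and θ ↦ e^{iθ} is injective on (-π, π]. -/
lemma ae_eval_cis_ne_zero {p : Polynomial ℂ} (hp : p ≠ 0) : ∀ᵐ θ ∂circ, p.eval (cis θ) ≠ 0 := by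
  have hfin : {θ | θ ∈ Set.Ioc (-Real.pi) Real.pi ∧ p.eval (cis θ) = 0}.Finite := by
    refine Set.Finite.of_finite_image (f := cis) (p.rootSet_finite ℂ |>.subset ?_) ?_
    · rintro _ ⟨θ, ⟨-, h⟩, rfl⟩
      rw [Polynomial.mem_rootSet]
      exact ⟨hp, by simpa using h⟩
    · intro a ha b hb hab
      have h1 := Complex.arg_exp_mul_I a
      have h2 := Complex.arg_exp_mul_I b
      unfold cis at hab
      rw [hab, h2, (toIocMod_eq_self _).mpr, (toIocMod_eq_self _).mpr] at h1
      · exact h1.symm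
      · rw [show -Real.pi + 2 * Real.pi = Real.pi by ring]; exact ha.1
      · rw [show -Real.pi + 2 * Real.pi = Real.pi by ring]; exact hb.1
  rw [ae_circ_iff, ae_restrict_iff' measurableSet_Ioc]
  filter_upwards [(measure_eq_zero_iff_ae_notMem (μ := volume)).mp (hfin.measure_zero volume)]
    with θ hθ hI h
  exact hθ ⟨hI, h⟩

lemma exp_integral_le {μ : Measure ℝ} [IsProbabilityMeasure μ] {f : ℝ → ℝ} (hf : Integrable f μ)
    (he : Integrable (fun θ ↦ Real.exp (f θ)) μ) :
    Real.exp (∫ θ, f θ ∂μ) ≤ ∫ θ, Real.exp (f θ) ∂μ :=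
  convexOn_exp.map_integral_le Real.continuous_exp.continuousOn isClosed_univ (by simp) hf he

lemma continuous_eval_cis (p : Polynomial ℂ) : Continuous fun θ ↦ p.eval (cis θ) :=
  p.continuous.comp continuous_cis

lemma integrable_norm_eval_cis_sq_mul {S : ℝ → ℝ} (hS : Integrable S circ) (p : Polynomial ℂ) :
    Integrable (fun θ ↦ ‖p.eval (cis θ)‖ ^ 2 * S θ) circ := by
  obtain ⟨C, hC⟩ := (isCompact_sphere (0 : ℂ) 1).exists_bound_of_continuousOn
    (p.continuous.continuousOn)
  refine hS.bdd_mul (c := C ^ 2) ?_ ?_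
  · exact ((continuous_eval_cis p).norm.pow 2).aestronglyMeasurable
  · refine ae_of_all _ fun θ ↦ ?_
    have := hC (cis θ) (by simp [norm_cis])
    rw [Real.norm_eq_abs, abs_of_nonneg (by positivity)]
    gcongr

/-- The prediction error of a monic polynomial is at least the geometric mean of the density. -/
lemma exp_integral_log_le_of_monic {S : ℝ → ℝ} (hS : Integrable S circ)
    (hpos : ∀ᵐ θ ∂circ, 0 < S θ) (hlog : Integrable (fun θ ↦ Real.log (S θ)) circ)
    {p : Polynomial ℂ} (hp : p.Monic) :
    Real.exp (∫ θ, Real.log (S θ) ∂circ) ≤ ∫ θ, ‖p.eval (cis θ)‖ ^ 2 * S θ ∂circ := by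
  have hi := integrable_log_norm_eval_cis p
  have hexp : (fun θ ↦ Real.exp (2 * Real.log ‖p.eval (cis θ)‖ + Real.log (S θ))) =ᵐ[circ]
      fun θ ↦ ‖p.eval (cis θ)‖ ^ 2 * S θ := by
    filter_upwards [hpos, ae_eval_cis_ne_zero hp.ne_zero] with θ h1 h2
    rw [Real.exp_add, Real.exp_log h1, two_mul, Real.exp_add, Real.exp_log (norm_pos_iff.mpr h2), sq]
  have h := exp_integral_le ((hi.const_mul 2).add hlog)
    ((integrable_norm_eval_cis_sq_mul hS p).congr hexp.symm)
  rw [← integral_congr_ae hexp]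
  refine le_trans (Real.exp_le_exp.mpr ?_) h
  simp only [Pi.add_apply]
  rw [integral_add (hi.const_mul 2) hlog, integral_const_mul]
  linarith [integral_log_norm_eval_cis_nonneg hp]

/-! ### Szegő's theorem: approximation of the geometric mean -/

lemma cis_neg_pow (θ : ℝ) (k : ℕ) :
    cis (-θ) ^ k = Complex.exp (((-(k : ℤ) : ℤ) : ℂ) * θ * Complex.I) := by
  rw [cis, ← Complex.exp_nat_mul]
  congr 1; push_cast; ring

lemma integral_eval_cis_neg (g : Polynomial ℂ) :
    ∫ θ, g.eval (cis (-θ)) ∂circ = g.coeff 0 := by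
  induction g using Polynomial.induction_on' with
  | add p q hp hq =>
    simp only [Polynomial.eval_add, Polynomial.coeff_add]
    rw [integral_add, hp, hq]
    · exact integrable_circ_of_continuous ((continuous_eval_cis p).comp continuous_neg)
    · exact integrable_circ_of_continuous ((continuous_eval_cis q).comp continuous_neg)
  | monomial n a =>
    simp only [Polynomial.eval_monomial, cis_neg_pow]
    rw [integral_const_mul, integral_circ_exp]
    by_cases hn : n = 0 <;> simp [hn, Polynomial.coeff_monomial]

/-- `r` is a lower bound for the prediction errors under the spectral density `S`. -/
def IsPredBound (S : ℝ → ℝ) (r : ℝ) : Prop :=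
  ∀ p : Polynomial ℂ, p.coeff 0 = 1 → r ≤ ∫ θ, ‖p.eval (cis (-θ))‖ ^ 2 * S θ ∂circ

/-- The function exp(g - g(0)) takes the value 1 at 0, and so do its Taylor truncations in g - g(0).
These truncations are polynomials to which the bound applies, and they are uniformly bounded on the
circle, so dominated convergence applies. -/
lemma IsPredBound.le_of_polynomial {S : ℝ → ℝ} (hS : Integrable S circ) {r : ℝ}
    (hr : IsPredBound S r) (g : Polynomial ℂ) :
    r ≤ Real.exp (-(2 * (g.coeff 0).re)) * ∫ θ, Real.exp (2 * (g.eval (cis (-θ))).re) * S θ ∂circ := by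
  set g' := g - Polynomial.C (g.coeff 0) with hg'
  obtain ⟨B, hB⟩ := (isCompact_sphere (0 : ℂ) 1).exists_bound_of_continuousOn
    (g'.continuous.continuousOn)
  let p : ℕ → Polynomial ℂ := fun m ↦
    ∑ k ∈ Finset.range (m + 1), Polynomial.C ((k.factorial : ℂ)⁻¹) * g' ^ k
  have hp0 : ∀ m, (p m).coeff 0 = 1 := by
    intro m
    simp only [p, Polynomial.coeff_zero_eq_eval_zero, Polynomial.eval_finsetSum,
      Polynomial.eval_mul, Polynomial.eval_C, Polynomial.eval_pow]
    have : Polynomial.eval 0 g' = 0 := by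
      simp [hg', Polynomial.coeff_zero_eq_eval_zero]
    rw [this, Finset.sum_range_succ']
    simp
  have hpe : ∀ m x, (p m).eval x = ∑ k ∈ Finset.range (m + 1), (k.factorial : ℂ)⁻¹ * g'.eval x ^ k := by
    intro m x
    simp [p, Polynomial.eval_finsetSum]
  have hlim : ∀ x, Tendsto (fun m ↦ (p m).eval x) atTop (𝓝 (Complex.exp (g'.eval x))) := by
    intro x
    simp only [hpe]
    have := (NormedSpace.expSeries_div_hasSum_exp (𝔸 := ℂ) (g'.eval x)).tendsto_sum_nat
    rw [← Complex.exp_eq_exp_ℂ] at this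
    simpa [div_eq_inv_mul, Function.comp_def] using this.comp (tendsto_add_atTop_nat 1)
  have hbd : ∀ m θ, ‖(p m).eval (cis θ)‖ ≤ Real.exp B := by
    intro m θ
    have h1 := hB (cis θ) (by simp [norm_cis])
    rw [hpe]
    refine (norm_sum_le _ _).trans (le_trans ?_ (Real.sum_le_exp_of_nonneg ((norm_nonneg _).trans h1) (m + 1)))
    refine Finset.sum_le_sum fun k _ ↦ ?_
    rw [norm_mul, norm_pow, norm_inv, Complex.norm_natCast, div_eq_inv_mul]
    gcongr
  have hint : Tendsto (fun m ↦ ∫ θ, ‖(p m).eval (cis (-θ))‖ ^ 2 * S θ ∂circ) atTop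
      (𝓝 (∫ θ, ‖Complex.exp (g'.eval (cis (-θ)))‖ ^ 2 * S θ ∂circ)) := by
    refine tendsto_integral_of_dominated_convergence (fun θ ↦ Real.exp B ^ 2 * ‖S θ‖) ?_
      (hS.norm.const_mul _) ?_ ?_
    · intro m
      exact ((((continuous_eval_cis (p m)).comp continuous_neg).norm.pow 2).aestronglyMeasurable).mul
        hS.aestronglyMeasurable
    · intro m
      refine ae_of_all _ fun θ ↦ ?_
      rw [norm_mul, Real.norm_eq_abs, abs_of_nonneg (by positivity)]
      gcongr
      exact hbd m (-θ)
    · exact ae_of_all _ fun θ ↦ (((hlim (cis (-θ))).norm.pow 2).mul_const _)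
  refine (ge_of_tendsto' hint fun m ↦ hr _ (hp0 m)).trans (le_of_eq ?_)
  rw [← integral_const_mul]
  refine integral_congr_ae (ae_of_all _ fun θ ↦ ?_)
  simp only [Complex.norm_exp, hg', Polynomial.eval_sub, Polynomial.eval_C, Complex.sub_re]
  rw [← mul_assoc, ← Real.exp_add, ← Real.exp_nat_mul]
  congr 2
  push_cast; ring

/-- Continuous functions on the unit circle are uniform limits of real parts of polynomials. -/
lemma exists_polynomial_re_approx {G : ℂ → ℝ} (hG : Continuous G) {ε : ℝ} (hε : 0 < ε) :
    ∃ g : Polynomial ℂ, ∀ θ : ℝ, |G (cis θ) - (g.eval (cis (-θ))).re| ≤ ε := by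
  have : Fact (0 < 2 * Real.pi) := ⟨Real.two_pi_pos⟩
  have hcis : ∀ θ : ℝ, ((AddCircle.toCircle (θ : AddCircle (2 * Real.pi)) : Circle) : ℂ) = cis θ := by
    intro θ
    rw [AddCircle.toCircle_apply_mk, Circle.coe_exp, cis]
    congr 2
    have := Real.pi_ne_zero
    field_simp
  let h : C(AddCircle (2 * Real.pi), ℂ) :=
    ⟨fun a ↦ (G (AddCircle.toCircle a : Circle) : ℂ), by
      exact Complex.continuous_ofReal.comp (hG.comp (continuous_subtype_val.comp AddCircle.continuous_toCircle))⟩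
  have hmem : h ∈ closure (Submodule.span ℂ (Set.range (@fourier (2 * Real.pi))) : Set _) := by
    rw [← Submodule.topologicalClosure_coe, span_fourier_closure_eq_top]; trivial
  obtain ⟨q, hq, hdist⟩ := Metric.mem_closure_iff.mp hmem ε hε
  -- A nonnegative frequency is the conjugate of a power of e^{-iθ}, a nonpositive one is such a
  -- power. Real parts do not see the conjugation, so g₁ + g₂ is the required polynomial.
  have hrep : ∃ g₁ g₂ : Polynomial ℂ, ∀ θ : ℝ, q (θ : AddCircle (2 * Real.pi)) =
      g₁.eval (cis (-θ)) + (starRingEnd ℂ) (g₂.eval (cis (-θ))) := by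
    refine Submodule.span_induction (p := fun q _ ↦ ∃ g₁ g₂ : Polynomial ℂ, ∀ θ : ℝ,
      q (θ : AddCircle (2 * Real.pi)) =
        g₁.eval (cis (-θ)) + (starRingEnd ℂ) (g₂.eval (cis (-θ)))) ?_ ?_ ?_ ?_ hq
    · rintro _ ⟨n, rfl⟩
      have hf : ∀ θ : ℝ, fourier n (θ : AddCircle (2 * Real.pi)) = cis θ ^ n := by
        intro θ
        rw [fourier_apply, AddCircle.toCircle_zsmul, Circle.coe_zpow, hcis]
      have hinv : ∀ θ : ℝ, cis (-θ) = (cis θ)⁻¹ := by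
        intro θ; rw [cis, cis, ← Complex.exp_neg]; congr 1; push_cast; ring
      have hconj : ∀ θ : ℝ, (starRingEnd ℂ) (cis (-θ)) = cis θ := by
        intro θ
        rw [cis, cis, ← Complex.exp_conj]; simp
      rcases Int.eq_nat_or_neg n with ⟨k, rfl | rfl⟩
      · refine ⟨0, Polynomial.X ^ k, fun θ ↦ ?_⟩
        rw [hf]; simp [hconj]
      · refine ⟨Polynomial.X ^ k, 0, fun θ ↦ ?_⟩
        rw [hf]; simp [hinv]
    · exact ⟨0, 0, fun θ ↦ by simp⟩
    · rintro x y _ _ ⟨a, b, h1⟩ ⟨c, d, h2⟩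
      refine ⟨a + c, b + d, fun θ ↦ ?_⟩
      rw [ContinuousMap.add_apply, h1, h2, Polynomial.eval_add, Polynomial.eval_add, map_add]; ring
    · rintro z x _ ⟨a, b, h1⟩
      refine ⟨Polynomial.C z * a, Polynomial.C ((starRingEnd ℂ) z) * b, fun θ ↦ ?_⟩
      rw [ContinuousMap.smul_apply, h1]
      simp; ring
  obtain ⟨g₁, g₂, hg⟩ := hrep
  refine ⟨g₁ + g₂, fun θ ↦ ?_⟩
  have h1 := (ContinuousMap.dist_apply_le_dist (f := h) (g := q) (θ : AddCircle (2 * Real.pi))).trans hdist.le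
  rw [dist_eq_norm] at h1
  refine le_trans ?_ ((Complex.abs_re_le_norm _).trans h1)
  rw [Complex.sub_re, hg θ]
  simp [h, hcis]

/-- The mean of Re g over the circle is Re g(0), so `IsPredBound.le_of_polynomial` is already this
inequality for G = 2 Re g. A uniform approximation within δ costs a factor at most e^{2δ}. -/
lemma IsPredBound.le_of_continuous {S : ℝ → ℝ} (hS : Integrable S circ) (h0 : ∀ θ, 0 ≤ S θ) {r : ℝ}
    (hr : IsPredBound S r) {G : ℂ → ℝ} (hG : Continuous G) :
    r ≤ Real.exp (-∫ θ, G (cis θ) ∂circ) * ∫ θ, Real.exp (G (cis θ)) * S θ ∂circ := by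
  set X := Real.exp (-∫ θ, G (cis θ) ∂circ) * ∫ θ, Real.exp (G (cis θ)) * S θ ∂circ with hX
  have hGi : Integrable (fun θ ↦ G (cis θ)) circ := integrable_circ_of_continuous (hG.comp continuous_cis)
  have key : ∀ δ : ℝ, 0 < δ → r ≤ Real.exp (2 * δ) * X := by
    intro δ hδ
    -- The half compensates for the exponent 2 Re g, which comes from the squared modulus of e^g.
    obtain ⟨g, hg⟩ := exists_polynomial_re_approx (G := fun z ↦ G z / 2) (by fun_prop) (half_pos hδ)
    have hg' : ∀ θ, |G (cis θ) - 2 * (g.eval (cis (-θ))).re| ≤ δ := by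
      intro θ
      have := hg θ
      rw [abs_le] at this ⊢
      constructor <;> linarith
    have hgc : Continuous fun θ ↦ g.eval (cis (-θ)) := (continuous_eval_cis g).comp continuous_neg
    have hgi : Integrable (fun θ ↦ g.eval (cis (-θ))) circ := integrable_circ_of_continuous hgc
    have hre : ∫ θ, 2 * (g.eval (cis (-θ))).re ∂circ = 2 * (g.coeff 0).re := by
      rw [integral_const_mul, ← integral_eval_cis_neg g]
      congr 1
      exact integral_re hgi
    have hrei : Integrable (fun θ ↦ 2 * (g.eval (cis (-θ))).re) circ :=
      integrable_circ_of_continuous (by fun_prop)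
    have hbdS : ∀ {f : ℝ → ℝ}, Continuous f → Integrable (fun θ ↦ Real.exp (f θ) * S θ) circ := by
      intro f hf
      obtain ⟨C, hC⟩ := (isCompact_Icc (a := -Real.pi) (b := Real.pi)).exists_bound_of_continuousOn
        (hf.rexp.continuousOn)
      exact hS.bdd_mul (c := C) (hf.rexp.aestronglyMeasurable)
        (ae_circ_of_forall fun θ hθ ↦ hC θ (Set.Ioc_subset_Icc_self hθ))
    refine (hr.le_of_polynomial hS g).trans ?_
    have e1 : Real.exp (-(2 * (g.coeff 0).re)) ≤ Real.exp δ * Real.exp (-∫ θ, G (cis θ) ∂circ) := by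
      rw [← Real.exp_add, Real.exp_le_exp, ← hre]
      have : ∫ θ, G (cis θ) ∂circ ≤ ∫ θ, (2 * (g.eval (cis (-θ))).re + δ) ∂circ :=
        integral_mono hGi (hrei.add (integrable_const _)) fun θ ↦ by
          have := (abs_le.mp (hg' θ)).2
          simp only; linarith
      rw [integral_add hrei (integrable_const _)] at this
      simp at this ⊢; linarith
    have e2 : ∫ θ, Real.exp (2 * (g.eval (cis (-θ))).re) * S θ ∂circ ≤
        Real.exp δ * ∫ θ, Real.exp (G (cis θ)) * S θ ∂circ := by
      rw [← integral_const_mul]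
      refine integral_mono (hbdS (by fun_prop)) ((hbdS (hG.comp continuous_cis)).const_mul _)
        fun θ ↦ ?_
      simp only
      rw [← mul_assoc, ← Real.exp_add]
      refine mul_le_mul_of_nonneg_right (Real.exp_le_exp.mpr ?_) (h0 θ)
      have := (abs_le.mp (hg' θ)).1
      linarith
    calc _ ≤ (Real.exp δ * Real.exp (-∫ θ, G (cis θ) ∂circ)) *
          (Real.exp δ * ∫ θ, Real.exp (G (cis θ)) * S θ ∂circ) :=
          mul_le_mul e1 e2 (integral_nonneg fun θ ↦ mul_nonneg (Real.exp_nonneg _) (h0 θ))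
            (by positivity)
      _ = _ := by rw [hX, two_mul, Real.exp_add]; ring
  have hlim : Tendsto (fun δ : ℝ ↦ Real.exp (2 * δ) * X) (𝓝[>] 0) (𝓝 X) := by
    have : Continuous fun δ : ℝ ↦ Real.exp (2 * δ) * X := by fun_prop
    have h := this.tendsto 0
    simp only [mul_zero, Real.exp_zero, one_mul] at h
    exact h.mono_left nhdsWithin_le_nhds
  exact ge_of_tendsto hlim (eventually_nhdsWithin_of_forall fun δ hδ ↦ key δ hδ)

/-- Bounded continuous functions are dense in L¹ of the circle measure, and a subsequence converges
almost everywhere. The inequality then passes to the limit by dominated convergence. -/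
lemma IsPredBound.le_of_bounded {S : ℝ → ℝ} (hS : Integrable S circ) (h0 : ∀ θ, 0 ≤ S θ) {r : ℝ}
    (hr : IsPredBound S r) {f : ℝ → ℝ} (hf : Measurable f) {C : ℝ} (hC : ∀ θ, |f θ| ≤ C) :
    r ≤ Real.exp (-∫ θ, f θ ∂circ) * ∫ θ, Real.exp (f θ) * S θ ∂circ := by
  have hC0 : 0 ≤ C := (abs_nonneg _).trans (hC 0)
  let ν : Measure ℂ := circ.map cis
  have : IsProbabilityMeasure ν := Measure.isProbabilityMeasure_map continuous_cis.aemeasurable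
  let F : ℂ → ℝ := fun z ↦ f z.arg
  have hF : Measurable F := hf.comp Complex.measurable_arg
  have hFL : MemLp F 1 ν := MemLp.of_bound hF.aestronglyMeasurable C (ae_of_all _ fun z ↦ hC _)
  have hap : ∀ n : ℕ, ∃ g : BoundedContinuousFunction ℂ ℝ,
      eLpNorm (F - (g : ℂ → ℝ)) 1 ν ≤ ENNReal.ofReal (1 / ((n : ℝ) + 1)) := by
    intro n
    obtain ⟨g, hg, -⟩ := hFL.exists_boundedContinuous_eLpNorm_sub_le (by simp)
      (ε := ENNReal.ofReal (1 / ((n : ℝ) + 1))) (by simp; positivity)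
    exact ⟨g, hg⟩
  choose g hg using hap
  have hm : TendstoInMeasure ν (fun n ↦ (g n : ℂ → ℝ)) atTop F := by
    refine tendstoInMeasure_of_tendsto_eLpNorm (p := 1) (by simp)
      (fun n ↦ (g n).continuous.aestronglyMeasurable) hF.aestronglyMeasurable ?_
    refine tendsto_of_tendsto_of_tendsto_of_le_of_le tendsto_const_nhds ?_ (fun _ ↦ zero_le)
      (fun n ↦ (eLpNorm_sub_comm _ _ _ _).le.trans (hg n))
    rw [← ENNReal.ofReal_zero]
    exact ENNReal.tendsto_ofReal tendsto_one_div_add_atTop_nhds_zero_nat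
  obtain ⟨ns, -, hns⟩ := hm.exists_seq_tendsto_ae
  -- Clipping to [-C, C] leaves the limit unchanged and gives the uniform bound needed for
  -- domination.
  let G : ℕ → ℂ → ℝ := fun n z ↦ max (-C) (min C (g (ns n) z))
  have hGc : ∀ n, Continuous (G n) := fun n ↦
    continuous_const.max (continuous_const.min (g (ns n)).continuous)
  have hGb : ∀ n z, |G n z| ≤ C := fun n z ↦ by
    rw [abs_le]; exact ⟨le_max_left _ _, max_le (by linarith) (min_le_left _ _)⟩
  have hlim : ∀ᵐ θ ∂circ, Tendsto (fun n ↦ G n (cis θ)) atTop (𝓝 (f θ)) := by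
    have h1 := ae_of_ae_map continuous_cis.aemeasurable hns
    filter_upwards [h1, ae_circ_of_forall fun θ hθ ↦ hθ] with θ h2 h3
    have harg : (cis θ).arg = θ := by
      rw [cis, Complex.arg_exp_mul_I, toIocMod_eq_self,
        show -Real.pi + 2 * Real.pi = Real.pi by ring]
      exact h3
    have h4 : F (cis θ) = f θ := by simp only [F, harg]
    rw [h4] at h2
    have h5 := (tendsto_const_nhds (x := -C)).max ((tendsto_const_nhds (x := C)).min h2)
    have h6 := abs_le.mp (hC θ)
    rwa [min_eq_right h6.2, max_eq_right h6.1] at h5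
  have l1 : Tendsto (fun n ↦ ∫ θ, G n (cis θ) ∂circ) atTop (𝓝 (∫ θ, f θ ∂circ)) :=
    tendsto_integral_of_dominated_convergence (fun _ ↦ C)
      (fun n ↦ ((hGc n).comp continuous_cis).aestronglyMeasurable) (integrable_const _)
      (fun n ↦ ae_of_all _ fun θ ↦ hGb n _) hlim
  have l2 : Tendsto (fun n ↦ ∫ θ, Real.exp (G n (cis θ)) * S θ ∂circ) atTop
      (𝓝 (∫ θ, Real.exp (f θ) * S θ ∂circ)) := by
    refine tendsto_integral_of_dominated_convergence (fun θ ↦ Real.exp C * S θ)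
      (fun n ↦ (((hGc n).comp continuous_cis).rexp.aestronglyMeasurable).mul hS.aestronglyMeasurable)
      (hS.const_mul _) (fun n ↦ ae_of_all _ fun θ ↦ ?_) ?_
    · rw [Real.norm_eq_abs, abs_of_nonneg (mul_nonneg (Real.exp_nonneg _) (h0 θ))]
      exact mul_le_mul_of_nonneg_right (Real.exp_le_exp.mpr (abs_le.mp (hGb n _)).2) (h0 θ)
    · filter_upwards [hlim] with θ h
      exact ((Real.continuous_exp.tendsto _).comp h).mul_const _
  exact ge_of_tendsto' (((Real.continuous_exp.tendsto _).comp l1.neg).mul l2)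
    fun n ↦ hr.le_of_continuous hS h0 (hGc n)

/-- The optimal test function is -log S, which may be unbounded. With S replaced in the logarithm by
its truncation c_n to [1/(n+1), n+1], the inequality reads r ≤ exp(∫ log c_n) ∫ S/c_n, and the last
integral tends to 1. -/
lemma IsPredBound.le_exp_integral_log {S : ℝ → ℝ} (hSm : Measurable S) (hS : Integrable S circ)
    (h0 : ∀ θ, 0 ≤ S θ) (hpos : ∀ᵐ θ ∂circ, 0 < S θ)
    (hlog : Integrable (fun θ ↦ Real.log (S θ)) circ) {r : ℝ} (hr : IsPredBound S r) :
    r ≤ Real.exp (∫ θ, Real.log (S θ) ∂circ) := by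
  let c : ℕ → ℝ → ℝ := fun n θ ↦ max (1 / ((n : ℝ) + 1)) (min ((n : ℝ) + 1) (S θ))
  have hn1 : ∀ n : ℕ, 1 / ((n : ℝ) + 1) ≤ 1 := fun n ↦ by
    rw [div_le_one (by positivity)]; linarith [(Nat.cast_nonneg n : (0 : ℝ) ≤ n)]
  have hn2 : ∀ n : ℕ, (1 : ℝ) ≤ (n : ℝ) + 1 := fun n ↦ by linarith [(Nat.cast_nonneg n : (0 : ℝ) ≤ n)]
  have hn0 : ∀ n : ℕ, 0 < 1 / ((n : ℝ) + 1) := fun n ↦ by positivity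
  have hcpos : ∀ n θ, 0 < c n θ := fun n θ ↦ lt_max_of_lt_left (hn0 n)
  have hcle : ∀ n θ, c n θ ≤ (n : ℝ) + 1 := fun n θ ↦
    max_le ((hn1 n).trans (hn2 n)) (min_le_left _ _)
  have hcm : ∀ n, Measurable (c n) := fun n ↦
    measurable_const.max (measurable_const.min hSm)
  -- Truncation moves the value towards 1, so |log S| dominates all the truncated logarithms.
  have hlc : ∀ n θ, 0 < S θ → |Real.log (c n θ)| ≤ |Real.log (S θ)| := by
    intro n θ hs
    rcases le_total 1 (S θ) with h1 | h1
    · have hc1 : 1 ≤ c n θ := le_max_of_le_right (le_min (hn2 n) h1)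
      have hc2 : c n θ ≤ S θ := max_le ((hn1 n).trans h1) (min_le_right _ _)
      rw [abs_of_nonneg (Real.log_nonneg hc1), abs_of_nonneg (Real.log_nonneg h1)]
      exact Real.log_le_log (hcpos n θ) hc2
    · have hc1 : c n θ ≤ 1 := max_le (hn1 n) ((min_le_right _ _).trans h1)
      have hc2 : S θ ≤ c n θ := le_max_of_le_right (le_min (h1.trans (hn2 n)) le_rfl)
      rw [abs_of_nonpos (Real.log_nonpos (hcpos n θ).le hc1), abs_of_nonpos (Real.log_nonpos hs.le h1)]
      exact neg_le_neg (Real.log_le_log hs hc2)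
  have hclim : ∀ θ, 0 < S θ → Tendsto (fun n ↦ c n θ) atTop (𝓝 (S θ)) := by
    intro θ hs
    refine tendsto_const_nhds.congr' ?_
    have e1 : ∀ᶠ n : ℕ in atTop, S θ ≤ (n : ℝ) + 1 := by
      filter_upwards [eventually_ge_atTop ⌈S θ⌉₊] with n hn
      exact (Nat.ceil_le.mp hn).trans (by linarith)
    have e2 : ∀ᶠ n : ℕ in atTop, 1 / ((n : ℝ) + 1) < S θ :=
      tendsto_one_div_add_atTop_nhds_zero_nat.eventually_lt_const hs
    filter_upwards [e1, e2] with n h1 h2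
    simp only [c, min_eq_right h1, max_eq_right h2.le]
  have l1 : Tendsto (fun n ↦ ∫ θ, Real.log (c n θ) ∂circ) atTop (𝓝 (∫ θ, Real.log (S θ) ∂circ)) := by
    refine tendsto_integral_of_dominated_convergence (fun θ ↦ |Real.log (S θ)|)
      (fun n ↦ (hcm n).log.aestronglyMeasurable) hlog.abs (fun n ↦ ?_) ?_
    · filter_upwards [hpos] with θ h using hlc n θ h
    · filter_upwards [hpos] with θ h using (hclim θ h).log h.ne'
  have l2 : Tendsto (fun n ↦ ∫ θ, S θ / c n θ ∂circ) atTop (𝓝 1) := by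
    have : Tendsto (fun n ↦ ∫ θ, S θ / c n θ ∂circ) atTop (𝓝 (∫ θ, (1 : ℝ) ∂circ)) := by
      refine tendsto_integral_of_dominated_convergence (fun θ ↦ 1 + S θ)
        (fun n ↦ (hSm.div (hcm n)).aestronglyMeasurable) ((integrable_const _).add hS)
        (fun n ↦ ae_of_all _ fun θ ↦ ?_) ?_
      · rw [Real.norm_eq_abs, abs_of_nonneg (div_nonneg (h0 θ) (hcpos n θ).le), div_le_iff₀ (hcpos n θ)]
        rcases le_total (S θ) ((n : ℝ) + 1) with h | h
        · have : S θ ≤ c n θ := by simp only [c, min_eq_right h]; exact le_max_right _ _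
          nlinarith [h0 θ, hcpos n θ]
        · have : 1 ≤ c n θ := by simp only [c, min_eq_left h]; exact le_max_of_le_right (hn2 n)
          nlinarith [h0 θ, hcpos n θ]
      · filter_upwards [hpos] with θ h
        have := (tendsto_const_nhds (x := S θ)).div (hclim θ h) h.ne'
        rwa [div_self h.ne'] at this
    simpa using this
  have hfin := ((Real.continuous_exp.tendsto _).comp l1).mul l2
  rw [mul_one] at hfin
  refine ge_of_tendsto' hfin fun n ↦ ?_
  have hb : ∀ θ, |-Real.log (c n θ)| ≤ Real.log ((n : ℝ) + 1) := by
    intro θ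
    rw [abs_neg, abs_le, ← Real.log_inv]
    refine ⟨Real.log_le_log (by positivity) ?_, Real.log_le_log (hcpos n θ) (hcle n θ)⟩
    rw [← one_div]; exact le_max_left _ _
  have := hr.le_of_bounded hS h0 (hcm n).log.neg hb
  simp only [Pi.neg_apply, integral_neg, neg_neg] at this
  refine this.trans (le_of_eq ?_)
  simp only [Function.comp_apply]
  congr 1
  refine integral_congr_ae (ae_of_all _ fun θ ↦ ?_)
  simp only [Real.exp_neg, Real.exp_log (hcpos n θ)]
  rw [div_eq_inv_mul]

/-- **Szegő's theorem** (approximation part). -/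
theorem exists_polynomial_integral_le {S : ℝ → ℝ} (hS : Integrable S circ)
    (hpos : ∀ᵐ θ ∂circ, 0 < S θ)
    (hlog : Integrable (fun θ ↦ Real.log (S θ)) circ) {ε : ℝ} (hε : 0 < ε) :
    ∃ p : Polynomial ℂ, p.coeff 0 = 1 ∧
      ∫ θ, ‖p.eval (cis (-θ))‖ ^ 2 * S θ ∂circ ≤ Real.exp (∫ θ, Real.log (S θ) ∂circ) + ε := by
  -- If no polynomial does this well, exp ∫ log S + ε is a lower bound for all prediction errors,
  -- which the previous lemma forbids.
  by_contra! hcon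
  obtain ⟨S₁, hS₁m, hS₁⟩ := hS.aestronglyMeasurable.aemeasurable
  -- A version of the density that is measurable and nonnegative everywhere, not just almost
  -- everywhere.
  let S' : ℝ → ℝ := fun θ ↦ max 0 (S₁ θ)
  have hae : S =ᵐ[circ] S' := by
    filter_upwards [hS₁, hpos] with θ h1 h2
    simp only [S', ← h1, max_eq_right h2.le]
  have hlogae : (fun θ ↦ Real.log (S θ)) =ᵐ[circ] fun θ ↦ Real.log (S' θ) := by
    filter_upwards [hae] with θ h using by rw [h]
  have hb : IsPredBound S' (Real.exp (∫ θ, Real.log (S θ) ∂circ) + ε) := by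
    intro p hp
    refine (hcon p hp).le.trans (le_of_eq (integral_congr_ae ?_))
    filter_upwards [hae] with θ h using by rw [h]
  have := hb.le_exp_integral_log (measurable_const.max hS₁m) (hS.congr hae)
    (fun θ ↦ le_max_left _ _) (by filter_upwards [hae, hpos] with θ h1 h2; rwa [h1] at h2)
    (hlog.congr hlogae)
  rw [← integral_congr_ae hlogae] at this
  linarith

/-! ### Stationary sequences in a Hilbert space and their spectral densities -/

section Spectrum

variable {E : Type*} [NormedAddCommGroup E] [InnerProductSpace ℝ E]

/-- The sequence `x` is stationary with spectral density `S`. -/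
structure HasSpectrum (x : ℤ → E) (S : ℝ → ℝ) : Prop where
  integrable : Integrable S circ
  inner_eq : ∀ s t : ℤ, ((inner ℝ (x s) (x t) : ℝ) : ℂ) =
    ∫ θ, (S θ : ℂ) * Complex.exp (((s - t : ℤ) : ℂ) * θ * Complex.I) ∂circ

lemma norm_exp_int_mul (n : ℤ) (θ : ℝ) : ‖Complex.exp ((n : ℂ) * θ * Complex.I)‖ = 1 := by
  have := Complex.norm_exp_ofReal_mul_I ((n : ℝ) * θ)
  push_cast at this; exact this

lemma continuous_exp_int_mul (n : ℤ) :
    Continuous fun θ : ℝ ↦ Complex.exp ((n : ℂ) * θ * Complex.I) := by fun_prop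

lemma integrable_mul_exp {f : ℝ → ℂ} (hf : Integrable f circ) (n : ℤ) :
    Integrable (fun θ ↦ f θ * Complex.exp ((n : ℂ) * θ * Complex.I)) circ :=
  hf.mul_bdd (c := 1) (continuous_exp_int_mul n).aestronglyMeasurable
    (ae_of_all _ fun θ ↦ (norm_exp_int_mul n θ).le)

lemma integrable_ofReal_mul_exp {S : ℝ → ℝ} (hS : Integrable S circ) (n : ℤ) :
    Integrable (fun θ : ℝ ↦ (S θ : ℂ) * Complex.exp ((n : ℂ) * θ * Complex.I)) circ :=
  integrable_mul_exp (f := fun θ ↦ (S θ : ℂ)) hS.ofReal n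

lemma HasSpectrum.norm_sq {x : ℤ → E} {S : ℝ → ℝ} (h : HasSpectrum x S) (t : ℤ) :
    ‖x t‖ ^ 2 = ∫ θ, S θ ∂circ := by
  have := h.inner_eq t t
  rw [real_inner_self_eq_norm_sq] at this
  simp only [sub_self, Int.cast_zero, zero_mul, Complex.exp_zero, mul_one] at this
  rw [integral_complex_ofReal] at this
  exact_mod_cast this

lemma HasSpectrum.inner_shift {x : ℤ → E} {S : ℝ → ℝ} (h : HasSpectrum x S) (s t u : ℤ) :
    inner ℝ (x (s + u)) (x (t + u)) = inner ℝ (x s) (x t) := by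
  have h1 := h.inner_eq (s + u) (t + u)
  rw [show s + u - (t + u) = s - t by ring, ← h.inner_eq s t] at h1
  exact_mod_cast h1

lemma HasSpectrum.add {x y : ℤ → E} {S S' : ℝ → ℝ} (hx : HasSpectrum x S) (hy : HasSpectrum y S')
    (horth : ∀ s t, inner ℝ (x s) (y t) = 0) :
    HasSpectrum (fun t ↦ x t + y t) (fun θ ↦ S θ + S' θ) := by
  refine ⟨hx.integrable.add hy.integrable, fun s t ↦ ?_⟩
  rw [inner_add_left, inner_add_right, inner_add_right, horth, real_inner_comm (x t) (y s), horth]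
  simp only [add_zero, zero_add, Complex.ofReal_add, add_mul]
  rw [integral_add (integrable_ofReal_mul_exp hx.integrable _)
    (integrable_ofReal_mul_exp hy.integrable _), hx.inner_eq, hy.inner_eq]

/-- Termwise integration, justified by absolute summability. The sign σ covers both uses: -1 when
the filter acts on the first argument of the covariance, and +1 when it acts on the second, where
the response is conjugated. -/
lemma hasSum_integral_mul_exp {g : ℕ → ℝ} (hg : Summable fun k ↦ |g k|) {φ ĝ : ℝ → ℂ}
    (hφ : Integrable φ circ) (n : ℤ) (σ : ℤ)
    (hĝ : ∀ θ : ℝ, HasSum (fun k : ℕ ↦ (g k : ℂ) * Complex.exp (((σ * k : ℤ) : ℂ) * θ * Complex.I))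
      (ĝ θ)) :
    HasSum (fun k : ℕ ↦ (g k : ℂ) *
        ∫ θ, φ θ * Complex.exp (((n + σ * k : ℤ) : ℂ) * θ * Complex.I) ∂circ)
      (∫ θ, φ θ * ĝ θ * Complex.exp ((n : ℂ) * θ * Complex.I) ∂circ) := by
  have key := hasSum_integral_of_summable_integral_norm (μ := circ) (E := ℂ)
    (F := fun (k : ℕ) (θ : ℝ) ↦ (g k : ℂ) * (φ θ * Complex.exp (((n + σ * k : ℤ) : ℂ) * θ * Complex.I)))
    (fun k ↦ (integrable_mul_exp hφ _).const_mul _) (by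
      simp only [norm_mul, norm_exp_int_mul, mul_one, integral_const_mul, Complex.norm_real]
      exact hg.mul_right _)
  simp only [integral_const_mul] at key
  suffices he : ∫ θ, φ θ * ĝ θ * Complex.exp ((n : ℂ) * θ * Complex.I) ∂circ = ∫ θ : ℝ, ∑' k : ℕ,
      (g k : ℂ) * (φ θ * Complex.exp (((n + σ * k : ℤ) : ℂ) * θ * Complex.I)) ∂circ by
    rw [he]; exact key
  refine integral_congr_ae (ae_of_all _ fun θ ↦ ?_)
  simp only
  have h1 := ((hĝ θ).mul_left (φ θ * Complex.exp ((n : ℂ) * θ * Complex.I))).tsum_eq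
  rw [show φ θ * ĝ θ * Complex.exp ((n : ℂ) * θ * Complex.I)
    = φ θ * Complex.exp ((n : ℂ) * θ * Complex.I) * ĝ θ by ring, ← h1]
  refine tsum_congr fun k ↦ ?_
  rw [show (((n + σ * k : ℤ) : ℂ)) * θ * Complex.I
    = (n : ℂ) * θ * Complex.I + ((σ * k : ℤ) : ℂ) * θ * Complex.I by push_cast; ring, Complex.exp_add]
  ring

lemma integrable_mul_of_hasSum {g : ℕ → ℝ} (hg : Summable fun k ↦ |g k|) {φ ĝ : ℝ → ℂ}
    (hφ : Integrable φ circ)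
    (hĝ : ∀ θ : ℝ, HasSum (fun k : ℕ ↦ (g k : ℂ) * Complex.exp (-(k * θ * Complex.I))) (ĝ θ)) :
    Continuous ĝ ∧ Integrable (fun θ ↦ φ θ * ĝ θ) circ := by
  have hn : ∀ (k : ℕ) (θ : ℝ), ‖(g k : ℂ) * Complex.exp (-(k * θ * Complex.I))‖ ≤ |g k| := by
    intro k θ
    have := norm_exp_int_mul (-(k : ℤ)) θ
    push_cast at this
    rw [norm_mul, show -((k : ℂ) * θ * Complex.I) = -(k : ℂ) * θ * Complex.I by ring, this,
      mul_one, Complex.norm_real, Real.norm_eq_abs]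
  have hc : Continuous ĝ := by
    have : ĝ = fun θ : ℝ ↦ ∑' k : ℕ, (g k : ℂ) * Complex.exp (-(k * θ * Complex.I)) :=
      funext fun θ ↦ (hĝ θ).tsum_eq.symm
    rw [this]
    exact continuous_tsum (fun k ↦ by fun_prop) hg hn
  refine ⟨hc, hφ.mul_bdd (c := ∑' k, |g k|) hc.aestronglyMeasurable (ae_of_all _ fun θ ↦ ?_)⟩
  rw [← (hĝ θ).tsum_eq]
  exact tsum_of_norm_bounded hg.hasSum (hn · θ)

/-- The filter is applied to one argument of the covariance at a time: the cross-covariance of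
output and input has density S ĝ, and filtering the other argument contributes the conjugate of ĝ.
-/
lemma HasSpectrum.filter {x z : ℤ → E} {S : ℝ → ℝ} (h : HasSpectrum x S) {g : ℕ → ℝ}
    (hg : Summable fun k ↦ |g k|) {ĝ : ℝ → ℂ}
    (hĝ : ∀ θ : ℝ, HasSum (fun k : ℕ ↦ (g k : ℂ) * Complex.exp (-(k * θ * Complex.I))) (ĝ θ))
    (hz : ∀ t : ℤ, HasSum (fun k : ℕ ↦ g k • x (t - k)) (z t)) :
    HasSpectrum z (fun θ ↦ ‖ĝ θ‖ ^ 2 * S θ) := by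
  have hS : Integrable (fun θ ↦ (S θ : ℂ)) circ := h.integrable.ofReal
  obtain ⟨hc, hi⟩ := integrable_mul_of_hasSum hg hS hĝ
  have h1 : ∀ s t : ℤ, ((inner ℝ (z s) (x t) : ℝ) : ℂ) =
      ∫ θ, (S θ : ℂ) * ĝ θ * Complex.exp (((s - t : ℤ) : ℂ) * θ * Complex.I) ∂circ := by
    intro s t
    have e1 : HasSum (fun k : ℕ ↦ (g k : ℂ) * ((inner ℝ (x (s - k)) (x t) : ℝ) : ℂ))
        ((inner ℝ (z s) (x t) : ℝ) : ℂ) := by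
      have := ((hz s).mapL (innerSL ℝ (x t))).mapL Complex.ofRealCLM
      simpa [real_inner_comm] using this
    have e2 := hasSum_integral_mul_exp hg hS (s - t) (-1) (ĝ := ĝ) (fun θ ↦ by
      convert hĝ θ using 4; push_cast; ring)
    refine e1.unique ?_
    convert e2 using 3 with k
    rw [h.inner_eq, show s - k - t = s - t + -1 * k by ring]
  refine ⟨?_, fun s t ↦ ?_⟩
  · obtain ⟨C, hC⟩ := (isCompact_Icc (a := -Real.pi) (b := Real.pi)).exists_bound_of_continuousOn
      (hc.norm.pow 2).continuousOn
    exact h.integrable.bdd_mul (c := C) (hc.norm.pow 2).aestronglyMeasurable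
      (ae_circ_of_forall fun θ hθ ↦ hC θ (Set.Ioc_subset_Icc_self hθ))
  · have e1 : HasSum (fun k : ℕ ↦ (g k : ℂ) * ((inner ℝ (z s) (x (t - k)) : ℝ) : ℂ))
        ((inner ℝ (z s) (z t) : ℝ) : ℂ) := by
      have := ((hz t).mapL (innerSL ℝ (z s))).mapL Complex.ofRealCLM
      simpa using this
    have e2 := hasSum_integral_mul_exp hg hi (s - t) 1 (ĝ := fun θ ↦ (starRingEnd ℂ) (ĝ θ))
      (fun θ ↦ by
        convert (hĝ θ).map (starRingEnd ℂ) Complex.continuous_conj using 2 with k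
        simp only [Function.comp_apply, map_mul, Complex.conj_ofReal, ← Complex.exp_conj]
        congr 2; simp)
    have e3 := e1.unique (by
      convert e2 using 3 with k
      rw [h1, show s - (t - k) = s - t + 1 * k by ring])
    rw [e3]
    refine integral_congr_ae (ae_of_all _ fun θ ↦ ?_)
    simp only
    push_cast
    rw [← Complex.mul_conj']
    ring_nf

/-- The covariances are Fourier coefficients of an integrable function, so this is the
Riemann–Lebesgue lemma. An atom in the spectrum would destroy it. -/
lemma HasSpectrum.tendsto_inner_zero {x : ℤ → E} {S : ℝ → ℝ} (h : HasSpectrum x S) :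
    Tendsto (fun n : ℕ ↦ inner ℝ (x n) (x 0)) atTop (𝓝 0) := by
  have hRL := Real.tendsto_integral_exp_smul_cocompact
    ((Set.Ioc (-Real.pi) Real.pi).indicator fun θ ↦ (S θ : ℂ))
  have hw : Tendsto (fun n : ℕ ↦ (-(n / (2 * Real.pi)) : ℝ)) atTop (cocompact ℝ) := by
    refine Tendsto.mono_right ?_ atBot_le_cocompact
    exact tendsto_neg_atTop_atBot.comp
      (tendsto_natCast_atTop_atTop.atTop_div_const Real.two_pi_pos)
  have h1 := (hRL.comp hw).const_smul (1 / (2 * Real.pi))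
  rw [smul_zero] at h1
  have h2 : ∀ n : ℕ, ((inner ℝ (x n) (x 0) : ℝ) : ℂ) = (1 / (2 * Real.pi)) •
      ∫ v : ℝ, Real.fourierChar (-(v * -(n / (2 * Real.pi)))) •
        (Set.Ioc (-Real.pi) Real.pi).indicator (fun θ ↦ (S θ : ℂ)) v := by
    intro n
    rw [h.inner_eq, integral_circ, intervalIntegral.integral_of_le (by linarith [Real.pi_pos]),
      ← integral_indicator measurableSet_Ioc]
    congr 2
    ext θ
    by_cases hθ : θ ∈ Set.Ioc (-Real.pi) Real.pi
    · simp only [Set.indicator_of_mem hθ]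
      rw [Circle.smul_def, Real.fourierChar_apply, smul_eq_mul, mul_comm]
      congr 2
      have := Real.pi_ne_zero
      push_cast
      field_simp
      simp
    · simp [Set.indicator_of_notMem hθ]
  have h3 : Tendsto (fun n : ℕ ↦ ((inner ℝ (x n) (x 0) : ℝ) : ℂ)) atTop (𝓝 0) := by
    simp_rw [h2]; exact h1
  have h4 := (Complex.continuous_re.tendsto _).comp h3
  simpa [Function.comp_def] using h4

/-- The spectral isometry on trigonometric polynomials. -/
lemma HasSpectrum.integral_norm_sq {x : ℤ → E} {S : ℝ → ℝ} (h : HasSpectrum x S) {ι : Type*}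
    (F : Finset ι) (c : ι → ℂ) (τ : ι → ℤ) :
    ∫ θ, ‖∑ i ∈ F, c i * Complex.exp ((τ i : ℂ) * θ * Complex.I)‖ ^ 2 * S θ ∂circ =
      ‖∑ i ∈ F, (c i).re • x (τ i)‖ ^ 2 + ‖∑ i ∈ F, (c i).im • x (τ i)‖ ^ 2 := by
  have h1 : ((∫ θ, ‖∑ i ∈ F, c i * Complex.exp ((τ i : ℂ) * θ * Complex.I)‖ ^ 2 * S θ ∂circ : ℝ) : ℂ)
      = ∑ i ∈ F, ∑ j ∈ F, c i * (starRingEnd ℂ) (c j) * (inner ℝ (x (τ i)) (x (τ j)) : ℝ) := by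
    rw [← integral_complex_ofReal]
    have : ∀ θ : ℝ, ((‖∑ i ∈ F, c i * Complex.exp ((τ i : ℂ) * θ * Complex.I)‖ ^ 2 * S θ : ℝ) : ℂ) =
        ∑ i ∈ F, ∑ j ∈ F, c i * (starRingEnd ℂ) (c j) *
          ((S θ : ℂ) * Complex.exp (((τ i - τ j : ℤ) : ℂ) * θ * Complex.I)) := by
      intro θ
      push_cast
      rw [← Complex.mul_conj', map_sum, Finset.sum_mul_sum, Finset.sum_mul]
      refine Finset.sum_congr rfl fun i _ ↦ ?_
      rw [Finset.sum_mul]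
      refine Finset.sum_congr rfl fun j _ ↦ ?_
      rw [map_mul, ← Complex.exp_conj, show ((τ i : ℂ) - τ j) * θ * Complex.I
        = (τ i : ℂ) * θ * Complex.I + (starRingEnd ℂ) ((τ j : ℂ) * θ * Complex.I) by
          simp; ring, Complex.exp_add]
      ring
    simp_rw [this]
    rw [integral_finsetSum _ fun i _ ↦ integrable_finsetSum _ fun j _ ↦
      (integrable_ofReal_mul_exp h.integrable _).const_mul _]
    refine Finset.sum_congr rfl fun i _ ↦ ?_
    rw [integral_finsetSum _ fun j _ ↦ (integrable_ofReal_mul_exp h.integrable _).const_mul _]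
    refine Finset.sum_congr rfl fun j _ ↦ ?_
    rw [integral_const_mul, h.inner_eq]
  have h2 : ∀ a : ι → ℝ, ‖∑ i ∈ F, a i • x (τ i)‖ ^ 2 =
      ∑ i ∈ F, ∑ j ∈ F, a i * a j * inner ℝ (x (τ i)) (x (τ j)) := by
    intro a
    rw [← real_inner_self_eq_norm_sq, sum_inner]
    refine Finset.sum_congr rfl fun i _ ↦ ?_
    rw [inner_sum]
    refine Finset.sum_congr rfl fun j _ ↦ ?_
    rw [real_inner_smul_left, real_inner_smul_right]; ring
  -- The inner products are real, and the real part of c_i times the conjugate of c_j is the sum of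
  -- the products of real parts and of imaginary parts.
  have h3 := congrArg Complex.re h1
  rw [Complex.ofReal_re] at h3
  rw [h3, h2, h2, Complex.re_sum, ← Finset.sum_add_distrib]
  refine Finset.sum_congr rfl fun i _ ↦ ?_
  rw [Complex.re_sum, ← Finset.sum_add_distrib]
  refine Finset.sum_congr rfl fun j _ ↦ ?_
  simp
  ring

/-- The coefficients are read in reverse order, so that d 0 = 1 becomes the leading coefficient. The
spectral isometry turns the norm into ∫ |p|² S with p monic, to which the Mahler measure bound
applies. -/
lemma HasSpectrum.le_norm_sq_sum {x : ℤ → E} {S : ℝ → ℝ} (h : HasSpectrum x S)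
    (hpos : ∀ᵐ θ ∂circ, 0 < S θ) (hlog : Integrable (fun θ ↦ Real.log (S θ)) circ)
    (t : ℤ) (N : ℕ) (d : ℕ → ℝ) (hd : d 0 = 1) :
    Real.exp (∫ θ, Real.log (S θ) ∂circ) ≤ ‖∑ i ∈ Finset.range (N + 1), d i • x (t - i)‖ ^ 2 := by
  let p : Polynomial ℂ :=
    ∑ i ∈ Finset.range (N + 1), Polynomial.C (d i : ℂ) * Polynomial.X ^ (N - i)
  have hp : p.Monic := by
    refine Polynomial.monic_of_natDegree_le_of_coeff_eq_one N ?_ ?_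
    · exact Polynomial.natDegree_sum_le_of_forall_le _ _ fun i _ ↦
        (Polynomial.natDegree_C_mul_X_pow_le _ _).trans (Nat.sub_le _ _)
    · simp only [p, Polynomial.finsetSum_coeff, Polynomial.coeff_C_mul, Polynomial.coeff_X_pow]
      rw [Finset.sum_eq_single 0]
      · simp [hd]
      · intro i hi hi0
        rw [if_neg, mul_zero]
        have := Finset.mem_range.mp hi
        omega
      · simp
  refine (exp_integral_log_le_of_monic h.integrable hpos hlog hp).trans (le_of_eq ?_)
  have h1 := h.integral_norm_sq (Finset.range (N + 1)) (fun i ↦ (d i : ℂ)) fun i ↦ t - i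
  simp only [Complex.ofReal_re, Complex.ofReal_im, zero_smul, Finset.sum_const_zero, norm_zero,
    ne_eq, OfNat.ofNat_ne_zero, not_false_eq_true, zero_pow, add_zero] at h1
  rw [← h1]
  refine integral_congr_ae (ae_of_all _ fun θ ↦ ?_)
  simp only
  congr 2
  have h2 : p.eval (cis θ) = Complex.exp (((N - t : ℤ) : ℂ) * θ * Complex.I) *
      ∑ i ∈ Finset.range (N + 1), (d i : ℂ) * Complex.exp (((t - i : ℤ) : ℂ) * θ * Complex.I) := by
    simp only [p, Polynomial.eval_finsetSum, Polynomial.eval_mul, Polynomial.eval_C,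
      Polynomial.eval_pow, Polynomial.eval_X]
    rw [Finset.mul_sum]
    refine Finset.sum_congr rfl fun i hi ↦ ?_
    rw [mul_left_comm, ← Complex.exp_add, cis, ← Complex.exp_nat_mul]
    congr 2
    rw [Nat.cast_sub (by have := Finset.mem_range.mp hi; omega)]
    push_cast; ring
  rw [h2, norm_mul, norm_exp_int_mul, one_mul]

lemma exists_sum_range_of_mem_span {x : ℤ → E} {t : ℤ} {y : E}
    (hy : y ∈ Submodule.span ℝ (Set.range fun k : ℕ ↦ x (t - 1 - k))) :
    ∃ (N : ℕ) (d : ℕ → ℝ), d 0 = 1 ∧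
      x t - y = ∑ i ∈ Finset.range (N + 1), d i • x (t - i) := by
  obtain ⟨c, rfl⟩ := Finsupp.mem_span_range_iff_exists_finsupp.mp hy
  obtain ⟨N, hN⟩ := c.support.exists_nat_subset_range
  refine ⟨N, fun i ↦ if i = 0 then 1 else -c (i - 1), by simp, ?_⟩
  rw [Finset.sum_range_succ', Finsupp.sum_of_support_subset c hN _ (by simp)]
  simp only [Nat.add_eq_zero_iff, one_ne_zero, and_false, if_false, Nat.add_sub_cancel, if_true,
    one_smul, Nat.cast_zero, sub_zero, neg_smul, Finset.sum_neg_distrib]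
  rw [add_comm, ← sub_eq_add_neg]
  congr 1
  refine Finset.sum_congr rfl fun i _ ↦ ?_
  congr 2; push_cast; ring

/-- The one-step prediction error is at least the geometric mean of the spectral density. -/
lemma HasSpectrum.le_norm_sub_sq {x : ℤ → E} {S : ℝ → ℝ} (h : HasSpectrum x S)
    (hpos : ∀ᵐ θ ∂circ, 0 < S θ) (hlog : Integrable (fun θ ↦ Real.log (S θ)) circ)
    {t : ℤ} {y : E}
    (hy : y ∈ closure (Submodule.span ℝ (Set.range fun k : ℕ ↦ x (t - 1 - k)) : Set E)) :
    Real.exp (∫ θ, Real.log (S θ) ∂circ) ≤ ‖x t - y‖ ^ 2 := by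
  have hcl : IsClosed {y : E | Real.exp (∫ θ, Real.log (S θ) ∂circ) ≤ ‖x t - y‖ ^ 2} :=
    isClosed_le continuous_const (by fun_prop)
  refine closure_minimal ?_ hcl hy
  intro y hy
  obtain ⟨N, d, hd, he⟩ := exists_sum_range_of_mem_span hy
  rw [Set.mem_ofPred_eq, he]
  exact h.le_norm_sq_sum hpos hlog t N d hd

/-- Finite linear predictors come arbitrarily close to the geometric mean of the spectral density. -/
lemma HasSpectrum.exists_predictor {x : ℤ → E} {S : ℝ → ℝ} (h : HasSpectrum x S)
    (hpos : ∀ᵐ θ ∂circ, 0 < S θ) (hlog : Integrable (fun θ ↦ Real.log (S θ)) circ)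
    {ε : ℝ} (hε : 0 < ε) :
    ∃ (N : ℕ) (c : ℕ → ℝ), ∀ t : ℤ,
      ‖x t - ∑ k ∈ Finset.range N, c k • x (t - 1 - k)‖ ^ 2 ≤
        Real.exp (∫ θ, Real.log (S θ) ∂circ) + ε := by
  obtain ⟨p, hp0, hp⟩ := exists_polynomial_integral_le h.integrable hpos hlog hε
  -- Szegő's polynomial may be complex. Its integral is the sum of the squared errors made by the
  -- real and the imaginary parts of the coefficients, so dropping the imaginary parts can only
  -- help; p(0) = 1 is kept.
  refine ⟨p.natDegree, fun k ↦ -(p.coeff (k + 1)).re, fun t ↦ le_trans ?_ hp⟩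
  have h1 := h.integral_norm_sq (Finset.range (p.natDegree + 1)) (fun i ↦ p.coeff i) fun i ↦ t - i
  have h2 : ∫ θ, ‖p.eval (cis (-θ))‖ ^ 2 * S θ ∂circ = ∫ θ, ‖∑ i ∈ Finset.range (p.natDegree + 1),
      p.coeff i * Complex.exp (((t - i : ℤ) : ℂ) * θ * Complex.I)‖ ^ 2 * S θ ∂circ := by
    refine integral_congr_ae (ae_of_all _ fun θ ↦ ?_)
    simp only
    congr 2
    have h3 : ∑ i ∈ Finset.range (p.natDegree + 1),
        p.coeff i * Complex.exp (((t - i : ℤ) : ℂ) * θ * Complex.I) =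
        Complex.exp ((t : ℂ) * θ * Complex.I) * p.eval (cis (-θ)) := by
      rw [Polynomial.eval_eq_sum_range, Finset.mul_sum]
      refine Finset.sum_congr rfl fun i _ ↦ ?_
      rw [cis_neg_pow, mul_left_comm, ← Complex.exp_add]
      congr 2; push_cast; ring
    rw [h3, norm_mul, norm_exp_int_mul, one_mul]
  rw [h2, h1]
  refine le_add_of_le_of_nonneg (le_of_eq ?_) (by positivity)
  congr 2
  rw [Finset.sum_range_succ', add_comm]
  simp only [hp0, Complex.one_re, one_smul, Nat.cast_zero, sub_zero, neg_smul,
    Finset.sum_neg_distrib, sub_neg_eq_add]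
  congr 1
  refine Finset.sum_congr rfl fun i _ ↦ ?_
  congr 2; push_cast; ring

end Spectrum

/-! ### Gaussian subspaces of `L²` -/

section GaussSpace

variable {Ω : Type*} [MeasurableSpace Ω] {P : Measure Ω} [IsProbabilityMeasure P]

/-- The value at `1` of the characteristic function of an element of `L²`. -/
def charOne (x : Lp ℝ 2 P) : ℂ := ∫ ω, Complex.exp ((x ω : ℂ) * Complex.I) ∂P

/-- A subspace of `L²` all of whose elements are centered Gaussian random variables. -/
def IsGaussSpace (K : Submodule ℝ (Lp ℝ 2 P)) : Prop :=
  ∀ x ∈ K, charOne x = Complex.exp ((-(‖x‖ ^ 2 / 2) : ℝ) : ℂ)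

lemma integrable_cexp_mul_I {f : Ω → ℝ} (hf : AEStronglyMeasurable f P) :
    Integrable (fun ω ↦ Complex.exp ((f ω : ℂ) * Complex.I)) P := by
  refine Integrable.of_bound (C := 1) ?_ (ae_of_all _ fun ω ↦ (Complex.norm_exp_ofReal_mul_I _).le)
  exact (by fun_prop : Continuous fun r : ℝ ↦ Complex.exp ((r : ℂ) * Complex.I)).comp_aestronglyMeasurable hf

omit [IsProbabilityMeasure P] in
lemma charOne_congr {x : Lp ℝ 2 P} {f : Ω → ℝ} (h : x =ᵐ[P] f) :
    charOne x = ∫ ω, Complex.exp ((f ω : ℂ) * Complex.I) ∂P := by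
  refine integral_congr_ae ?_
  filter_upwards [h] with ω hω using by rw [hω]

lemma integral_abs_le_norm (x : Lp ℝ 2 P) : ∫ ω, |x ω| ∂P ≤ ‖x‖ := by
  have h1 := eLpNorm_le_eLpNorm_of_exponent_le (μ := P) (p := 1) (q := 2) (by norm_num)
    (Lp.aestronglyMeasurable x)
  have h2 : ∫ ω, |x ω| ∂P = (eLpNorm x 1 P).toReal := by
    rw [eLpNorm_one_eq_lintegral_enorm, ← integral_norm_eq_lintegral_enorm (Lp.aestronglyMeasurable x)]
    rfl
  rw [h2, Lp.norm_def]
  exact ENNReal.toReal_mono (Lp.eLpNorm_ne_top x) h1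

lemma norm_exp_sub_exp_le (a b : ℝ) :
    ‖Complex.exp ((a : ℂ) * Complex.I) - Complex.exp ((b : ℂ) * Complex.I)‖ ≤ |a - b| := by
  have h : Complex.exp ((a : ℂ) * Complex.I) - Complex.exp ((b : ℂ) * Complex.I) =
      Complex.exp ((b : ℂ) * Complex.I) * (Complex.exp (Complex.I * ((a - b : ℝ) : ℂ)) - 1) := by
    rw [mul_sub, ← Complex.exp_add, mul_one]
    congr 2; push_cast; ring
  rw [h, norm_mul, Complex.norm_exp_ofReal_mul_I, one_mul]
  exact Real.norm_exp_I_mul_ofReal_sub_one_le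

lemma integrable_coe (x : Lp ℝ 2 P) : Integrable x P :=
  (Lp.memLp x).integrable (by norm_num)

/-- The map is 1-Lipschitz, because |e^{ia} - e^{ib}| ≤ |a - b| and the L¹ norm is at most the L²
norm. Being centered Gaussian is therefore a closed condition on subspaces of L². -/
lemma continuous_charOne : Continuous (charOne (P := P)) := by
  refine LipschitzWith.continuous (K := 1) (LipschitzWith.of_dist_le_mul fun x y ↦ ?_)
  rw [dist_eq_norm, dist_eq_norm, NNReal.coe_one, one_mul, charOne, charOne,
    ← integral_sub (integrable_cexp_mul_I (Lp.aestronglyMeasurable x))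
      (integrable_cexp_mul_I (Lp.aestronglyMeasurable y))]
  refine (norm_integral_le_integral_norm _).trans (le_trans ?_ (integral_abs_le_norm (x - y)))
  refine integral_mono_ae ((integrable_cexp_mul_I (Lp.aestronglyMeasurable x)).sub
      (integrable_cexp_mul_I (Lp.aestronglyMeasurable y))).norm (integrable_coe (x - y)).abs ?_
  filter_upwards [Lp.coeFn_sub x y] with ω h
  rw [h]
  exact norm_exp_sub_exp_le _ _

lemma IsGaussSpace.topologicalClosure {K : Submodule ℝ (Lp ℝ 2 P)} (hK : IsGaussSpace K) :
    IsGaussSpace K.topologicalClosure := by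
  intro x hx
  have hcl : IsClosed {x : Lp ℝ 2 P | charOne x = Complex.exp ((-(‖x‖ ^ 2 / 2) : ℝ) : ℂ)} :=
    isClosed_eq continuous_charOne (by fun_prop)
  exact closure_minimal hK hcl hx

omit [IsProbabilityMeasure P] in
lemma IsGaussSpace.mono {K K' : Submodule ℝ (Lp ℝ 2 P)} (hK : IsGaussSpace K) (h : K' ≤ K) :
    IsGaussSpace K' := fun x hx ↦ hK x (h hx)

omit [IsProbabilityMeasure P] in
lemma norm_sq_eq_integral_sq {x : Lp ℝ 2 P} {f : Ω → ℝ} (h : x =ᵐ[P] f) :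
    ‖x‖ ^ 2 = ∫ ω, f ω ^ 2 ∂P := by
  rw [← real_inner_self_eq_norm_sq, L2.inner_def]
  refine integral_congr_ae ?_
  filter_upwards [h] with ω hω
  simp [hω, sq]

omit [IsProbabilityMeasure P] in
lemma inner_eq_integral_mul {x y : Lp ℝ 2 P} {f g : Ω → ℝ} (hx : x =ᵐ[P] f) (hy : y =ᵐ[P] g) :
    inner ℝ x y = ∫ ω, f ω * g ω ∂P := by
  rw [L2.inner_def]
  refine integral_congr_ae ?_
  filter_upwards [hx, hy] with ω h1 h2
  simp [h1, h2, mul_comm]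

omit [IsProbabilityMeasure P] in
lemma coeFn_sum_smul {ι : Type*} (F : Finset ι) (c : ι → ℝ) {x : ι → Lp ℝ 2 P} {X : ι → Ω → ℝ}
    (h : ∀ i, x i =ᵐ[P] X i) :
    (∑ i ∈ F, c i • x i : Lp ℝ 2 P) =ᵐ[P] fun ω ↦ ∑ i ∈ F, c i * X i ω := by
  classical
  induction F using Finset.induction_on with
  | empty =>
    simp only [Finset.sum_empty]
    exact Lp.coeFn_zero ℝ 2 P
  | insert a s ha ih =>
    rw [Finset.sum_insert ha]
    filter_upwards [Lp.coeFn_add (c a • x a) (∑ i ∈ s, c i • x i), ih, Lp.coeFn_smul (c a) (x a), h a]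
      with ω h1 h2 h3 h4
    rw [h1, Pi.add_apply, h2, h3, Pi.smul_apply, h4, Finset.sum_insert ha, smul_eq_mul]

omit [IsProbabilityMeasure P] in
lemma exists_finsupp_of_mem_span {ι : Type*} {x : ι → Lp ℝ 2 P} {X : ι → Ω → ℝ}
    (h : ∀ i, x i =ᵐ[P] X i) {y : Lp ℝ 2 P} (hy : y ∈ Submodule.span ℝ (Set.range x)) :
    ∃ c : ι →₀ ℝ, y =ᵐ[P] fun ω ↦ ∑ i ∈ c.support, c i * X i ω := by
  obtain ⟨c, rfl⟩ := Finsupp.mem_span_range_iff_exists_finsupp.mp hy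
  exact ⟨c, coeFn_sum_smul c.support c h⟩

omit [IsProbabilityMeasure P] in
/-- The span of a centered Gaussian process is a Gaussian subspace. -/
lemma isGaussSpace_span {ι : Type*} {x : ι → Lp ℝ 2 P} {X : ι → Ω → ℝ} (h : ∀ i, x i =ᵐ[P] X i)
    (hX : IsGaussianProcess X P) (h0 : ∀ i, ∫ ω, X i ω ∂P = 0) :
    IsGaussSpace (Submodule.span ℝ (Set.range x)) := by
  intro y hy
  obtain ⟨c, hc⟩ := exists_finsupp_of_mem_span h hy
  have hG := (hX.smul c).hasGaussianLaw_fun_sum (I := c.support)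
  simp only [smul_eq_mul] at hG
  have hm : ∫ ω, ∑ i ∈ c.support, c i * X i ω ∂P = 0 := by
    rw [integral_finsetSum _ fun i _ ↦ ((hX.hasGaussianLaw_eval i).integrable).const_mul _]
    simp [integral_const_mul, h0]
  have hlaw := hG.map_eq_gaussianReal
  rw [hm, variance_of_integral_eq_zero hG.aemeasurable hm, ← norm_sq_eq_integral_sq hc] at hlaw
  have h1 := charFun_gaussianReal (μ := 0) (v := (‖y‖ ^ 2).toNNReal) 1
  rw [← hlaw, charFun_apply_real, integral_map hG.aemeasurable (by fun_prop)] at h1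
  rw [charOne_congr hc]
  simp only [Complex.ofReal_one, one_mul] at h1
  rw [h1]
  congr 1
  simp

omit [IsProbabilityMeasure P] in
-- A subspace contains all multiples t • x, so the value of their characteristic functions at 1
-- gives the characteristic function of x at every t.
lemma charOne_smul_eq {K : Submodule ℝ (Lp ℝ 2 P)} (hK : IsGaussSpace K) {x : Lp ℝ 2 P}
    (hx : x ∈ K) {f : Ω → ℝ} (hf : x =ᵐ[P] f) (t : ℝ) :
    ∫ ω, Complex.exp (((t * f ω : ℝ) : ℂ) * Complex.I) ∂P =
      Complex.exp ((-(t ^ 2 * ‖x‖ ^ 2 / 2) : ℝ) : ℂ) := by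
  have h1 : (t • x : Lp ℝ 2 P) =ᵐ[P] fun ω ↦ t * f ω := by
    filter_upwards [Lp.coeFn_smul t x, hf] with ω a b
    rw [a, Pi.smul_apply, b, smul_eq_mul]
  rw [← charOne_congr h1, hK _ (K.smul_mem t hx), norm_smul, mul_pow, Real.norm_eq_abs, sq_abs]

/-- Elements of a Gaussian subspace are centered Gaussian. -/
lemma IsGaussSpace.map_eq {K : Submodule ℝ (Lp ℝ 2 P)} (hK : IsGaussSpace K) {x : Lp ℝ 2 P}
    (hx : x ∈ K) {f : Ω → ℝ} (hf : x =ᵐ[P] f) :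
    P.map f = gaussianReal 0 (‖x‖ ^ 2).toNNReal := by
  have hfm : AEMeasurable f P := (Lp.aestronglyMeasurable x).aemeasurable.congr hf
  have := Measure.isProbabilityMeasure_map hfm
  refine Measure.ext_of_charFun (funext fun t ↦ ?_)
  rw [charFun_apply_real, charFun_gaussianReal, integral_map hfm (by fun_prop)]
  have := charOne_smul_eq hK hx hf t
  push_cast at this
  rw [this]
  congr 1
  rw [Real.coe_toNNReal _ (by positivity)]
  push_cast; ring

lemma IsGaussSpace.integral_eq_zero {K : Submodule ℝ (Lp ℝ 2 P)} (hK : IsGaussSpace K)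
    {x : Lp ℝ 2 P} (hx : x ∈ K) {f : Ω → ℝ} (hf : x =ᵐ[P] f) : ∫ ω, f ω ∂P = 0 := by
  have hfm : AEMeasurable f P := (Lp.aestronglyMeasurable x).aemeasurable.congr hf
  have := integral_map hfm (f := fun r : ℝ ↦ r) aestronglyMeasurable_id
  rw [← this, hK.map_eq hx hf, integral_id_gaussianReal]

lemma strongDual_pi_apply {ι : Type*} [Fintype ι] [DecidableEq ι] (L : StrongDual ℝ (ι → ℝ))
    (z : ι → ℝ) : L z = ∑ i, L (Pi.single i 1) * z i := by
  conv_lhs => rw [pi_eq_sum_univ' z, map_sum]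
  refine Finset.sum_congr rfl fun i _ ↦ ?_
  rw [map_smul, smul_eq_mul, mul_comm]

omit [IsProbabilityMeasure P] in
-- A linear functional of the vector is again an element of the subspace, so no joint Gaussianity
-- has to be assumed separately.
lemma IsGaussSpace.charFunDual_eq {K : Submodule ℝ (Lp ℝ 2 P)} (hK : IsGaussSpace K)
    {ι : Type*} [Fintype ι] [DecidableEq ι] {x : ι → Lp ℝ 2 P} (hx : ∀ i, x i ∈ K)
    {X : ι → Ω → ℝ} (h : ∀ i, x i =ᵐ[P] X i) (L : StrongDual ℝ (ι → ℝ)) :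
    charFunDual (P.map fun ω i ↦ X i ω) L =
      Complex.exp ((-(‖∑ i, L (Pi.single i 1) • x i‖ ^ 2 / 2) : ℝ) : ℂ) := by
  have hm : AEMeasurable (fun ω i ↦ X i ω) P := aemeasurable_pi_lambda _ fun i ↦
    (Lp.aestronglyMeasurable (x i)).aemeasurable.congr (h i)
  rw [charFunDual_apply, integral_map hm (by fun_prop),
    ← hK _ (Submodule.sum_mem _ fun i _ ↦ K.smul_mem _ (hx i)),
    charOne_congr (coeFn_sum_smul Finset.univ _ h)]
  refine integral_congr_ae (ae_of_all _ fun ω ↦ ?_)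
  simp only
  rw [strongDual_pi_apply L]

/-- The joint law of elements of a Gaussian subspace is determined by the norms of their linear
combinations. -/
lemma IsGaussSpace.map_pi_eq {K : Submodule ℝ (Lp ℝ 2 P)} (hK : IsGaussSpace K)
    {ι : Type*} [Fintype ι] {x y : ι → Lp ℝ 2 P} (hx : ∀ i, x i ∈ K) (hy : ∀ i, y i ∈ K)
    {X Y : ι → Ω → ℝ} (hX : ∀ i, x i =ᵐ[P] X i) (hY : ∀ i, y i =ᵐ[P] Y i)
    (hinner : ∀ i j, inner ℝ (x i) (x j) = inner ℝ (y i) (y j)) :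
    P.map (fun ω i ↦ X i ω) = P.map fun ω i ↦ Y i ω := by
  classical
  refine Measure.ext_of_charFunDual (funext fun L ↦ ?_)
  have h : ‖∑ i, L (Pi.single i 1) • x i‖ ^ 2 = ‖∑ i, L (Pi.single i 1) • y i‖ ^ 2 := by
    simp only [← real_inner_self_eq_norm_sq, sum_inner, inner_sum, real_inner_smul_left,
      real_inner_smul_right, hinner]
  rw [hK.charFunDual_eq hx hX, hK.charFunDual_eq hy hY, h]

/-- In a Gaussian subspace, orthogonality implies independence. -/
lemma IsGaussSpace.indepFun {K : Submodule ℝ (Lp ℝ 2 P)} (hK : IsGaussSpace K)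
    {ι : Type*} [Fintype ι] {x : ι → Lp ℝ 2 P} (hx : ∀ i, x i ∈ K) {n : Lp ℝ 2 P} (hn : n ∈ K)
    {X : ι → Ω → ℝ} (hX : ∀ i, x i =ᵐ[P] X i) {N : Ω → ℝ} (hN : n =ᵐ[P] N)
    (horth : ∀ i, inner ℝ (x i) n = 0) : IndepFun (fun ω i ↦ X i ω) N P := by
  classical
  have hm : AEMeasurable (fun ω i ↦ X i ω) P := aemeasurable_pi_lambda _ fun i ↦
    (Lp.aestronglyMeasurable (x i)).aemeasurable.congr (hX i)
  have hNm : AEMeasurable N P := (Lp.aestronglyMeasurable n).aemeasurable.congr hN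
  -- Independence is factorization of the joint characteristic function. Its exponent is a squared
  -- norm, which splits by Pythagoras.
  rw [indepFun_iff_charFunDual_prod hm hNm]
  intro L
  rw [hK.charFunDual_eq hx hX, charFunDual_apply, charFunDual_apply,
    integral_map (hm.prodMk hNm) (by fun_prop), integral_map hNm (by fun_prop)]
  set a := fun i ↦ (L.comp (.inl ℝ (ι → ℝ) ℝ)) (Pi.single i 1) with ha
  set b := L (0, 1) with hb
  have e1 : ∀ r : ℝ, (L.comp (.inr ℝ (ι → ℝ) ℝ)) r = b * r := by
    intro r
    have : (L.comp (.inr ℝ (ι → ℝ) ℝ)) (r • 1) = r • b := by rw [map_smul]; rfl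
    rw [smul_eq_mul, mul_one, smul_eq_mul, mul_comm] at this
    exact this
  have e2 : ∀ ω, L (fun i ↦ X i ω, N ω) = ∑ i, a i * X i ω + b * N ω := by
    intro ω
    have : ((fun i ↦ X i ω, N ω) : (ι → ℝ) × ℝ) =
      ContinuousLinearMap.inl ℝ (ι → ℝ) ℝ (fun i ↦ X i ω) +
        ContinuousLinearMap.inr ℝ (ι → ℝ) ℝ (N ω) := by simp
    rw [this, map_add, ← e1, ← strongDual_pi_apply (L.comp (.inl ℝ (ι → ℝ) ℝ))]
    rfl
  simp only [e1, e2]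
  rw [charOne_smul_eq hK hn hN]
  have e3 : ((∑ i, a i • x i) + b • n : Lp ℝ 2 P) =ᵐ[P] fun ω ↦ ∑ i, a i * X i ω + b * N ω := by
    filter_upwards [Lp.coeFn_add (∑ i, a i • x i) (b • n), coeFn_sum_smul Finset.univ a hX,
      Lp.coeFn_smul b n, hN] with ω h1 h2 h3 h4
    rw [h1, Pi.add_apply, h2, h3, Pi.smul_apply, h4, smul_eq_mul]
  rw [← charOne_congr e3, hK _ (K.add_mem (Submodule.sum_mem _ fun i _ ↦ K.smul_mem _ (hx i))
    (K.smul_mem b hn)), ← Complex.exp_add, ← Complex.ofReal_add]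
  congr 2
  have h0 : inner ℝ (∑ i, a i • x i) (b • n) = 0 := by
    simp [sum_inner, real_inner_smul_left, real_inner_smul_right, horth]
  rw [norm_add_sq_real, h0, norm_smul, mul_pow, Real.norm_eq_abs, sq_abs]
  ring

/-- The sum of independent Gaussian subspaces. -/
lemma IsGaussSpace.sup_of_indep {K K' : Submodule ℝ (Lp ℝ 2 P)} (hK : IsGaussSpace K)
    (hK' : IsGaussSpace K') (hind : ∀ x ∈ K, ∀ y ∈ K', IndepFun x y P) :
    IsGaussSpace (K ⊔ K') ∧ ∀ x ∈ K, ∀ y ∈ K', inner ℝ x y = 0 := by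
  have horth : ∀ x ∈ K, ∀ y ∈ K', inner ℝ x y = 0 := by
    intro x hx y hy
    rw [inner_eq_integral_mul (ae_eq_refl x) (ae_eq_refl y),
      (hind x hx y hy).integral_fun_mul_eq_mul_integral (Lp.aestronglyMeasurable x) (Lp.aestronglyMeasurable y),
      hK.integral_eq_zero hx (ae_eq_refl x), zero_mul]
  refine ⟨fun z hz ↦ ?_, horth⟩
  obtain ⟨x, hx, y, hy, rfl⟩ := Submodule.mem_sup.mp hz
  rw [charOne_congr (Lp.coeFn_add x y)]
  have h1 : ∀ ω, Complex.exp (((x + y : Ω → ℝ) ω : ℂ) * Complex.I) =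
      Complex.exp ((x ω : ℂ) * Complex.I) * Complex.exp ((y ω : ℂ) * Complex.I) := by
    intro ω
    rw [← Complex.exp_add, Pi.add_apply]; push_cast; ring_nf
  simp_rw [h1]
  have hm : Measurable fun r : ℝ ↦ Complex.exp ((r : ℂ) * Complex.I) := by fun_prop
  have h2 := ((hind x hx y hy).comp hm hm).integral_fun_mul_eq_mul_integral
    (integrable_cexp_mul_I (Lp.aestronglyMeasurable x)).aestronglyMeasurable
    (integrable_cexp_mul_I (Lp.aestronglyMeasurable y)).aestronglyMeasurable
  simp only [Function.comp_apply] at h2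
  rw [h2]
  change charOne x * charOne y = _
  rw [hK x hx, hK' y hy, ← Complex.exp_add, ← Complex.ofReal_add, norm_add_sq_real, horth x hx y hy]
  congr 2; ring

omit [IsProbabilityMeasure P] in
/-- An almost surely convergent filtered series also converges in `L²`, to the same limit. -/
lemma exists_hasSum_L2 {x : ℤ → Lp ℝ 2 P} {X : ℤ → Ω → ℝ} (h : ∀ t, x t =ᵐ[P] X t) {C : ℝ}
    (hC : ∀ t, ‖x t‖ ≤ C) {g : ℕ → ℝ} (hg : Summable fun k ↦ |g k|) {t : ℤ} {Z : Ω → ℝ}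
    (hZ : ∀ᵐ ω ∂P, HasSum (fun k : ℕ ↦ g k * X (t - k) ω) (Z ω)) :
    ∃ z : Lp ℝ 2 P, z =ᵐ[P] Z ∧ HasSum (fun k : ℕ ↦ g k • x (t - k)) z := by
  have hs : Summable fun k : ℕ ↦ g k • x (t - k) := by
    refine Summable.of_norm_bounded (hg.mul_right C) fun k ↦ ?_
    rw [norm_smul, Real.norm_eq_abs]
    exact mul_le_mul_of_nonneg_left (hC _) (abs_nonneg _)
  refine ⟨_, ?_, hs.hasSum⟩
  -- L² convergence gives an almost surely convergent subsequence of partial sums, which identifies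
  -- the L² limit with the pointwise one.
  have hm := tendstoInMeasure_of_tendsto_Lp hs.hasSum.tendsto_sum_nat
  obtain ⟨ns, hns, hlim⟩ := hm.exists_seq_tendsto_ae
  have hpart : ∀ n, ((∑ k ∈ Finset.range n, g k • x (t - k) : Lp ℝ 2 P) : Ω → ℝ) =ᵐ[P]
      fun ω ↦ ∑ k ∈ Finset.range n, g k * X (t - k) ω := fun n ↦
    coeFn_sum_smul _ g (x := fun k : ℕ ↦ x (t - k)) (X := fun k : ℕ ↦ X (t - k)) fun k ↦ h _
  filter_upwards [hlim, hZ, ae_all_iff.mpr hpart] with ω h1 h2 h3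
  simp only [h3] at h1
  exact tendsto_nhds_unique h1 (h2.tendsto_sum_nat.comp hns.tendsto_atTop)

end GaussSpace

/-! ### Gaussian regression kernels and their divergences -/

section Divergence

variable {ξ : Type*} [MeasurableSpace ξ]

/-- The kernel `x ↦ N(m x, v)`. -/
def gaussKernel (m : ξ → ℝ) (hm : Measurable m) (v : ℝ≥0) : Kernel ξ ℝ :=
  ((Kernel.deterministic m hm) ×ₖ (Kernel.const ξ (gaussianReal 0 v))).map fun p ↦ p.1 + p.2

instance (m : ξ → ℝ) (hm : Measurable m) (v : ℝ≥0) : IsMarkovKernel (gaussKernel m hm v) :=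
  Kernel.IsMarkovKernel.map _ (by fun_prop)

lemma gaussKernel_apply (m : ξ → ℝ) (hm : Measurable m) (v : ℝ≥0) (x : ξ) :
    gaussKernel m hm v x = gaussianReal (m x) v := by
  rw [gaussKernel, Kernel.map_apply _ (by fun_prop), Kernel.prod_apply, Kernel.deterministic_apply,
    Kernel.const_apply, Measure.dirac_prod, Measure.map_map (by fun_prop) (by fun_prop)]
  have := gaussianReal_map_const_add (μ := 0) (v := v) (m x)
  rw [zero_add] at this
  exact this

/-- B is m(X) plus a centered Gaussian variable independent of X, so its conditional law given X is
the Gaussian centered at m(X). -/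
lemma map_prodMk_eq_compProd_gaussKernel {Ω : Type*} [MeasurableSpace Ω] {P : Measure Ω}
    [IsProbabilityMeasure P] {X : Ω → ξ} (hX : Measurable X) {B : Ω → ℝ} (hB : Measurable B)
    {m : ξ → ℝ} (hm : Measurable m) {v : ℝ≥0}
    (hind : IndepFun X (fun ω ↦ B ω - m (X ω)) P)
    (hlaw : P.map (fun ω ↦ B ω - m (X ω)) = gaussianReal 0 v) :
    P.map (fun ω ↦ (X ω, B ω)) = P.map X ⊗ₘ gaussKernel m hm v := by
  have hN : Measurable fun ω ↦ B ω - m (X ω) := hB.sub (hm.comp hX)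
  have h1 := (indepFun_iff_map_prod_eq_prod_map_map hX.aemeasurable hN.aemeasurable).mp hind
  rw [hlaw] at h1
  have := Measure.isProbabilityMeasure_map (μ := P) hX.aemeasurable
  refine Measure.ext_of_lintegral _ fun f hf ↦ ?_
  rw [lintegral_map hf (hX.prodMk hB), Measure.lintegral_compProd hf]
  have h2 : ∫⁻ ω, f (X ω, B ω) ∂P =
      ∫⁻ p, f (p.1, m p.1 + p.2) ∂(P.map fun ω ↦ (X ω, B ω - m (X ω))) := by
    rw [lintegral_map (by fun_prop) (hX.prodMk hN)]
    simp
  rw [h2, h1, lintegral_prod _ (by fun_prop)]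
  refine lintegral_congr fun x ↦ ?_
  have h3 := gaussianReal_map_const_add (μ := 0) (v := v) (m x)
  rw [zero_add] at h3
  rw [gaussKernel_apply, ← h3, lintegral_map (by fun_prop) (by fun_prop)]

/-- The density of `N(m₁, v₁)` with respect to `N(m₀, v₀)`. -/
def gaussRatio (m₁ m₀ : ξ → ℝ) (v₁ v₀ : ℝ≥0) (p : ξ × ℝ) : ℝ :=
  gaussianPDFReal (m₁ p.1) v₁ p.2 / gaussianPDFReal (m₀ p.1) v₀ p.2

lemma measurable_gaussRatio {m₁ m₀ : ξ → ℝ} (hm₁ : Measurable m₁) (hm₀ : Measurable m₀)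
    (v₁ v₀ : ℝ≥0) : Measurable (gaussRatio m₁ m₀ v₁ v₀) := by
  unfold gaussRatio gaussianPDFReal
  fun_prop

lemma compProd_gaussKernel_eq_withDensity (μ : Measure ξ) [IsProbabilityMeasure μ] {m₁ m₀ : ξ → ℝ}
    (hm₁ : Measurable m₁) (hm₀ : Measurable m₀) {v₁ v₀ : ℝ≥0} (hv₁ : v₁ ≠ 0) (hv₀ : v₀ ≠ 0) :
    μ ⊗ₘ gaussKernel m₁ hm₁ v₁ = (μ ⊗ₘ gaussKernel m₀ hm₀ v₀).withDensity
      fun p ↦ ENNReal.ofReal (gaussRatio m₁ m₀ v₁ v₀ p) := by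
  have hg : Measurable fun p : ξ × ℝ ↦ ENNReal.ofReal (gaussRatio m₁ m₀ v₁ v₀ p) :=
    (measurable_gaussRatio hm₁ hm₀ v₁ v₀).ennreal_ofReal
  refine Measure.ext_of_lintegral _ fun f hf ↦ ?_
  rw [lintegral_withDensity_eq_lintegral_mul _ hg hf, Measure.lintegral_compProd hf,
    Measure.lintegral_compProd (hg.mul hf)]
  refine lintegral_congr fun x ↦ ?_
  have hgf : Measurable fun b ↦ ((fun p ↦ ENNReal.ofReal (gaussRatio m₁ m₀ v₁ v₀ p)) * f) (x, b) :=
    (hg.mul hf).comp measurable_prodMk_left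
  rw [gaussKernel_apply, gaussKernel_apply, gaussianReal_of_var_ne_zero _ hv₁,
    gaussianReal_of_var_ne_zero _ hv₀,
    lintegral_withDensity_eq_lintegral_mul _ (measurable_gaussianPDF _ _) (by fun_prop),
    lintegral_withDensity_eq_lintegral_mul _ (measurable_gaussianPDF _ _) hgf]
  refine lintegral_congr fun y ↦ ?_
  simp only [Pi.mul_apply, gaussRatio, gaussianPDF, ← mul_assoc]
  rw [← ENNReal.ofReal_mul (gaussianPDFReal_nonneg _ _ _),
    mul_div_cancel₀ _ (gaussianPDFReal_pos _ _ _ hv₀).ne']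

omit [MeasurableSpace ξ] in
lemma log_gaussRatio {m₁ m₀ : ξ → ℝ} {v₁ v₀ : ℝ≥0} (hv₁ : v₁ ≠ 0) (hv₀ : v₀ ≠ 0) (p : ξ × ℝ) :
    Real.log (gaussRatio m₁ m₀ v₁ v₀ p) = 1 / 2 * Real.log (v₀ / v₁)
      - (p.2 - m₁ p.1) ^ 2 / (2 * v₁) + (p.2 - m₀ p.1) ^ 2 / (2 * v₀) := by
  have h1 : (0 : ℝ) < v₁ := by positivity
  have h0 : (0 : ℝ) < v₀ := by positivity
  have hlog : ∀ (m : ℝ) (v : ℝ≥0) (x : ℝ), (0 : ℝ) < v → Real.log (gaussianPDFReal m v x) =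
      -(1 / 2 * (Real.log (2 * Real.pi) + Real.log v)) - (x - m) ^ 2 / (2 * v) := by
    intro m v x hv
    have hp := Real.pi_pos
    rw [gaussianPDFReal, Real.log_mul (by positivity) (Real.exp_pos _).ne', Real.log_exp,
      Real.log_inv, Real.log_sqrt (by positivity), Real.log_mul (by positivity) hv.ne']
    ring
  rw [gaussRatio, Real.log_div (gaussianPDFReal_pos _ _ _ hv₁).ne' (gaussianPDFReal_pos _ _ _ hv₀).ne',
    hlog _ _ _ h1, hlog _ _ _ h0, Real.log_div h0.ne' h1.ne']
  ring

/-- The divergence between two Gaussian regressions of the same variable. -/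
lemma klDiv_compProd_gaussKernel {Ω : Type*} [MeasurableSpace Ω] {P : Measure Ω}
    [IsProbabilityMeasure P] {X : Ω → ξ} (hX : Measurable X) {B : Ω → ℝ} (hB : Measurable B)
    {m₁ m₀ : ξ → ℝ} (hm₁ : Measurable m₁) (hm₀ : Measurable m₀) {v₁ v₀ : ℝ≥0} (hv₁ : v₁ ≠ 0)
    (hv₀ : v₀ ≠ 0) (hind : IndepFun X (fun ω ↦ B ω - m₁ (X ω)) P)
    (hlaw₁ : P.map (fun ω ↦ B ω - m₁ (X ω)) = gaussianReal 0 v₁)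
    (hlaw₀ : P.map (fun ω ↦ B ω - m₀ (X ω)) = gaussianReal 0 v₀) :
    InformationTheory.klDiv (P.map fun ω ↦ (X ω, B ω)) (P.map X ⊗ₘ gaussKernel m₀ hm₀ v₀) =
      ENNReal.ofReal (1 / 2 * Real.log (v₀ / v₁)) := by
  have hμ := Measure.isProbabilityMeasure_map (μ := P) hX.aemeasurable
  have hJp : IsProbabilityMeasure (P.map fun ω ↦ (X ω, B ω)) :=
    Measure.isProbabilityMeasure_map (hX.prodMk hB).aemeasurable
  have hJ := map_prodMk_eq_compProd_gaussKernel hX hB hm₁ hind hlaw₁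
  have hwd := compProd_gaussKernel_eq_withDensity (P.map X) hm₁ hm₀ hv₁ hv₀
  rw [← hJ] at hwd
  set J := P.map fun ω ↦ (X ω, B ω) with hJdef
  set R := P.map X ⊗ₘ gaussKernel m₀ hm₀ v₀ with hR
  have hg := measurable_gaussRatio hm₁ hm₀ v₁ v₀
  have hac : J ≪ R := hwd ▸ withDensity_absolutelyContinuous _ _
  have hllr : llr J R =ᵐ[J] fun p ↦ Real.log (gaussRatio m₁ m₀ v₁ v₀ p) := by
    have h1 : J.rnDeriv R =ᵐ[R] fun p ↦ ENNReal.ofReal (gaussRatio m₁ m₀ v₁ v₀ p) := by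
      conv_lhs => rw [hwd]
      exact Measure.rnDeriv_withDensity _ hg.ennreal_ofReal
    filter_upwards [hac.ae_le h1] with p hp
    rw [llr, hp, ENNReal.toReal_ofReal]
    exact div_nonneg (gaussianPDFReal_nonneg _ _ _) (gaussianPDFReal_nonneg _ _ _)
  have hsq : ∀ {m : ξ → ℝ} (hm : Measurable m) {v : ℝ≥0},
      P.map (fun ω ↦ B ω - m (X ω)) = gaussianReal 0 v →
      Integrable (fun ω ↦ (B ω - m (X ω)) ^ 2) P ∧ ∫ ω, (B ω - m (X ω)) ^ 2 ∂P = v := by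
    intro m hm v hlaw
    have hN : Measurable fun ω ↦ B ω - m (X ω) := hB.sub (hm.comp hX)
    have hi : Integrable (fun x : ℝ ↦ x ^ 2) (gaussianReal 0 v) :=
      (memLp_id_gaussianReal (μ := 0) (v := v) 2).integrable_sq
    constructor
    · have := hi
      rw [← hlaw] at this
      exact (integrable_map_measure (by fun_prop) hN.aemeasurable).mp this
    · have h2 := variance_id_gaussianReal (μ := 0) (v := v)
      rw [variance_of_integral_eq_zero aemeasurable_id (by simp)] at h2
      have h3 := integral_map (μ := P) hN.aemeasurable (f := fun x : ℝ ↦ x ^ 2) (by fun_prop)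
      rw [← h3, hlaw]; exact h2
  -- Under the true law each residual has second moment equal to its own variance. The two quadratic
  -- terms of the log-density then integrate to 1/2 each and cancel, and only the log-ratio of
  -- variances survives.
  obtain ⟨hi₁, he₁⟩ := hsq hm₁ hlaw₁
  obtain ⟨hi₀, he₀⟩ := hsq hm₀ hlaw₀
  have hi₁' : Integrable (fun ω ↦ 1 / 2 * Real.log (v₀ / v₁)
      - (B ω - m₁ (X ω)) ^ 2 / (2 * v₁)) P := (integrable_const _).sub (hi₁.div_const _)
  have hiP : Integrable (fun ω ↦ 1 / 2 * Real.log (v₀ / v₁)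
      - (B ω - m₁ (X ω)) ^ 2 / (2 * v₁) + (B ω - m₀ (X ω)) ^ 2 / (2 * v₀)) P :=
    hi₁'.add (hi₀.div_const _)
  have hiJ : Integrable (fun p ↦ Real.log (gaussRatio m₁ m₀ v₁ v₀ p)) J := by
    rw [hJdef, integrable_map_measure hg.log.aestronglyMeasurable (hX.prodMk hB).aemeasurable]
    refine hiP.congr (ae_of_all _ fun ω ↦ ?_)
    simp only [Function.comp_apply, log_gaussRatio hv₁ hv₀]
  rw [InformationTheory.klDiv_of_ac_of_integrable hac (hiJ.congr hllr.symm)]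
  simp only [probReal_univ, add_sub_cancel_right]
  congr 1
  rw [integral_congr_ae hllr, hJdef, integral_map (hX.prodMk hB).aemeasurable
    hg.log.aestronglyMeasurable]
  simp only [log_gaussRatio hv₁ hv₀]
  rw [integral_add hi₁' (hi₀.div_const _),
    integral_sub (integrable_const _) (hi₁.div_const _), integral_div, integral_div, he₁, he₀]
  have h1 : (v₁ : ℝ) ≠ 0 := by exact_mod_cast hv₁
  have h0 : (v₀ : ℝ) ≠ 0 := by exact_mod_cast hv₀
  simp
  field_simp
  ring

/-- Data processing, applied to the equivalence and to its inverse. -/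
lemma klDiv_map_measurableEquiv {α β : Type*} [MeasurableSpace α] [MeasurableSpace β]
    (μ ν : Measure α) [IsFiniteMeasure μ] [IsFiniteMeasure ν] (e : α ≃ᵐ β) :
    InformationTheory.klDiv (μ.map e) (ν.map e) = InformationTheory.klDiv μ ν := by
  refine le_antisymm (InformationTheory.klDiv_map_le μ ν e.measurable) ?_
  have h := InformationTheory.klDiv_map_le (μ.map e) (ν.map e) e.symm.measurable
  rwa [e.map_symm_map, e.map_symm_map] at h

end Divergence

/-- Conditional mutual information for Gaussian regressions, in terms of the two error variances. -/
theorem condMutualInfo_of_regression {Ω : Type*} [MeasurableSpace Ω] {P : Measure Ω}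
    [IsProbabilityMeasure P] {α γ : Type*} [MeasurableSpace α] [StandardBorelSpace α] [Nonempty α]
    [MeasurableSpace γ] {A : Ω → α} {B : Ω → ℝ} {C : Ω → γ} (hA : Measurable A) (hB : Measurable B)
    (hC : Measurable C) {m₁ : γ × α → ℝ} {m₀ : γ → ℝ} (hm₁ : Measurable m₁) (hm₀ : Measurable m₀)
    {v₁ v₀ : ℝ≥0} (hv₁ : v₁ ≠ 0) (hv₀ : v₀ ≠ 0)
    (hind₁ : IndepFun (fun ω ↦ (C ω, A ω)) (fun ω ↦ B ω - m₁ (C ω, A ω)) P)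
    (hlaw₁ : P.map (fun ω ↦ B ω - m₁ (C ω, A ω)) = gaussianReal 0 v₁)
    (hind₀ : IndepFun C (fun ω ↦ B ω - m₀ (C ω)) P)
    (hlaw₀ : P.map (fun ω ↦ B ω - m₀ (C ω)) = gaussianReal 0 v₀) :
    condMutualInfo P A B C = ENNReal.ofReal (1 / 2 * Real.logb 2 (v₀ / v₁)) := by
  have hCA : Measurable fun ω ↦ (C ω, A ω) := hC.prodMk hA
  have hμ := Measure.isProbabilityMeasure_map (μ := P) hC.aemeasurable
  have hμ' := Measure.isProbabilityMeasure_map (μ := P) hCA.aemeasurable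
  have hκ := condDistrib_ae_eq_of_measure_eq_compProd C hB.aemeasurable
    (map_prodMk_eq_compProd_gaussKernel hC hB hm₀ hind₀ hlaw₀)
  have hjoint : (P.map fun ω ↦ (C ω, (A ω, B ω))) =
      (P.map fun ω ↦ ((C ω, A ω), B ω)).map MeasurableEquiv.prodAssoc := by
    rw [Measure.map_map (MeasurableEquiv.measurable _) (hCA.prodMk hB)]
    rfl
  -- Given C, the reference law draws B from a Gaussian kernel that ignores A. It is therefore the
  -- law of (C, A) followed by a regression of B on (C, A), and both laws are Gaussian regressions
  -- over the same base.
  have href : (P.map C) ⊗ₘ (condDistrib A C P ×ₖ condDistrib B C P) =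
      (P.map (fun ω ↦ (C ω, A ω)) ⊗ₘ gaussKernel (fun p ↦ m₀ p.1) (hm₀.comp measurable_fst) v₀).map
        MeasurableEquiv.prodAssoc := by
    rw [← compProd_map_condDistrib hA.aemeasurable]
    refine Measure.ext_of_lintegral _ fun f hf ↦ ?_
    have hfe : Measurable fun p : (γ × α) × ℝ ↦ f (MeasurableEquiv.prodAssoc p) :=
      hf.comp (MeasurableEquiv.measurable _)
    rw [lintegral_map hf (MeasurableEquiv.measurable _), Measure.lintegral_compProd hf,
      Measure.lintegral_compProd hfe,
      Measure.lintegral_compProd (Measurable.lintegral_kernel_prod_right' hfe)]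
    refine lintegral_congr_ae ?_
    filter_upwards [hκ] with c hc
    rw [Kernel.prod_apply, hc, lintegral_prod _ (by fun_prop)]
    refine lintegral_congr fun a ↦ ?_
    rw [gaussKernel_apply, gaussKernel_apply]
    rfl
  rw [condMutualInfo, hjoint, href, klDiv_map_measurableEquiv,
    klDiv_compProd_gaussKernel (m₀ := fun p ↦ m₀ p.1) hCA hB hm₁ (hm₀.comp measurable_fst) hv₁ hv₀ hind₁ hlaw₁ hlaw₀,
    ← ENNReal.ofReal_div_of_pos (Real.log_pos (by norm_num)), Real.logb]
  congr 1
  ring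

/-! ### Linear regression in a Gaussian subspace -/

/-- Orthogonal projection onto the span, written with explicit coefficients. The family may be
linearly dependent, so the coefficients are chosen rather than unique. -/
lemma exists_regression {E : Type*} [NormedAddCommGroup E] [InnerProductSpace ℝ E] {ι : Type*}
    [Fintype ι] (x : ι → E) (b : E) : ∃ α : ι → ℝ, (∀ i, inner ℝ (x i) (b - ∑ i, α i • x i) = 0) ∧
      ∀ y ∈ Submodule.span ℝ (Set.range x), ‖b - ∑ i, α i • x i‖ ^ 2 ≤ ‖b - y‖ ^ 2 := by
  have hfin : FiniteDimensional ℝ (Submodule.span ℝ (Set.range x)) :=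
    FiniteDimensional.span_of_finite ℝ (Set.finite_range x)
  set M := Submodule.span ℝ (Set.range x) with hM
  obtain ⟨α, hα⟩ := (Submodule.mem_span_range_iff_exists_fun ℝ).mp
    (M.starProjection_apply_mem b)
  have horth : ∀ y ∈ M, inner ℝ y (b - ∑ i, α i • x i) = 0 := by
    intro y hy
    rw [hα]
    exact Submodule.inner_right_of_mem_orthogonal hy (M.sub_starProjection_mem_orthogonal b)
  refine ⟨α, fun i ↦ horth _ (Submodule.subset_span ⟨i, rfl⟩), fun y hy ↦ ?_⟩
  have hmem : ∑ i, α i • x i - y ∈ M := M.sub_mem (hα ▸ M.starProjection_apply_mem b) hy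
  have h1 : b - y = (b - ∑ i, α i • x i) + (∑ i, α i • x i - y) := by abel
  rw [h1, norm_add_sq_real, real_inner_comm, horth _ hmem]
  nlinarith [sq_nonneg ‖∑ i, α i • x i - y‖]

/-- `v` is the squared distance from `b` to `M`, and it is attained. -/
def IsErrorVar {E : Type*} [NormedAddCommGroup E] [InnerProductSpace ℝ E] (M : Submodule ℝ E)
    (b : E) (v : ℝ) : Prop :=
  (∃ y ∈ M, v = ‖b - y‖ ^ 2) ∧ ∀ y ∈ M, v ≤ ‖b - y‖ ^ 2

/-- Conditional mutual information of finitely many elements of a Gaussian subspace. -/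
theorem IsGaussSpace.exists_condMutualInfo_eq {Ω : Type*} [MeasurableSpace Ω] {P : Measure Ω}
    [IsProbabilityMeasure P] {K : Submodule ℝ (Lp ℝ 2 P)} (hK : IsGaussSpace K)
    {ι κ : Type*} [Fintype ι] [Fintype κ] {a : ι → Lp ℝ 2 P} {c : κ → Lp ℝ 2 P} {b : Lp ℝ 2 P}
    (ha : ∀ i, a i ∈ K) (hc : ∀ k, c k ∈ K) (hb : b ∈ K) {A : ι → Ω → ℝ} {C : κ → Ω → ℝ}
    {B : Ω → ℝ} (hA : ∀ i, Measurable (A i)) (hC : ∀ k, Measurable (C k)) (hB : Measurable B)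
    (haA : ∀ i, a i =ᵐ[P] A i) (hcC : ∀ k, c k =ᵐ[P] C k) (hbB : b =ᵐ[P] B)
    (hpos : b ∉ Submodule.span ℝ (Set.range (Sum.elim c a))) :
    ∃ v₁ v₀ : ℝ, IsErrorVar (Submodule.span ℝ (Set.range (Sum.elim c a))) b v₁ ∧
      IsErrorVar (Submodule.span ℝ (Set.range c)) b v₀ ∧
      condMutualInfo P (fun ω i ↦ A i ω) B (fun ω k ↦ C k ω) =
        ENNReal.ofReal (1 / 2 * Real.logb 2 (v₀ / v₁)) := by
  obtain ⟨α, hα, hαmin⟩ := exists_regression (Sum.elim c a) b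
  obtain ⟨β, hβ, hβmin⟩ := exists_regression c b
  have hmemα : ∑ i, α i • Sum.elim c a i ∈ Submodule.span ℝ (Set.range (Sum.elim c a)) :=
    Submodule.sum_mem _ fun i _ ↦ Submodule.smul_mem _ _ (Submodule.subset_span ⟨i, rfl⟩)
  have hmemβ : ∑ i, β i • c i ∈ Submodule.span ℝ (Set.range c) :=
    Submodule.sum_mem _ fun i _ ↦ Submodule.smul_mem _ _ (Submodule.subset_span ⟨i, rfl⟩)
  have hle : Submodule.span ℝ (Set.range c) ≤ Submodule.span ℝ (Set.range (Sum.elim c a)) := by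
    refine Submodule.span_mono ?_
    rintro _ ⟨k, rfl⟩
    exact ⟨Sum.inl k, rfl⟩
  set n₁ := b - ∑ i, α i • Sum.elim c a i with hn₁
  set n₀ := b - ∑ i, β i • c i with hn₀
  have hx : ∀ i, Sum.elim c a i ∈ K := by rintro (k | i); exacts [hc k, ha i]
  have hX : ∀ i, ((Sum.elim c a i : Lp ℝ 2 P) : Ω → ℝ) =ᵐ[P] Sum.elim C A i := by rintro (k | i); exacts [hcC k, haA i]
  have hn₁K : n₁ ∈ K := K.sub_mem hb (K.sum_mem fun i _ ↦ K.smul_mem _ (hx i))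
  have hn₀K : n₀ ∈ K := K.sub_mem hb (K.sum_mem fun i _ ↦ K.smul_mem _ (hc i))
  have hp₁ : 0 < ‖n₁‖ ^ 2 := by
    have : n₁ ≠ 0 := fun h ↦ hpos (by rw [sub_eq_zero.mp h]; exact hmemα)
    positivity
  have hp₀ : 0 < ‖n₀‖ ^ 2 := by
    have : n₀ ≠ 0 := fun h ↦ hpos (by rw [sub_eq_zero.mp h]; exact hle hmemβ)
    positivity
  have hae₁ : n₁ =ᵐ[P] fun ω ↦ B ω - ∑ i, α i * Sum.elim C A i ω := by
    filter_upwards [Lp.coeFn_sub b (∑ i, α i • Sum.elim c a i), hbB,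
      coeFn_sum_smul Finset.univ α hX] with ω h1 h2 h3
    rw [hn₁, h1, Pi.sub_apply, h2, h3]
  have hae₀ : n₀ =ᵐ[P] fun ω ↦ B ω - ∑ i, β i * C i ω := by
    filter_upwards [Lp.coeFn_sub b (∑ i, β i • c i), hbB,
      coeFn_sum_smul Finset.univ β hcC] with ω h1 h2 h3
    rw [hn₀, h1, Pi.sub_apply, h2, h3]
  refine ⟨‖n₁‖ ^ 2, ‖n₀‖ ^ 2, ⟨⟨_, hmemα, rfl⟩, hαmin⟩, ⟨⟨_, hmemβ, rfl⟩, hβmin⟩, ?_⟩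
  let m₁ : (κ → ℝ) × (ι → ℝ) → ℝ := fun p ↦ ∑ i, α i * Sum.elim p.1 p.2 i
  let m₀ : (κ → ℝ) → ℝ := fun p ↦ ∑ i, β i * p i
  have hm₁eq : ∀ p, m₁ p = ∑ k, α (Sum.inl k) * p.1 k + ∑ i, α (Sum.inr i) * p.2 i := by
    intro p; simp [m₁, Fintype.sum_sum_type]
  have hm₁ : Measurable m₁ := by
    rw [funext hm₁eq]; fun_prop
  have hm₀ : Measurable m₀ := by fun_prop
  have hsplit : ∀ ω, m₁ (fun k ↦ C k ω, fun i ↦ A i ω) = ∑ i, α i * Sum.elim C A i ω := by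
    intro ω
    rw [hm₁eq, Fintype.sum_sum_type]; rfl
  have hae₁' : n₁ =ᵐ[P] fun ω ↦ B ω - m₁ (fun k ↦ C k ω, fun i ↦ A i ω) := by
    simpa only [hsplit] using hae₁
  have hind₁ := hK.indepFun hx hn₁K hX hae₁' hα
  have hproj : Measurable fun z : κ ⊕ ι → ℝ ↦ ((fun k ↦ z (Sum.inl k), fun i ↦ z (Sum.inr i)) :
      (κ → ℝ) × (ι → ℝ)) := by fun_prop
  have := condMutualInfo_of_regression (P := P) (A := fun ω i ↦ A i ω) (B := B)
    (C := fun ω k ↦ C k ω) (measurable_pi_lambda _ hA) hB (measurable_pi_lambda _ hC) hm₁ hm₀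
    (v₁ := (‖n₁‖ ^ 2).toNNReal) (v₀ := (‖n₀‖ ^ 2).toNNReal) (Real.toNNReal_pos.mpr hp₁).ne' (Real.toNNReal_pos.mpr hp₀).ne'
    (hind₁.comp hproj measurable_id) (hK.map_eq hn₁K hae₁')
    (hK.indepFun hc hn₀K hcC hae₀ hβ) (hK.map_eq hn₀K hae₀)
  rw [this, Real.coe_toNNReal _ hp₁.le, Real.coe_toNNReal _ hp₀.le]

/-! ### Maximal inequality and almost sure convergence of ergodic averages -/

section Ergodic

variable {α : Type*} [MeasurableSpace α] {μ : Measure α} [IsProbabilityMeasure μ] {T : α → α}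

omit [IsProbabilityMeasure μ] in
lemma integral_comp_measurePreserving (hT : MeasurePreserving T μ μ) {f : α → ℝ} (hf : Measurable f) :
    ∫ a, f (T a) ∂μ = ∫ a, f a ∂μ := by
  conv_rhs => rw [← hT.map_eq]
  rw [integral_map hT.measurable.aemeasurable hf.aestronglyMeasurable]

/-- The maximum of the first `n` partial sums of `f` along the orbit, and `0`. -/
def maxSum (T : α → α) (f : α → ℝ) : ℕ → α → ℝ
  | 0 => fun _ ↦ 0
  | n + 1 => fun a ↦ max 0 (f a + maxSum T f n (T a))

omit [MeasurableSpace α] in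
lemma maxSum_nonneg (f : α → ℝ) (n : ℕ) (a : α) : 0 ≤ maxSum T f n a := by
  cases n with
  | zero => exact le_rfl
  | succ n => exact le_max_left _ _

omit [MeasurableSpace α] in
lemma maxSum_le_succ (f : α → ℝ) (n : ℕ) (a : α) : maxSum T f n a ≤ maxSum T f (n + 1) a := by
  induction n generalizing a with
  | zero => exact maxSum_nonneg f 1 a
  | succ n ih => exact max_le_max le_rfl (by have := ih (T a); linarith)

omit [MeasurableSpace α] in
lemma birkhoffSum_le_maxSum (f : α → ℝ) (n : ℕ) (a : α) : birkhoffSum T f n a ≤ maxSum T f n a := by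
  induction n generalizing a with
  | zero => simp [maxSum]
  | succ n ih =>
    rw [birkhoffSum_succ']
    exact le_max_of_le_right (by have := ih (T a); linarith)

omit [IsProbabilityMeasure μ] in
lemma integrable_maxSum (hT : MeasurePreserving T μ μ) {f : α → ℝ} (hf : Integrable f μ) (n : ℕ) :
    Integrable (maxSum T f n) μ := by
  induction n with
  | zero => exact integrable_zero _ _ _
  | succ n ih =>
    exact (integrable_zero _ _ _).sup (hf.add (hT.integrable_comp_of_integrable ih))

omit [IsProbabilityMeasure μ] in
/-- Garsia's form of the maximal ergodic theorem. -/
lemma setIntegral_maxSum_pos_nonneg (hT : MeasurePreserving T μ μ) {f : α → ℝ} (hfm : Measurable f)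
    (hf : Integrable f μ) (n : ℕ) : 0 ≤ ∫ a in {a | 0 < maxSum T f (n + 1) a}, f a ∂μ := by
  have hm : ∀ n, Measurable (maxSum T f n) := by
    intro n
    induction n with
    | zero => exact measurable_const
    | succ n ih => exact measurable_const.max (hfm.add (ih.comp hT.measurable))
  have hi := integrable_maxSum hT hf (n + 1)
  have hi' : Integrable (fun a ↦ maxSum T f (n + 1) (T a)) μ := hT.integrable_comp_of_integrable hi
  have hE : MeasurableSet {a | 0 < maxSum T f (n + 1) a} := measurableSet_lt measurable_const (hm _)
  rw [← integral_indicator hE]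
  -- The maximum M and its shift M∘T have equal integrals, while M - M∘T ≤ f where M is positive and
  -- M - M∘T ≤ 0 elsewhere.
  have h1 : ∫ a, (maxSum T f (n + 1) a - maxSum T f (n + 1) (T a)) ∂μ = 0 := by
    rw [integral_sub hi hi', integral_comp_measurePreserving hT (hm _), sub_self]
  refine h1.symm.le.trans ?_
  refine integral_mono (hi.sub hi') (hf.indicator hE) fun a ↦ ?_
  by_cases ha : 0 < maxSum T f (n + 1) a
  · rw [Set.indicator_of_mem (by exact ha)]
    have h2 : maxSum T f (n + 1) a = f a + maxSum T f n (T a) := by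
      rcases le_total 0 (f a + maxSum T f n (T a)) with h | h
      · exact max_eq_right h
      · exact absurd (max_eq_left h) ha.ne'
    have h3 := maxSum_le_succ (T := T) f n (T a)
    simp only
    linarith
  · rw [Set.indicator_of_notMem (by exact ha)]
    have h3 := maxSum_nonneg (T := T) f (n + 1) (T a)
    simp only
    linarith

/-- The maximal inequality for ergodic averages of nonnegative functions. -/
lemma measure_exists_birkhoffSum_gt_le (hT : MeasurePreserving T μ μ) {f : α → ℝ}
    (hfm : Measurable f) (hf : Integrable f μ) (h0 : ∀ a, 0 ≤ f a) {c : ℝ} (hc : 0 < c) :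
    μ {a | ∃ n : ℕ, c * n < birkhoffSum T f n a} ≤ ENNReal.ofReal ((∫ a, f a ∂μ) / c) := by
  -- An average of f exceeds c exactly when a partial sum of f - c is positive, so the maximal
  -- theorem is applied to f - c.
  let g : α → ℝ := fun a ↦ f a - c
  have hg : Integrable g μ := hf.sub (integrable_const c)
  let E : ℕ → Set α := fun n ↦ {a | 0 < maxSum T g (n + 1) a}
  have hmono : Monotone E := monotone_nat_of_le_succ fun n a ha ↦
    lt_of_lt_of_le ha (maxSum_le_succ (T := T) g (n + 1) a)
  have hsum : ∀ n a, birkhoffSum T g n a = birkhoffSum T f n a - c * n := by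
    intro n a
    simp [birkhoffSum, g, Finset.sum_sub_distrib, mul_comm]
  have hsub : {a | ∃ n : ℕ, c * n < birkhoffSum T f n a} ⊆ ⋃ n, E n := by
    rintro a ⟨n, hn⟩
    cases n with
    | zero => simp at hn
    | succ n =>
      refine Set.mem_iUnion.mpr ⟨n, lt_of_lt_of_le ?_ (birkhoffSum_le_maxSum g (n + 1) a)⟩
      rw [hsum]; linarith
  refine (measure_mono hsub).trans ?_
  rw [hmono.measure_iUnion]
  refine iSup_le fun n ↦ ?_
  have h1 := setIntegral_maxSum_pos_nonneg hT (hfm.sub measurable_const) hg n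
  change 0 ≤ ∫ a in E n, (f a - c) ∂μ at h1
  rw [integral_sub hf.integrableOn (integrable_const c).integrableOn, setIntegral_const,
    smul_eq_mul] at h1
  have h2 : ∫ a in E n, f a ∂μ ≤ ∫ a, f a ∂μ :=
    setIntegral_le_integral hf (ae_of_all _ h0)
  have h3 : μ.real (E n) ≤ (∫ a, f a ∂μ) / c := by
    rw [le_div_iff₀ hc]; linarith
  rw [← ofReal_measureReal]
  exact ENNReal.ofReal_le_ofReal h3

omit [IsProbabilityMeasure μ] in
/-- A square integrable function grows sublinearly along almost every orbit. -/
lemma ae_tendsto_iterate_div (hT : MeasurePreserving T μ μ) {f : α → ℝ} (hfm : Measurable f)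
    (hf : Integrable (fun a ↦ f a ^ 2) μ) :
    ∀ᵐ a ∂μ, Tendsto (fun n : ℕ ↦ f (T^[n] a) / (n : ℝ)) atTop (𝓝 0) := by
  -- These terms have integral of order 1/n², so their sum is finite almost everywhere and they tend
  -- to 0.
  let F : ℕ → α → ℝ≥0∞ := fun n a ↦ ENNReal.ofReal ((f (T^[n] a) / (n : ℝ)) ^ 2)
  have hTn : ∀ n, MeasurePreserving T^[n] μ μ := fun n ↦ hT.iterate n
  have hFm : ∀ n, Measurable (F n) := fun n ↦
    (((hfm.comp (hTn n).measurable).div_const _).pow_const 2).ennreal_ofReal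
  have hF : ∀ n, ∫⁻ a, F n a ∂μ = ENNReal.ofReal ((∫ a, f a ^ 2 ∂μ) * (1 / (n : ℝ) ^ 2)) := by
    intro n
    have h1 : Integrable (fun a ↦ f (T^[n] a) ^ 2) μ := (hTn n).integrable_comp_of_integrable hf
    have h2 : ∫ a, (f (T^[n] a) / (n : ℝ)) ^ 2 ∂μ = (∫ a, f a ^ 2 ∂μ) * (1 / (n : ℝ) ^ 2) := by
      simp only [div_pow]
      rw [integral_div, integral_comp_measurePreserving (hTn n) (f := fun a ↦ f a ^ 2)
        (hfm.pow_const 2)]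
      ring
    rw [← h2, ofReal_integral_eq_lintegral_ofReal]
    · simpa only [div_pow] using h1.div_const _
    · exact ae_of_all _ fun a ↦ sq_nonneg _
  have hsum : Summable fun n : ℕ ↦ (∫ a, f a ^ 2 ∂μ) * (1 / (n : ℝ) ^ 2) :=
    (Real.summable_one_div_nat_pow.mpr (by norm_num)).mul_left _
  have hnn : ∀ n : ℕ, 0 ≤ (∫ a, f a ^ 2 ∂μ) * (1 / (n : ℝ) ^ 2) := fun n ↦
    mul_nonneg (integral_nonneg fun a ↦ sq_nonneg _) (by positivity)
  have hfin : ∫⁻ a, ∑' n, F n a ∂μ ≠ ∞ := by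
    rw [lintegral_tsum fun n ↦ (hFm n).aemeasurable]
    simp_rw [hF]
    rw [← ENNReal.ofReal_tsum_of_nonneg hnn hsum]
    exact ENNReal.ofReal_ne_top
  filter_upwards [ae_lt_top (Measurable.tsum hFm) hfin] with a ha
  have h1 : Tendsto (fun n ↦ F n a) atTop (𝓝 0) := ENNReal.tendsto_atTop_zero_of_tsum_ne_top ha.ne
  have h2 := (ENNReal.tendsto_toReal ENNReal.zero_ne_top).comp h1
  have h3 : Tendsto (fun n : ℕ ↦ (f (T^[n] a) / (n : ℝ)) ^ 2) atTop (𝓝 0) := by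
    refine h2.congr fun n ↦ ?_
    simp [F, ENNReal.toReal_ofReal (sq_nonneg _)]
  have h4 := h3.sqrt
  rw [Real.sqrt_zero] at h4
  simp only [Real.sqrt_sq_eq_abs] at h4
  exact (tendsto_zero_iff_abs_tendsto_zero _).mpr h4

omit [MeasurableSpace α] in
-- Averaging f, or averaging its block sums of length N and dividing by N, differs only by boundary
-- terms at both ends of the orbit; these are negligible after division by n.
lemma mul_birkhoffSum_sub (f : α → ℝ) (N n : ℕ) (a : α) :
    N * birkhoffSum T f n a - birkhoffSum T (birkhoffSum T f N) n a =
      ∑ k ∈ Finset.range N, (birkhoffSum T f k a - birkhoffSum T f k (T^[n] a)) := by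
  have h1 : birkhoffSum T (birkhoffSum T f N) n a =
      ∑ k ∈ Finset.range N, birkhoffSum T f n (T^[k] a) := by
    simp only [birkhoffSum]
    rw [Finset.sum_comm]
    refine Finset.sum_congr rfl fun k _ ↦ Finset.sum_congr rfl fun j _ ↦ ?_
    rw [← Function.iterate_add_apply, ← Function.iterate_add_apply, add_comm]
  rw [h1, ← nsmul_eq_mul, ← Finset.card_range N, ← Finset.sum_const, Finset.card_range,
    ← Finset.sum_sub_distrib]
  refine Finset.sum_congr rfl fun k _ ↦ ?_
  have h2 := birkhoffSum_add T f n k a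
  have h3 := birkhoffSum_add T f k n a
  rw [add_comm k n] at h3
  linarith

/-- If the ergodic averages of a square integrable function tend to zero in `L¹`, then they tend to
zero almost surely. -/
theorem ae_tendsto_birkhoffAverage_zero (hT : MeasurePreserving T μ μ) {f : α → ℝ}
    (hfm : Measurable f) (hf : Integrable (fun a ↦ f a ^ 2) μ)
    (hlim : Tendsto (fun N : ℕ ↦ ∫ a, |birkhoffSum T f N a / N| ∂μ) atTop (𝓝 0)) :
    ∀ᵐ a ∂μ, Tendsto (fun n : ℕ ↦ birkhoffSum T f n a / n) atTop (𝓝 0) := by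
  have hSm : ∀ N, Measurable (birkhoffSum T f N) := fun N ↦
    Finset.measurable_sum _ fun k _ ↦ hfm.comp (hT.iterate k).measurable
  have hfi : Integrable f μ :=
    ((memLp_two_iff_integrable_sq hfm.aestronglyMeasurable).mpr hf).integrable (by norm_num)
  have hSi : ∀ N, Integrable (birkhoffSum T f N) μ := fun N ↦
    integrable_finsetSum _ fun k _ ↦ (hT.iterate k).integrable_comp_of_integrable hfi
  have hcob : ∀ᵐ a ∂μ, ∀ N : ℕ, Tendsto (fun n : ℕ ↦
      (N * birkhoffSum T f n a - birkhoffSum T (birkhoffSum T f N) n a) / n) atTop (𝓝 0) := by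
    have hit : ∀ᵐ a ∂μ, ∀ k : ℕ, Tendsto (fun n : ℕ ↦ f (T^[k] (T^[n] a)) / (n : ℝ)) atTop (𝓝 0) := by
      refine ae_all_iff.mpr fun k ↦ ?_
      exact ae_tendsto_iterate_div hT (hfm.comp (hT.iterate k).measurable)
        ((hT.iterate k).integrable_comp_of_integrable hf)
    filter_upwards [hit] with a ha N
    simp only [mul_birkhoffSum_sub, Finset.sum_div]
    rw [show (0 : ℝ) = ∑ k ∈ Finset.range N, (0 - ∑ j ∈ Finset.range k, (0 : ℝ)) by simp]
    refine tendsto_finsetSum _ fun k _ ↦ ?_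
    simp only [sub_div]
    refine Tendsto.sub (tendsto_const_nhds.div_atTop tendsto_natCast_atTop_atTop) ?_
    simp only [birkhoffSum, Finset.sum_div]
    exact tendsto_finsetSum _ fun j _ ↦ ha j
  -- By the maximal inequality, the averages of |A_N f|, with A_N f the ergodic average of length N,
  -- stay below c off a set of measure at most ‖A_N f‖₁/c. This tends to 0, so almost every point is
  -- good for some N. There the averages of f are eventually below c plus the boundary terms, which
  -- are at most c.
  have hbad : ∀ c : ℝ, 0 < c →
      ∀ᵐ a ∂μ, ∀ᶠ n : ℕ in atTop, |birkhoffSum T f n a / n| ≤ 2 * c := by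
    intro c hc
    let E : ℕ → Set α := fun N ↦
      {a | ∃ n : ℕ, c * n < birkhoffSum T (fun a ↦ |birkhoffSum T f N a / N|) n a}
    have hE : ∀ N, μ (E N) ≤ ENNReal.ofReal ((∫ a, |birkhoffSum T f N a / N| ∂μ) / c) := fun N ↦
      measure_exists_birkhoffSum_gt_le hT (((hSm N).div_const _).abs) (((hSi N).div_const _).abs)
        (fun a ↦ abs_nonneg _) hc
    -- The index starts at 1: for N = 0 the quotient is 0 by convention and E 0 is empty, so
    -- including it would make the statement void.
    have hnull : μ (⋂ N, E (N + 1)) = 0 := by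
      have h1 := ENNReal.tendsto_ofReal ((hlim.div_const c).comp (tendsto_add_atTop_nat 1))
      rw [zero_div, ENNReal.ofReal_zero] at h1
      refine le_antisymm (ge_of_tendsto' h1 fun N ↦ ?_) zero_le
      exact (measure_mono (Set.iInter_subset _ N)).trans (hE (N + 1))
    filter_upwards [hcob, measure_eq_zero_iff_ae_notMem.mp hnull] with a h1 h2
    rw [Set.mem_iInter, not_forall] at h2
    obtain ⟨N, hN⟩ := h2
    have hN' : ∀ n : ℕ, birkhoffSum T (fun a ↦ |birkhoffSum T f (N + 1) a / (N + 1 : ℕ)|) n a ≤ c * n := by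
      intro n
      by_contra hcon
      exact hN ⟨n, not_le.mp hcon⟩
    have hNpos : (0 : ℝ) < (N + 1 : ℕ) := by positivity
    have h3 := (h1 (N + 1)).abs
    rw [abs_zero] at h3
    filter_upwards [h3.eventually_le_const (show 0 < c * (N + 1 : ℕ) by positivity),
      eventually_gt_atTop 0] with n hn hn0
    have hnpos : (0 : ℝ) < n := by exact_mod_cast hn0
    rw [abs_div, abs_of_pos hnpos, div_le_iff₀ hnpos] at hn ⊢
    have h4 : |birkhoffSum T (birkhoffSum T f (N + 1)) n a| ≤ (N + 1 : ℕ) * (c * n) := by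
      refine le_trans ?_ (mul_le_mul_of_nonneg_left (hN' n) hNpos.le)
      simp only [birkhoffSum]
      rw [Finset.mul_sum]
      refine (Finset.abs_sum_le_sum_abs _ _).trans (le_of_eq (Finset.sum_congr rfl fun k _ ↦ ?_))
      rw [abs_div, abs_of_pos hNpos, mul_div_cancel₀ _ hNpos.ne']
    have h5 : (N + 1 : ℕ) * |birkhoffSum T f n a| ≤ (N + 1 : ℕ) * (2 * c * n) := by
      rw [← abs_of_pos hNpos, ← abs_mul, abs_of_pos hNpos]
      have := abs_sub_abs_le_abs_sub (((N + 1 : ℕ) : ℝ) * birkhoffSum T f n a)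
        (birkhoffSum T (birkhoffSum T f (N + 1)) n a)
      linarith
    exact le_of_mul_le_mul_left h5 hNpos
  have hall : ∀ᵐ a ∂μ, ∀ m : ℕ, ∀ᶠ n : ℕ in atTop,
      |birkhoffSum T f n a / n| ≤ 2 * (1 / ((m : ℝ) + 1)) :=
    ae_all_iff.mpr fun m ↦ hbad _ (by positivity)
  filter_upwards [hall] with a ha
  rw [Metric.tendsto_atTop']
  intro ε hε
  obtain ⟨m, hm⟩ := exists_nat_one_div_lt (half_pos hε)
  obtain ⟨n₀, hn₀⟩ := eventually_atTop.mp (ha m)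
  refine ⟨n₀, fun n hn ↦ ?_⟩
  rw [Real.dist_eq, sub_zero]
  exact lt_of_le_of_lt (hn₀ n hn.le) (by linarith)

end Ergodic

/-! ### The law of large numbers for the squares of a stationary Gaussian sequence -/

/-- The squared norm of the sum of N terms is at most 2N ∑_{n<N} |h n|. After division by N² this is
twice a Cesàro mean of a null sequence. -/
lemma tendsto_norm_average_zero {E : Type*} [NormedAddCommGroup E] [InnerProductSpace ℝ E]
    {f : ℕ → E} {h : ℕ → ℝ} (hf : ∀ j n, inner ℝ (f j) (f (j + n)) = h n)
    (hh : Tendsto h atTop (𝓝 0)) :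
    Tendsto (fun N : ℕ ↦ ‖(N : ℝ)⁻¹ • ∑ k ∈ Finset.range N, f k‖) atTop (𝓝 0) := by
  have hbd : ∀ N : ℕ, ‖∑ k ∈ Finset.range N, f k‖ ^ 2 ≤ 2 * N * ∑ n ∈ Finset.range N, |h n| := by
    intro N
    induction N with
    | zero => simp
    | succ N ih =>
      have h1 : inner ℝ (∑ k ∈ Finset.range N, f k) (f N) = ∑ k ∈ Finset.range N, h (k + 1) := by
        rw [sum_inner, ← Finset.sum_range_reflect (fun k ↦ h (k + 1))]
        refine Finset.sum_congr rfl fun k hk ↦ ?_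
        have hkN := Finset.mem_range.mp hk
        rw [← hf k, show k + (N - 1 - k + 1) = N by omega]
      have h2 : ‖f N‖ ^ 2 = h 0 := by rw [← real_inner_self_eq_norm_sq, ← hf N 0, add_zero]
      have h3 : ∑ k ∈ Finset.range N, h (k + 1) ≤ ∑ k ∈ Finset.range N, |h (k + 1)| :=
        Finset.sum_le_sum fun k _ ↦ le_abs_self _
      have h4 := Finset.sum_range_succ' (fun n ↦ |h n|) N
      have h5 : ∑ n ∈ Finset.range N, |h n| ≤ ∑ n ∈ Finset.range (N + 1), |h n| :=
        Finset.sum_le_sum_of_subset_of_nonneg (Finset.range_mono (Nat.le_succ N))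
          fun _ _ _ ↦ abs_nonneg _
      rw [Finset.sum_range_succ, norm_add_sq_real, h1, h2]
      push_cast
      nlinarith [le_abs_self (h 0), abs_nonneg (h 0),
        mul_le_mul_of_nonneg_left h5 (Nat.cast_nonneg (α := ℝ) N)]
  have hces := (hh.abs).cesaro
  rw [abs_zero] at hces
  have hsq : Tendsto (fun N : ℕ ↦ ‖(N : ℝ)⁻¹ • ∑ k ∈ Finset.range N, f k‖ ^ 2) atTop (𝓝 0) := by
    have h0 := hces.const_mul 2
    rw [mul_zero] at h0
    refine tendsto_of_tendsto_of_tendsto_of_le_of_le' tendsto_const_nhds h0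
      (Eventually.of_forall fun N ↦ sq_nonneg _) ?_
    filter_upwards [eventually_gt_atTop 0] with N hN
    have hNpos : (0 : ℝ) < N := by exact_mod_cast hN
    rw [norm_smul, mul_pow, norm_inv, Real.norm_of_nonneg hNpos.le]
    calc _ ≤ ((N : ℝ)⁻¹) ^ 2 * (2 * N * ∑ n ∈ Finset.range N, |h n|) :=
          mul_le_mul_of_nonneg_left (hbd N) (by positivity)
      _ = _ := by field_simp
  have := hsq.sqrt
  simpa [Real.sqrt_sq (norm_nonneg _)] using this

section LLN

variable {Ω : Type*} [MeasurableSpace Ω] {P : Measure Ω} [IsProbabilityMeasure P]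
  {K : Submodule ℝ (Lp ℝ 2 P)}

lemma IsGaussSpace.memLp (hK : IsGaussSpace K) {x : Lp ℝ 2 P} (hx : x ∈ K) {X : Ω → ℝ}
    (hX : x =ᵐ[P] X) {p : ℝ≥0∞} (hp : p ≠ ∞) : MemLp X p P := by
  have hm : AEMeasurable X P := (Lp.aestronglyMeasurable x).aemeasurable.congr hX
  have h := memLp_id_gaussianReal' (μ := 0) (v := (‖x‖ ^ 2).toNNReal) p hp
  rw [← hK.map_eq hx hX] at h
  exact (memLp_map_measure_iff aestronglyMeasurable_id hm).mp h

lemma IsGaussSpace.memLp_pow (hK : IsGaussSpace K) {x : Lp ℝ 2 P} (hx : x ∈ K) {X : Ω → ℝ}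
    (hX : x =ᵐ[P] X) (n : ℕ) : MemLp (fun ω ↦ X ω ^ (n + 1)) 2 P := by
  have hp : (2 * ((n + 1 : ℕ) : ℝ≥0∞)) ≠ ∞ := ENNReal.mul_ne_top (by simp) (ENNReal.natCast_ne_top _)
  have h := (hK.memLp hx hX hp).norm_rpow_div ((n + 1 : ℕ) : ℝ≥0∞)
  rw [ENNReal.mul_div_cancel_right (by simp) (ENNReal.natCast_ne_top _)] at h
  have hm : AEStronglyMeasurable X P := (Lp.aestronglyMeasurable x).congr hX
  refine (memLp_congr_norm h.1 (hm.pow (n + 1)) (Eventually.of_forall fun ω ↦ ?_)).mp h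
  simp only [ENNReal.toReal_natCast, Real.rpow_natCast, norm_pow, norm_norm, Pi.pow_apply]

/-- Covariance of the squares of two elements of equal norm in a Gaussian subspace. -/
lemma IsGaussSpace.integral_sq_mul_sq (hK : IsGaussSpace K) {x y : Lp ℝ 2 P} (hx : x ∈ K)
    (hy : y ∈ K) {X Y : Ω → ℝ} (hX : x =ᵐ[P] X) (hY : y =ᵐ[P] Y) {s : ℝ} (hxs : ‖x‖ ^ 2 = s)
    (hys : ‖y‖ ^ 2 = s) :
    ∫ ω, (X ω ^ 2 - s) * (Y ω ^ 2 - s) ∂P =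
      (inner ℝ x y / s) ^ 2 * ∫ z, (z ^ 2 - s) ^ 2 ∂gaussianReal 0 s.toNNReal := by
  have hs0 : 0 ≤ s := hxs ▸ sq_nonneg _
  set m := ∫ z, (z ^ 2 - s) ^ 2 ∂gaussianReal 0 s.toNNReal with hm
  -- In the degenerate case s = 0 the quotient is 0 by convention, and both sides vanish.
  rcases hs0.eq_or_lt with h0 | hpos
  · subst h0
    have hx0 : x = 0 := by simpa using hxs
    have : X =ᵐ[P] 0 := hX.symm.trans (by rw [hx0]; exact Lp.coeFn_zero ℝ 2 P)
    rw [div_zero, zero_pow two_ne_zero, zero_mul]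
    refine integral_eq_zero_of_ae ?_
    filter_upwards [this] with ω h
    simp [h]
  -- Regression of Y on X: Y = ρX + ξ with ξ independent of X. In the expansion every term but ρ²(X²
  -- - s)² has mean zero; the moment m is never evaluated.
  set ρ := inner ℝ x y / s with hρ
  have hxiK : y - ρ • x ∈ K := K.sub_mem hy (K.smul_mem _ hx)
  have hxi : (y - ρ • x : Lp ℝ 2 P) =ᵐ[P] fun ω ↦ Y ω - ρ * X ω := by
    filter_upwards [Lp.coeFn_sub y (ρ • x), Lp.coeFn_smul ρ x, hX, hY] with ω h1 h2 h3 h4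
    rw [h1, Pi.sub_apply, h2, Pi.smul_apply, smul_eq_mul, h3, h4]
  have hXm : AEMeasurable X P := (Lp.aestronglyMeasurable x).aemeasurable.congr hX
  have hYm : AEMeasurable Y P := (Lp.aestronglyMeasurable y).aemeasurable.congr hY
  have horth : inner ℝ x (y - ρ • x) = 0 := by
    rw [inner_sub_right, inner_smul_right, real_inner_self_eq_norm_sq, hxs, hρ]
    field_simp
    ring
  have hind : IndepFun X (fun ω ↦ Y ω - ρ * X ω) P :=
    (hK.indepFun (ι := Unit) (x := fun _ ↦ x) (fun _ ↦ hx) hxiK (fun _ ↦ hX) hxi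
      (fun _ ↦ horth)).comp (measurable_pi_apply ()) measurable_id
  set ξ : Ω → ℝ := fun ω ↦ Y ω - ρ * X ω with hξ
  have hX2 := hK.memLp_pow hx hX 1
  have hξ2 := hK.memLp_pow hxiK hxi 1
  have hX1 := hK.memLp_pow hx hX 0
  have hξ1 := hK.memLp_pow hxiK hxi 0
  simp only [zero_add, pow_one, Nat.reduceAdd] at hX1 hX2 hξ1 hξ2
  have hg := hX2.sub (memLp_const s)
  have hg0 : ∫ ω, (X ω ^ 2 - s) ∂P = 0 := by
    rw [integral_sub (hX2.integrable one_le_two) (integrable_const s), ← norm_sq_eq_integral_sq hX,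
      hxs]
    simp
  have hgg : ∫ ω, (X ω ^ 2 - s) ^ 2 ∂P = m := by
    rw [hm, ← hxs, ← hK.map_eq hx hX, integral_map hXm (by fun_prop)]
  have hi1 : Integrable (fun ω ↦ (X ω ^ 2 - s) * (X ω ^ 2)) P := hg.integrable_mul hX2
  have hi2 : Integrable (fun ω ↦ (X ω ^ 2 - s) * (X ω)) P := hg.integrable_mul hX1
  have hξm : AEMeasurable ξ P := hYm.sub (hXm.const_mul ρ)
  have hgi : Integrable (fun ω ↦ X ω ^ 2 - s) P := hg.integrable one_le_two
  have hξi : Integrable ξ P := hξ1.integrable one_le_two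
  have hξ2i : Integrable (fun ω ↦ ξ ω ^ 2) P := hξ2.integrable one_le_two
  have hI1 : IndepFun (fun ω ↦ (X ω ^ 2 - s) * X ω) ξ P :=
    hind.comp (φ := fun z ↦ (z ^ 2 - s) * z) (by fun_prop) measurable_id
  have hI2 : IndepFun (fun ω ↦ X ω ^ 2 - s) (fun ω ↦ ξ ω ^ 2) P :=
    hind.comp (φ := fun z ↦ z ^ 2 - s) (ψ := fun z ↦ z ^ 2) (by fun_prop) (by fun_prop)
  have hA : ∫ ω, (X ω ^ 2 - s) * X ω * ξ ω ∂P = 0 := by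
    have h := hI1.integral_fun_mul_eq_mul_integral hi2.1 hξi.1
    rw [h, show ∫ ω, ξ ω ∂P = 0 from hK.integral_eq_zero hxiK hxi, mul_zero]
  have hAi : Integrable (fun ω ↦ (X ω ^ 2 - s) * X ω * ξ ω) P := hI1.integrable_mul hi2 hξi
  have hB : ∫ ω, (X ω ^ 2 - s) * ξ ω ^ 2 ∂P = 0 := by
    have h := hI2.integral_fun_mul_eq_mul_integral hgi.1 hξ2i.1
    rw [h, hg0, zero_mul]
  have hBi : Integrable (fun ω ↦ (X ω ^ 2 - s) * ξ ω ^ 2) P := hI2.integrable_mul hgi hξ2i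
  have hCi : Integrable (fun ω ↦ (X ω ^ 2 - s) ^ 2) P := hg.integrable_sq
  calc ∫ ω, (X ω ^ 2 - s) * (Y ω ^ 2 - s) ∂P
      = ∫ ω, (ρ ^ 2 * (X ω ^ 2 - s) ^ 2 + (ρ ^ 2 * s - s) * (X ω ^ 2 - s)
          + (2 * ρ) * ((X ω ^ 2 - s) * X ω * ξ ω) + (X ω ^ 2 - s) * ξ ω ^ 2) ∂P := by
        refine integral_congr_ae (Eventually.of_forall fun ω ↦ ?_)
        simp only [hξ]
        ring
    _ = ρ ^ 2 * m := by
        have hD : Integrable (fun ω ↦ ρ ^ 2 * (X ω ^ 2 - s) ^ 2 + (ρ ^ 2 * s - s) * (X ω ^ 2 - s)) P :=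
          (hCi.const_mul _).add (hgi.const_mul _)
        have hE : Integrable (fun ω ↦ ρ ^ 2 * (X ω ^ 2 - s) ^ 2 + (ρ ^ 2 * s - s) * (X ω ^ 2 - s)
            + (2 * ρ) * ((X ω ^ 2 - s) * X ω * ξ ω)) P := hD.add (hAi.const_mul _)
        rw [integral_add hE hBi, integral_add hD (hAi.const_mul _),
          integral_add (hCi.const_mul _) (hgi.const_mul _), integral_const_mul, integral_const_mul,
          integral_const_mul, hgg, hg0, hA, hB]
        ring

/-- The sample power of a stationary Gaussian sequence with a spectral density converges almost
surely. -/
theorem IsGaussSpace.ae_tendsto_average_sq (hK : IsGaussSpace K) {u : ℤ → Lp ℝ 2 P}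
    (hu : ∀ t, u t ∈ K) {U : ℤ → Ω → ℝ} (hU : ∀ t, u t =ᵐ[P] U t) (hUm : ∀ t, Measurable (U t))
    {S : ℝ → ℝ} (hS : HasSpectrum u S) :
    ∀ᵐ ω ∂P, Tendsto (fun T : ℕ ↦ (1 / (T : ℝ)) * ∑ t ∈ Finset.Icc 1 T, U (t : ℤ) ω ^ 2) atTop
      (𝓝 (∫ θ, S θ ∂circ)) := by
  set s := ∫ θ, S θ ∂circ with hs
  have hns : ∀ t, ‖u t‖ ^ 2 = s := hS.norm_sq
  let Φ : Ω → ℕ → ℝ := fun ω k ↦ U ((k : ℤ) + 1) ω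
  let T : (ℕ → ℝ) → ℕ → ℝ := fun x k ↦ x (k + 1)
  have hΦ : Measurable Φ := measurable_pi_lambda _ fun k ↦ hUm _
  have hTm : Measurable T := measurable_pi_lambda _ fun k ↦ measurable_pi_apply _
  let μ := P.map Φ
  have hμ : IsProbabilityMeasure μ := Measure.isProbabilityMeasure_map hΦ.aemeasurable
  -- Equality of laws on sequence space is tested on finite sets of indices. There a law in the
  -- Gaussian subspace is determined by its inner products, which are shift invariant.
  have hT : MeasurePreserving T μ μ := by
    refine ⟨hTm, ?_⟩
    rw [Measure.map_map hTm hΦ]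
    refine (map_eq_iff_forall_finset_map_restrict_eq (X := fun (k : ℕ) ω ↦ U (((k + 1 : ℕ) : ℤ) + 1) ω)
      (Y := fun (k : ℕ) ω ↦ U ((k : ℤ) + 1) ω)
      (measurable_pi_lambda _ fun k ↦ hUm _).aemeasurable hΦ.aemeasurable).mpr fun I ↦ ?_
    refine hK.map_pi_eq (x := fun k : I ↦ u (((k + 1 : ℕ) : ℤ) + 1)) (y := fun k : I ↦ u ((k : ℤ) + 1))
      (fun k ↦ hu _) (fun k ↦ hu _) (fun k ↦ hU _) (fun k ↦ hU _) fun i j ↦ ?_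
    rw [← hS.inner_shift ((i : ℕ) + 1) ((j : ℕ) + 1) 1]
    push_cast
    rfl
  let f : (ℕ → ℝ) → ℝ := fun x ↦ x 0 ^ 2 - s
  have hfm : Measurable f := ((measurable_pi_apply 0).pow_const 2).sub measurable_const
  have hL2 : ∀ t, MemLp (fun ω ↦ U t ω ^ 2 - s) 2 P := fun t ↦
    (hK.memLp_pow (hu t) (hU t) 1).sub (memLp_const s)
  have hf2 : Integrable (fun a ↦ f a ^ 2) μ := by
    rw [integrable_map_measure (hfm.pow_const 2).aestronglyMeasurable hΦ.aemeasurable]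
    exact (hL2 1).integrable_sq
  have hiter : ∀ k (x : ℕ → ℝ), T^[k] x = fun j ↦ x (j + k) := by
    intro k
    induction k with
    | zero => intro x; rfl
    | succ k ih =>
      intro x
      rw [Function.iterate_succ_apply, ih]
      funext j
      simp only [T]
      congr 1
  have hsum : ∀ n ω, birkhoffSum T f n (Φ ω) = ∑ k ∈ Finset.range n, (U ((k : ℤ) + 1) ω ^ 2 - s) := by
    intro n ω
    simp only [birkhoffSum, hiter, f, Φ, zero_add]
  have hlim : Tendsto (fun N : ℕ ↦ ∫ a, |birkhoffSum T f N a / N| ∂μ) atTop (𝓝 0) := by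
    let g : ℕ → Lp ℝ 2 P := fun k ↦ (hL2 ((k : ℤ) + 1)).toLp
    have hg : ∀ k, g k =ᵐ[P] fun ω ↦ U ((k : ℤ) + 1) ω ^ 2 - s := fun k ↦ MemLp.coeFn_toLp _
    have h1 := tendsto_norm_average_zero (f := g) (h := fun n ↦ (inner ℝ (u n) (u 0) / s) ^ 2 *
        ∫ z, (z ^ 2 - s) ^ 2 ∂gaussianReal 0 s.toNNReal) (fun j n ↦ by
      rw [inner_eq_integral_mul (hg j) (hg (j + n)), hK.integral_sq_mul_sq (hu _) (hu _) (hU _) (hU _)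
        (hns _) (hns _), real_inner_comm, ← hS.inner_shift (n : ℤ) 0 ((j : ℤ) + 1)]
      congr 5
      · push_cast; ring
      · ring) (by
      have := ((hS.tendsto_inner_zero.div_const s).pow 2).mul_const
        (∫ z, (z ^ 2 - s) ^ 2 ∂gaussianReal 0 s.toNNReal)
      simpa using this)
    refine squeeze_zero (fun N ↦ integral_nonneg fun a ↦ abs_nonneg _) (fun N ↦ ?_) h1
    have hae : ((N : ℝ)⁻¹ • ∑ k ∈ Finset.range N, g k : Lp ℝ 2 P) =ᵐ[P]
        fun ω ↦ birkhoffSum T f N (Φ ω) / N := by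
      rw [Finset.smul_sum]
      filter_upwards [coeFn_sum_smul (Finset.range N) (fun _ ↦ (N : ℝ)⁻¹) hg] with ω h
      rw [h, hsum, ← Finset.mul_sum]; ring
    have hSm : Measurable fun a ↦ |birkhoffSum T f N a / N| :=
      ((Finset.measurable_sum _ fun k _ ↦ hfm.comp (hT.iterate k).measurable).div_const _).abs
    rw [integral_map hΦ.aemeasurable hSm.aestronglyMeasurable]
    refine le_trans (le_of_eq (integral_congr_ae ?_)) (integral_abs_le_norm _)
    filter_upwards [hae] with ω h using by rw [h]
  have hfin := ae_of_ae_map hΦ.aemeasurable (ae_tendsto_birkhoffAverage_zero hT hfm hf2 hlim)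
  filter_upwards [hfin] with ω hω
  have h1 := hω.add_const s
  rw [zero_add] at h1
  refine h1.congr' ?_
  filter_upwards [eventually_gt_atTop 0] with n hn
  have hnpos : (0 : ℝ) < n := by exact_mod_cast hn
  have h2 : ∑ t ∈ Finset.Icc 1 n, U (t : ℤ) ω ^ 2 = ∑ k ∈ Finset.range n, U ((k : ℤ) + 1) ω ^ 2 := by
    rw [Finset.range_eq_Ico, ← Finset.Ico_add_one_right_eq_Icc,
      ← Finset.sum_Ico_add' (fun t : ℕ ↦ U (t : ℤ) ω ^ 2) 0 n 1]
    simp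
  rw [hsum, Finset.sum_sub_distrib, Finset.sum_const, Finset.card_range, nsmul_eq_mul, h2]
  field_simp
  ring

end LLN

/-! ### The signals of the loop as stationary sequences in `L²` -/

section Signals

variable {Ω : Type*} [MeasurableSpace Ω] {P : Measure Ω} [IsProbabilityMeasure P]

omit [IsProbabilityMeasure P] in
lemma IsWhiteGaussianNoise.isGaussianProcess {e : ℤ → Ω → ℝ} (he : IsWhiteGaussianNoise P e) :
    IsGaussianProcess e P := by
  refine ⟨fun I ↦ ?_⟩
  have h1 : ∀ i : I, HasGaussianLaw (e i) P := fun i ↦ ⟨by rw [he.law]; infer_instance⟩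
  exact (he.indep.precomp Subtype.val_injective).hasGaussianLaw h1

/-- White noise as an orthonormal sequence in `L²`. -/
lemma IsWhiteGaussianNoise.exists_hasSpectrum {e : ℤ → Ω → ℝ} (he : IsWhiteGaussianNoise P e) :
    ∃ x : ℤ → Lp ℝ 2 P, (∀ t, x t =ᵐ[P] e t) ∧ HasSpectrum x (fun _ ↦ 1) ∧
      IsGaussSpace (Submodule.span ℝ (Set.range x)) := by
  have hG := he.isGaussianProcess
  have hL2 : ∀ t, MemLp (e t) 2 P := fun t ↦ (hG.hasGaussianLaw_eval t).memLp_two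
  have h0 : ∀ t, ∫ ω, e t ω ∂P = 0 := fun t ↦ by
    have := integral_map (he.measurable t).aemeasurable (f := fun z : ℝ ↦ z) (μ := P) (by fun_prop)
    rw [← this, he.law]
    exact integral_id_gaussianReal
  have hx : ∀ t, (hL2 t).toLp =ᵐ[P] e t := fun t ↦ MemLp.coeFn_toLp _
  refine ⟨fun t ↦ (hL2 t).toLp, hx, ⟨integrable_const 1, fun s t ↦ ?_⟩, isGaussSpace_span hx hG h0⟩
  simp only [Complex.ofReal_one, one_mul]
  rw [integral_circ_exp, inner_eq_integral_mul (hx s) (hx t)]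
  rcases eq_or_ne s t with rfl | hst
  · have h1 : ∫ ω, e s ω * e s ω ∂P = 1 := by
      have h2 := variance_eq_integral (he.measurable s).aemeasurable (μ := P)
      rw [h0 s] at h2
      have h3 := variance_id_gaussianReal (μ := 0) (v := 1)
      rw [← he.law s, variance_id_map (he.measurable s).aemeasurable, h2] at h3
      simpa [sq] using h3
    simp [h1]
  · rw [(he.indep.indepFun hst).integral_fun_mul_eq_mul_integral (hL2 s).1 (hL2 t).1, h0 s]
    simp [sub_eq_zero, hst]

lemma IsGaussianWithPSD.exists_hasSpectrum {S : ℝ → ℝ} {V : ℤ → Ω → ℝ}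
    (hV : IsGaussianWithPSD P S V) :
    ∃ x : ℤ → Lp ℝ 2 P, (∀ t, x t =ᵐ[P] V t) ∧ HasSpectrum x S ∧
      IsGaussSpace (Submodule.span ℝ (Set.range x)) := by
  have hL2 : ∀ t, MemLp (V t) 2 P := fun t ↦ (hV.gaussian.hasGaussianLaw_eval t).memLp_two
  have hx : ∀ t, (hL2 t).toLp =ᵐ[P] V t := fun t ↦ MemLp.coeFn_toLp _
  refine ⟨fun t ↦ (hL2 t).toLp, hx, ⟨integrable_circ_iff.mpr hV.psd_integrable, fun s t ↦ ?_⟩,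
    isGaussSpace_span hx hV.gaussian hV.mean_zero⟩
  rw [inner_eq_integral_mul (hx s) (hx t), hV.cov_eq, integral_circ, Complex.real_smul]
  push_cast
  rfl

omit [IsProbabilityMeasure P] in
/-- The output of a stable filter driven by a stationary sequence. -/
lemma HasSpectrum.exists_filterOutput {x : ℤ → Lp ℝ 2 P} {S : ℝ → ℝ} (hx : HasSpectrum x S)
    {X Z : ℤ → Ω → ℝ} (hX : ∀ t, x t =ᵐ[P] X t) {G : RatFunc ℝ} (hG : IsRHInf G)
    (hZ : IsFilterOutput P G X Z) :
    ∃ z : ℤ → Lp ℝ 2 P, (∀ t, z t =ᵐ[P] Z t) ∧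
      (∀ t, HasSum (fun k : ℕ ↦ impulse G k • x (t - k)) (z t)) ∧
      HasSpectrum z (fun θ ↦ gainSq G θ * S θ) := by
  have hC : ∀ t, ‖x t‖ ≤ √(∫ θ, S θ ∂circ) := fun t ↦ by
    rw [← hx.norm_sq t, Real.sqrt_sq (norm_nonneg _)]
  choose z hz hsum using fun t ↦ exists_hasSum_L2 hX hC hG.summable_impulse (hZ t)
  exact ⟨z, hz, hsum, hx.filter hG.summable_impulse hG.hasSum_freqResp hsum⟩

/-- Membership is required only where the coefficient is nonzero. This lets a strictly causal filter
skip the current sample. -/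
lemma mem_topologicalClosure_span_of_hasSum {E : Type*} [NormedAddCommGroup E] [NormedSpace ℝ E]
    {K : Submodule ℝ E} (hK : IsClosed (K : Set E)) {g : ℕ → ℝ} {x : ℕ → E} {z : E}
    (h : ∀ k, g k ≠ 0 → x k ∈ K) (hz : HasSum (fun k ↦ g k • x k) z) : z ∈ K := by
  refine hK.mem_of_tendsto hz (Eventually.of_forall fun s ↦ K.sum_mem fun k _ ↦ ?_)
  rcases eq_or_ne (g k) 0 with h0 | h0
  · simp [h0]
  · exact K.smul_mem _ (h k h0)

omit [IsProbabilityMeasure P] in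
/-- The spans in `L²` of two independent processes are independent. -/
lemma indepFun_of_mem_span {ι κ : Type*} {X : ι → Ω → ℝ} {Z : κ → Ω → ℝ} {x : ι → Lp ℝ 2 P}
    {z : κ → Lp ℝ 2 P} (hX : ∀ i, x i =ᵐ[P] X i) (hZ : ∀ i, z i =ᵐ[P] Z i)
    (h : IndepFun (fun ω i ↦ X i ω) (fun ω i ↦ Z i ω) P) {a b : Lp ℝ 2 P}
    (ha : a ∈ Submodule.span ℝ (Set.range x)) (hb : b ∈ Submodule.span ℝ (Set.range z)) :
    IndepFun a b P := by
  obtain ⟨c, hc⟩ := exists_finsupp_of_mem_span hX ha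
  obtain ⟨d, hd⟩ := exists_finsupp_of_mem_span hZ hb
  refine IndepFun.congr ?_ hc.symm hd.symm
  exact h.comp (φ := fun p : ι → ℝ ↦ ∑ i ∈ c.support, c i * p i)
    (ψ := fun p : κ → ℝ ↦ ∑ i ∈ d.support, d i * p i) (by fun_prop) (by fun_prop)

/-- The noise, the filtered message and the channel input of the loop, as stationary sequences in a
common Gaussian space. -/
theorem IsYoulaLoop.exists_signals {H Q Qv : RatFunc ℝ} {Sv : ℝ → ℝ} {W V U Y : ℤ → Ω → ℝ}
    (hH : IsRHInf H) (hQ : IsRHInf Q) (hQv : IsRHInf Qv) (hW : IsFilteredGaussianNoise P H W)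
    (hV : IsGaussianWithPSD P Sv V)
    (hVW : IndepFun (fun ω (t : ℤ) ↦ V t ω) (fun ω (t : ℤ) ↦ W t ω) P)
    (hloop : IsYoulaLoop P Q Qv W V U Y) :
    ∃ (K : Submodule ℝ (Lp ℝ 2 P)) (f g w : ℤ → Lp ℝ 2 P), IsGaussSpace K ∧
      (∀ t, f t ∈ K) ∧ (∀ t, g t ∈ K) ∧ (∀ t, w t ∈ K) ∧
      (∀ t, w t =ᵐ[P] W t) ∧ (∀ t, (f t + g t : Lp ℝ 2 P) =ᵐ[P] U t) ∧
      HasSpectrum f (fun θ ↦ gainSq Qv θ * Sv θ) ∧ HasSpectrum w (gainSq H) ∧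
      (∀ t, HasSum (fun k : ℕ ↦ impulse Q k • w (t - k)) (g t)) ∧
      ∀ s t, inner ℝ (f s) (w t) = 0 := by
  obtain ⟨-, e, he, hWe⟩ := hW
  obtain ⟨x, hxe, hx, hxK⟩ := he.exists_hasSpectrum
  obtain ⟨w, hwW, hwsum, hw⟩ := hx.exists_filterOutput hxe hH hWe
  simp only [mul_one] at hw
  obtain ⟨v, hvV, hv, hvK⟩ := hV.exists_hasSpectrum
  set A := Submodule.span ℝ (Set.range v) with hA
  set B := Submodule.span ℝ (Set.range w) with hB
  -- Independence is assumed between V and W, not between V and the underlying white noise. The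
  -- noise space is therefore the span of w, which inherits Gaussianity from the closed span of the
  -- white noise.
  have hBG : IsGaussSpace B := hxK.topologicalClosure.mono <| Submodule.span_le.mpr <| by
    rintro _ ⟨t, rfl⟩
    exact mem_topologicalClosure_span_of_hasSum (Submodule.isClosed_topologicalClosure _)
      (fun k _ ↦ Submodule.le_topologicalClosure _ (Submodule.subset_span ⟨_, rfl⟩)) (hwsum t)
  obtain ⟨hG, horth⟩ := hvK.sup_of_indep hBG fun a ha b hb ↦ indepFun_of_mem_span hvV hwW hVW ha hb
  -- The filtered input cancels: Q Y - Q U = Q W termwise, so the implicit loop equation becomes an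
  -- explicit formula for U.
  have hctl : ∀ t : ℤ, ∃ F G : Ω → ℝ,
      (∀ᵐ ω ∂P, HasSum (fun k : ℕ ↦ impulse Qv k * V (t - k) ω) (F ω)) ∧
      (∀ᵐ ω ∂P, HasSum (fun k : ℕ ↦ impulse Q k * W (t - k) ω) (G ω)) ∧
      ∀ᵐ ω ∂P, U t ω = F ω + G ω := by
    intro t
    have h : ∀ᵐ ω ∂P, HasSum (fun k : ℕ ↦ impulse Qv k * V (t - k) ω)
          (∑' k : ℕ, impulse Qv k * V (t - k) ω) ∧
        HasSum (fun k : ℕ ↦ impulse Q k * W (t - k) ω) (∑' k : ℕ, impulse Q k * W (t - k) ω) ∧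
        U t ω = ∑' k : ℕ, impulse Qv k * V (t - k) ω + ∑' k : ℕ, impulse Q k * W (t - k) ω := by
      filter_upwards [hloop.controller t] with ω ⟨a, b, c, ha, hb, hc, habc⟩
      have hd : HasSum (fun k : ℕ ↦ impulse Q k * W (t - k) ω) (c - a) := by
        refine (hc.sub ha).congr_fun fun k ↦ ?_
        rw [hloop.channel]; ring
      refine ⟨hb.summable.hasSum, hd.summable.hasSum, ?_⟩
      rw [hb.tsum_eq, hd.tsum_eq]; linarith
    exact ⟨_, _, h.mono fun _ h ↦ h.1, h.mono fun _ h ↦ h.2.1, h.mono fun _ h ↦ h.2.2⟩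
  choose F G hF hGs hU using hctl
  obtain ⟨f, hfF, hfsum, hf⟩ := hv.exists_filterOutput (Z := F) hvV hQv hF
  obtain ⟨g, hgG, hgsum, -⟩ := hw.exists_filterOutput (Z := G) hwW hQ hGs
  have hle := Submodule.le_topologicalClosure (A ⊔ B)
  have hwK : ∀ t, w t ∈ (A ⊔ B).topologicalClosure := fun t ↦
    hle (Submodule.mem_sup_right (Submodule.subset_span ⟨t, rfl⟩))
  have hvK' : ∀ t, v t ∈ (A ⊔ B).topologicalClosure := fun t ↦
    hle (Submodule.mem_sup_left (Submodule.subset_span ⟨t, rfl⟩))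
  have hcl := Submodule.isClosed_topologicalClosure (A ⊔ B)
  refine ⟨_, f, g, w, hG.topologicalClosure,
    fun t ↦ mem_topologicalClosure_span_of_hasSum hcl (fun k _ ↦ hvK' _) (hfsum t),
    fun t ↦ mem_topologicalClosure_span_of_hasSum hcl (fun k _ ↦ hwK _) (hgsum t),
    hwK, hwW, fun t ↦ ?_, hf, hw, hgsum, fun s t ↦ ?_⟩
  · filter_upwards [Lp.coeFn_add (f t) (g t), hfF t, hgG t, hU t] with ω h1 h2 h3 h4
    rw [h1, Pi.add_apply, h2, h3, h4]
  · have h := (hfsum s).mapL (innerSL ℝ (w t))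
    simp only [map_smul, innerSL_apply_apply] at h
    have h0 : ∀ k : ℕ, inner ℝ (w t) (v (s - k)) = 0 := fun k ↦ by
      rw [real_inner_comm]
      exact horth _ (Submodule.subset_span ⟨_, rfl⟩) _ (Submodule.subset_span ⟨_, rfl⟩)
    simp only [h0, smul_zero] at h
    rw [real_inner_comm]
    exact h.unique hasSum_zero

end Signals

/-! ### Prediction errors in the loop -/

section ErrorVar

variable {E : Type*} [NormedAddCommGroup E] [InnerProductSpace ℝ E]

lemma IsErrorVar.le_of_le {M M' : Submodule ℝ E} {b : E} {v v' : ℝ} (h : IsErrorVar M b v)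
    (h' : IsErrorVar M' b v') (hM : M' ≤ M) : v ≤ v' := by
  obtain ⟨y, hy, rfl⟩ := h'.1
  exact h.2 y (hM hy)

/-- The finite-horizon prediction errors of a stationary sequence decrease to the geometric mean of
its spectral density. -/
lemma HasSpectrum.tendsto_errorVar {y : ℤ → E} {S : ℝ → ℝ} (hy : HasSpectrum y S)
    (hpos : ∀ᵐ θ ∂circ, 0 < S θ) (hlog : Integrable (fun θ ↦ Real.log (S θ)) circ) {v : ℕ → ℝ}
    (hv : ∀ n : ℕ, IsErrorVar (Submodule.span ℝ (Set.range fun k : Fin n ↦ y (((k : ℕ) : ℤ) + 1)))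
      (y ((n : ℤ) + 1)) (v n)) :
    Tendsto v atTop (𝓝 (Real.exp (∫ θ, Real.log (S θ) ∂circ))) := by
  have hlow : ∀ n, Real.exp (∫ θ, Real.log (S θ) ∂circ) ≤ v n := by
    intro n
    obtain ⟨z, hz, h⟩ := (hv n).1
    rw [h]
    refine hy.le_norm_sub_sq hpos hlog (subset_closure (Submodule.span_mono ?_ hz))
    rintro _ ⟨k, rfl⟩
    refine ⟨n - 1 - k, ?_⟩
    have := k.2
    dsimp only
    congr 1
    omega
  refine tendsto_order.mpr ⟨fun a ha ↦ Eventually.of_forall fun n ↦ ha.trans_le (hlow n),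
    fun a ha ↦ ?_⟩
  obtain ⟨N, c, hN⟩ := hy.exists_predictor hpos hlog (half_pos (sub_pos.mpr ha))
  filter_upwards [eventually_ge_atTop N] with n hn
  refine lt_of_le_of_lt (((hv n).2 _ ?_).trans (hN ((n : ℤ) + 1))) (by linarith)
  refine Submodule.sum_mem _ fun k hk ↦ Submodule.smul_mem _ _ (Submodule.subset_span ?_)
  have hk' := Finset.mem_range.mp hk
  refine ⟨⟨n - 1 - k, by omega⟩, ?_⟩
  dsimp only
  congr 1
  omega

variable {w f g : ℤ → E} {Sw : ℝ → ℝ} {q : ℕ → ℝ}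

/-- Given the input up to time `n + 1`, the output at that time cannot be predicted better than the
noise from its infinite past. -/
lemma HasSpectrum.le_norm_output_sub_sq (hw : HasSpectrum w Sw) (hpos : ∀ᵐ θ ∂circ, 0 < Sw θ)
    (hlog : Integrable (fun θ ↦ Real.log (Sw θ)) circ) (hq : q 0 = 0)
    (hg : ∀ t, HasSum (fun k : ℕ ↦ q k • w (t - k)) (g t)) (horth : ∀ s t, inner ℝ (f s) (w t) = 0)
    (n : ℕ) {x : E}
    (hx : x ∈ Submodule.span ℝ (Set.range (Sum.elim
      (fun k : Fin n ↦ f (((k : ℕ) : ℤ) + 1) + g (((k : ℕ) : ℤ) + 1) + w (((k : ℕ) : ℤ) + 1))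
      (fun i : Fin (n + 1) ↦ f (((i : ℕ) : ℤ) + 1) + g (((i : ℕ) : ℤ) + 1))))) :
    Real.exp (∫ θ, Real.log (Sw θ) ∂circ) ≤
      ‖f ((n : ℤ) + 1) + g ((n : ℤ) + 1) + w ((n : ℤ) + 1) - x‖ ^ 2 := by
  set B := Submodule.span ℝ (Set.range fun k : ℕ ↦ w ((n : ℤ) + 1 - 1 - k)) with hB
  set A := Submodule.span ℝ (Set.range f) with hA
  have hwB : ∀ t : ℤ, t ≤ n → w t ∈ B.topologicalClosure := fun t ht ↦ by
    refine Submodule.le_topologicalClosure _ (Submodule.subset_span ⟨(n - t).toNat, ?_⟩)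
    dsimp only
    congr 1
    omega
  -- Since q 0 = 0, the feedback part at time n + 1 involves noise only up to time n.
  have hgB : ∀ t : ℤ, t ≤ n + 1 → g t ∈ B.topologicalClosure := fun t ht ↦ by
    refine mem_topologicalClosure_span_of_hasSum (Submodule.isClosed_topologicalClosure _)
      (fun k hk ↦ hwB _ ?_) (hg t)
    have : k ≠ 0 := fun h ↦ hk (h ▸ hq)
    omega
  have hu : ∀ t : ℤ, t ≤ n + 1 → f t + g t ∈ A ⊔ B.topologicalClosure := fun t ht ↦
    Submodule.add_mem_sup (Submodule.subset_span ⟨t, rfl⟩) (hgB t ht)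
  -- All signals except the current noise sample lie in the message space A plus the closed past B
  -- of the noise. The error is thus a + (w + b), with a orthogonal to w and b, and dropping a
  -- leaves a prediction error of w from its past.
  have hspan : f ((n : ℤ) + 1) + g ((n : ℤ) + 1) - x ∈ A ⊔ B.topologicalClosure := by
    refine Submodule.sub_mem _ (hu _ le_rfl) (Submodule.span_le.mpr ?_ hx)
    rintro _ ⟨k | i, rfl⟩
    · have := k.2
      exact Submodule.add_mem _ (hu _ (by omega)) (Submodule.mem_sup_right (hwB _ (by omega)))
    · have := i.2
      exact hu _ (by omega)
  obtain ⟨a, ha, b, hb, hab⟩ := Submodule.mem_sup.mp hspan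
  have haw : ∀ t, inner ℝ a (w t) = 0 := fun t ↦ by
    have : A ≤ (Submodule.span ℝ {w t})ᗮ := by
      refine Submodule.span_le.mpr ?_
      rintro _ ⟨s, rfl⟩
      rw [SetLike.mem_coe, Submodule.mem_orthogonal_singleton_iff_inner_left]
      exact horth s t
    exact Submodule.mem_orthogonal_singleton_iff_inner_left.mp (this ha)
  have hab0 : inner ℝ a b = 0 := by
    have : B.topologicalClosure ≤ (Submodule.span ℝ {a})ᗮ := by
      refine Submodule.topologicalClosure_minimal _ (Submodule.span_le.mpr ?_)
        (Submodule.isClosed_orthogonal _)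
      rintro _ ⟨k, rfl⟩
      rw [SetLike.mem_coe, Submodule.mem_orthogonal_singleton_iff_inner_right]
      exact haw _
    exact Submodule.mem_orthogonal_singleton_iff_inner_right.mp (this hb)
  have hle := hw.le_norm_sub_sq hpos hlog (t := (n : ℤ) + 1) (y := -b)
    (B.topologicalClosure.neg_mem hb)
  have hdecomp : f ((n : ℤ) + 1) + g ((n : ℤ) + 1) + w ((n : ℤ) + 1) - x =
      a + (w ((n : ℤ) + 1) - -b) := by
    rw [sub_neg_eq_add, add_sub_right_comm, ← hab]
    abel
  rw [hdecomp, norm_add_sq_real, sub_neg_eq_add, inner_add_right, haw, hab0]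
  rw [sub_neg_eq_add] at hle
  nlinarith [sq_nonneg ‖a‖]

/-- The errors of predicting the output from the past outputs and the inputs decrease to the
geometric mean of the spectral density of the noise. -/
lemma HasSpectrum.tendsto_errorVar_output (hw : HasSpectrum w Sw) (hpos : ∀ᵐ θ ∂circ, 0 < Sw θ)
    (hlog : Integrable (fun θ ↦ Real.log (Sw θ)) circ) (hq : q 0 = 0)
    (hg : ∀ t, HasSum (fun k : ℕ ↦ q k • w (t - k)) (g t)) (horth : ∀ s t, inner ℝ (f s) (w t) = 0)
    {v : ℕ → ℝ} (hv : ∀ n : ℕ, IsErrorVar (Submodule.span ℝ (Set.range (Sum.elim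
      (fun k : Fin n ↦ f (((k : ℕ) : ℤ) + 1) + g (((k : ℕ) : ℤ) + 1) + w (((k : ℕ) : ℤ) + 1))
      (fun i : Fin (n + 1) ↦ f (((i : ℕ) : ℤ) + 1) + g (((i : ℕ) : ℤ) + 1)))))
      (f ((n : ℤ) + 1) + g ((n : ℤ) + 1) + w ((n : ℤ) + 1)) (v n)) :
    Tendsto v atTop (𝓝 (Real.exp (∫ θ, Real.log (Sw θ) ∂circ))) := by
  have hlow : ∀ n, Real.exp (∫ θ, Real.log (Sw θ) ∂circ) ≤ v n := by
    intro n
    obtain ⟨z, hz, h⟩ := (hv n).1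
    rw [h]
    exact hw.le_norm_output_sub_sq hpos hlog hq hg horth n hz
  refine tendsto_order.mpr ⟨fun a ha ↦ Eventually.of_forall fun n ↦ ha.trans_le (hlow n),
    fun a ha ↦ ?_⟩
  obtain ⟨N, c, hN⟩ := hw.exists_predictor hpos hlog (half_pos (sub_pos.mpr ha))
  filter_upwards [eventually_ge_atTop N] with n hn
  set M := Submodule.span ℝ (Set.range (Sum.elim
      (fun k : Fin n ↦ f (((k : ℕ) : ℤ) + 1) + g (((k : ℕ) : ℤ) + 1) + w (((k : ℕ) : ℤ) + 1))
      (fun i : Fin (n + 1) ↦ f (((i : ℕ) : ℤ) + 1) + g (((i : ℕ) : ℤ) + 1)))) with hM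
  have hu : ∀ i : ℕ, i < n + 1 → f ((i : ℤ) + 1) + g ((i : ℤ) + 1) ∈ M := fun i hi ↦
    Submodule.subset_span ⟨Sum.inr ⟨i, hi⟩, rfl⟩
  have hwM : ∀ k : ℕ, k < n → w ((k : ℤ) + 1) ∈ M := fun k hk ↦ by
    have h1 : f ((k : ℤ) + 1) + g ((k : ℤ) + 1) + w ((k : ℤ) + 1) ∈ M :=
      Submodule.subset_span ⟨Sum.inl ⟨k, hk⟩, rfl⟩
    simpa using M.sub_mem h1 (hu k (by omega))
  -- The competing predictor is the known current input plus a finite predictor of the noise, whose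
  -- past samples are recovered as output minus input.
  have hmem : f ((n : ℤ) + 1) + g ((n : ℤ) + 1) +
      ∑ k ∈ Finset.range N, c k • w ((n : ℤ) + 1 - 1 - k) ∈ M := by
    refine M.add_mem (hu n (by omega)) (M.sum_mem fun k hk ↦ M.smul_mem _ ?_)
    have hk' := Finset.mem_range.mp hk
    have := hwM (n - 1 - k) (by omega)
    rwa [show ((n - 1 - k : ℕ) : ℤ) + 1 = (n : ℤ) + 1 - 1 - k by omega] at this
  have h := (hv n).2 _ hmem
  rw [add_sub_add_left_eq_sub] at h
  exact (h.trans (hN _)).trans_lt (by linarith)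

end ErrorVar

/-! ### Log-integrability of the spectral densities -/

/-- Only θ = π is missing, and it gives the same point of the circle as -π. -/
lemma gainSq_pos_of_forall_Ico {H : RatFunc ℝ}
    (h : ∀ θ ∈ Set.Ico (-Real.pi) Real.pi, 0 < gainSq H θ) :
    ∀ θ ∈ Set.Icc (-Real.pi) Real.pi, 0 < gainSq H θ := by
  intro θ hθ
  rcases hθ.2.eq_or_lt with rfl | hlt
  · have h1 := h (-Real.pi) ⟨le_rfl, by linarith [Real.pi_pos]⟩
    have h2 : Complex.exp (((-Real.pi : ℝ) : ℂ) * Complex.I) = Complex.exp (Real.pi * Complex.I) := by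
      push_cast
      rw [neg_mul, Complex.exp_neg, Complex.exp_pi_mul_I]
      norm_num
    rw [gainSq, freqResp_eq_div, h2] at h1
    rwa [gainSq, freqResp_eq_div]
  · exact h θ ⟨hθ.1, hlt⟩

lemma IsRHInf.integrable_log_gainSq {H : RatFunc ℝ} (hH : IsRHInf H)
    (h : ∀ θ ∈ Set.Icc (-Real.pi) Real.pi, 0 < gainSq H θ) :
    Integrable (fun θ ↦ Real.log (gainSq H θ)) circ := by
  rw [integrable_circ_iff]
  refine ContinuousOn.intervalIntegrable (hH.continuous_gainSq.continuousOn.log fun θ hθ ↦ ?_)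
  rw [Set.uIcc_of_le (by linarith [Real.pi_pos])] at hθ
  exact (h θ hθ).ne'

/-- `1 + Q` as a quotient of polynomials on the unit circle. -/
lemma IsRHInf.one_add_freqResp {Q : RatFunc ℝ} (hQ : IsRHInf Q) (θ : ℝ) :
    1 + freqResp Q θ = ((Q.denom + Q.num).map (algebraMap ℝ ℂ)).eval (cis θ) /
      (Q.denom.map (algebraMap ℝ ℂ)).eval (cis θ) := by
  have h := hQ.aeval_denom_ne_zero (Complex.norm_exp_ofReal_mul_I θ)
  rw [freqResp_eq_div, Polynomial.eval_map_algebraMap, Polynomial.eval_map_algebraMap, map_add, cis]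
  field_simp

/-- The denominator dominates in degree, so the sum keeps its degree. This excludes Q = -1. -/
lemma IsStrictlyProper.denom_add_num_ne_zero {Q : RatFunc ℝ} (hQ : IsStrictlyProper Q) :
    Q.denom + Q.num ≠ 0 := fun h ↦ by
  have := Polynomial.degree_add_eq_left_of_degree_lt hQ
  rw [h, Polynomial.degree_zero] at this
  exact Q.denom_ne_zero (Polynomial.degree_eq_bot.mp this.symm)

/-- The function 1 + Q may vanish on the circle, so positivity holds only almost everywhere. Its
logarithm is still integrable because log |p| is for every polynomial p. -/
lemma IsRHInf.one_add_freqResp_ae {Q : RatFunc ℝ} (hQ : IsRHInf Q) (hQs : IsStrictlyProper Q) :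
    (∀ᵐ θ ∂circ, 0 < ‖1 + freqResp Q θ‖ ^ 2) ∧
      Integrable (fun θ ↦ Real.log (‖1 + freqResp Q θ‖ ^ 2)) circ := by
  have hd : Q.denom.map (algebraMap ℝ ℂ) ≠ 0 :=
    (Polynomial.map_ne_zero_iff (algebraMap ℝ ℂ).injective).mpr Q.denom_ne_zero
  have hn : (Q.denom + Q.num).map (algebraMap ℝ ℂ) ≠ 0 :=
    (Polynomial.map_ne_zero_iff (algebraMap ℝ ℂ).injective).mpr hQs.denom_add_num_ne_zero
  have hne : ∀ᵐ θ ∂circ, ((Q.denom + Q.num).map (algebraMap ℝ ℂ)).eval (cis θ) ≠ 0 ∧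
      (Q.denom.map (algebraMap ℝ ℂ)).eval (cis θ) ≠ 0 :=
    (ae_eval_cis_ne_zero hn).and (ae_eval_cis_ne_zero hd)
  refine ⟨?_, ?_⟩
  · filter_upwards [hne] with θ h
    rw [hQ.one_add_freqResp]
    exact pow_pos (norm_pos_iff.mpr (div_ne_zero h.1 h.2)) 2
  · refine (((integrable_log_norm_eval_cis ((Q.denom + Q.num).map (algebraMap ℝ ℂ))).sub
      (integrable_log_norm_eval_cis (Q.denom.map (algebraMap ℝ ℂ)))).const_mul 2).congr ?_
    filter_upwards [hne] with θ h
    rw [hQ.one_add_freqResp, Real.log_pow, norm_div,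
      Real.log_div (norm_ne_zero_iff.mpr h.1) (norm_ne_zero_iff.mpr h.2)]
    simp

/-- The logarithm of an integrable function is integrable as soon as it is bounded below by an
integrable function. -/
lemma integrable_log_of_le {α : Type*} [MeasurableSpace α] {μ : Measure α} {S R : α → ℝ}
    (hS : Integrable S μ) (hR : Integrable (fun a ↦ Real.log (R a)) μ) (hpos : ∀ᵐ a ∂μ, 0 < R a)
    (hle : ∀ᵐ a ∂μ, R a ≤ S a) : Integrable (fun a ↦ Real.log (S a)) μ := by
  refine (hS.abs.add hR.abs).mono' (Real.measurable_log.comp_aemeasurable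
    hS.1.aemeasurable).aestronglyMeasurable ?_
  filter_upwards [hpos, hle] with a h1 h2
  have h3 := Real.log_le_log h1 h2
  have h4 := Real.log_le_sub_one_of_pos (h1.trans_le h2)
  rw [Real.norm_eq_abs, Pi.add_apply, abs_le]
  constructor
  · linarith [neg_abs_le (Real.log (R a)), abs_nonneg (S a)]
  · linarith [le_abs_self (S a), abs_nonneg (Real.log (R a))]

/-- The filter `1 + Q`. -/
lemma HasSpectrum.one_add_filter {E : Type*} [NormedAddCommGroup E] [InnerProductSpace ℝ E]
    {w g : ℤ → E} {S : ℝ → ℝ} (hw : HasSpectrum w S) {Q : RatFunc ℝ} (hQ : IsRHInf Q)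
    (hg : ∀ t : ℤ, HasSum (fun k : ℕ ↦ impulse Q k • w (t - k)) (g t)) :
    HasSpectrum (fun t ↦ g t + w t) (fun θ ↦ ‖1 + freqResp Q θ‖ ^ 2 * S θ) := by
  refine hw.filter (g := fun k ↦ impulse Q k + if k = 0 then 1 else 0)
    (ĝ := fun θ ↦ 1 + freqResp Q θ) ?_ (fun θ ↦ ?_) fun t ↦ ?_
  · refine Summable.of_nonneg_of_le (fun _ ↦ abs_nonneg _) (fun k ↦ abs_add_le _ _)
      (hQ.summable_impulse.add (summable_of_ne_finset_zero (s := {0}) fun k hk ↦ ?_))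
    simp_all
  · rw [add_comm]
    refine ((hQ.hasSum_freqResp θ).add (hasSum_ite_eq 0 (1 : ℂ))).congr_fun fun k ↦ ?_
    rcases eq_or_ne k 0 with rfl | h
    · simp
    · simp [h]
  · refine ((hg t).add (hasSum_ite_eq 0 (w t))).congr_fun fun k ↦ ?_
    rcases eq_or_ne k 0 with rfl | h
    · simp [add_smul]
    · simp [h]

/-! ### The directed information rate -/

/-- The directed information rate of a channel `y = f + g + w` in a Gaussian space, where `g` is a
strictly causal functional of the noise `w` and `f` is orthogonal to `w`. -/
theorem IsGaussSpace.tendsto_directedInfo {Ω : Type*} [MeasurableSpace Ω] {P : Measure Ω}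
    [IsProbabilityMeasure P] {K : Submodule ℝ (Lp ℝ 2 P)} (hK : IsGaussSpace K)
    {f g w : ℤ → Lp ℝ 2 P} (hf : ∀ t, f t ∈ K) (hgK : ∀ t, g t ∈ K) (hwK : ∀ t, w t ∈ K)
    {U Y : ℤ → Ω → ℝ} (hUm : ∀ t, Measurable (U t)) (hYm : ∀ t, Measurable (Y t))
    (hU : ∀ t, (f t + g t : Lp ℝ 2 P) =ᵐ[P] U t) (hY : ∀ t, (f t + g t + w t : Lp ℝ 2 P) =ᵐ[P] Y t)
    {q : ℕ → ℝ} (hq : q 0 = 0) (hg : ∀ t, HasSum (fun k : ℕ ↦ q k • w (t - k)) (g t))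
    (horth : ∀ s t, inner ℝ (f s) (w t) = 0) {Sw Sy : ℝ → ℝ} (hw : HasSpectrum w Sw)
    (hy : HasSpectrum (fun t ↦ f t + g t + w t) Sy) (hwpos : ∀ᵐ θ ∂circ, 0 < Sw θ)
    (hypos : ∀ᵐ θ ∂circ, 0 < Sy θ) (hwlog : Integrable (fun θ ↦ Real.log (Sw θ)) circ)
    (hylog : Integrable (fun θ ↦ Real.log (Sy θ)) circ) :
    (∀ T : ℕ, directedInfo P U Y T ≠ ∞) ∧
      Tendsto (fun T : ℕ ↦ (1 / (T : ℝ)) * (directedInfo P U Y T).toReal) atTop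
        (𝓝 (1 / 2 * ∫ θ, Real.logb 2 (Sy θ / Sw θ) ∂circ)) := by
  have hterm : ∀ n : ℕ, ∃ v₁ v₀ : ℝ,
      IsErrorVar (Submodule.span ℝ (Set.range (Sum.elim
        (fun k : Fin n ↦ f (((k : ℕ) : ℤ) + 1) + g (((k : ℕ) : ℤ) + 1) + w (((k : ℕ) : ℤ) + 1))
        (fun i : Fin (n + 1) ↦ f (((i : ℕ) : ℤ) + 1) + g (((i : ℕ) : ℤ) + 1)))))
        (f ((n : ℤ) + 1) + g ((n : ℤ) + 1) + w ((n : ℤ) + 1)) v₁ ∧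
      IsErrorVar (Submodule.span ℝ (Set.range fun k : Fin n ↦
        f (((k : ℕ) : ℤ) + 1) + g (((k : ℕ) : ℤ) + 1) + w (((k : ℕ) : ℤ) + 1)))
        (f ((n : ℤ) + 1) + g ((n : ℤ) + 1) + w ((n : ℤ) + 1)) v₀ ∧
      condMutualInfo P (block U (n + 1)) (Y ((n : ℤ) + 1)) (block Y n) =
        ENNReal.ofReal (1 / 2 * Real.logb 2 (v₀ / v₁)) := fun n ↦
    hK.exists_condMutualInfo_eq (fun i ↦ K.add_mem (hf _) (hgK _))
      (fun k ↦ K.add_mem (K.add_mem (hf _) (hgK _)) (hwK _))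
      (K.add_mem (K.add_mem (hf _) (hgK _)) (hwK _)) (fun i ↦ hUm _) (fun k ↦ hYm _) (hYm _)
      -- An exactly predictable output would have error 0, below the positive geometric mean of the
      -- noise spectrum.
      (fun i ↦ hU _) (fun k ↦ hY _) (hY _) fun hmem ↦ by
        have := hw.le_norm_output_sub_sq hwpos hwlog hq hg horth n hmem
        rw [sub_self, norm_zero, zero_pow two_ne_zero] at this
        exact (Real.exp_pos _).not_ge this
  choose v₁ v₀ hv₁ hv₀ hI using hterm
  have hlim₁ := hw.tendsto_errorVar_output hwpos hwlog hq hg horth hv₁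
  have hlim₀ := hy.tendsto_errorVar hypos hylog hv₀
  have hv₁pos : ∀ n, 0 < v₁ n := fun n ↦ by
    obtain ⟨z, hz, h⟩ := (hv₁ n).1
    rw [h]
    exact (Real.exp_pos _).trans_le (hw.le_norm_output_sub_sq hwpos hwlog hq hg horth n hz)
  have hle : ∀ n, v₁ n ≤ v₀ n := fun n ↦ (hv₁ n).le_of_le (hv₀ n) <| Submodule.span_mono <| by
    rintro _ ⟨k, rfl⟩
    exact ⟨Sum.inl k, rfl⟩
  have hnn : ∀ n, 0 ≤ 1 / 2 * Real.logb 2 (v₀ n / v₁ n) := fun n ↦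
    mul_nonneg (by norm_num) (Real.logb_nonneg one_lt_two ((one_le_div (hv₁pos n)).mpr (hle n)))
  have hdir : ∀ T, directedInfo P U Y T =
      ENNReal.ofReal (∑ n ∈ Finset.range T, 1 / 2 * Real.logb 2 (v₀ n / v₁ n)) := fun T ↦ by
    rw [directedInfo, ENNReal.ofReal_sum_of_nonneg fun n _ ↦ hnn n]
    exact Finset.sum_congr rfl fun n _ ↦ hI n
  refine ⟨fun T ↦ by rw [hdir]; exact ENNReal.ofReal_ne_top, ?_⟩
  -- The logarithm of the ratio of the two geometric means is the integral of the log-ratio of the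
  -- densities.
  have hval : ∫ θ, Real.logb 2 (Sy θ / Sw θ) ∂circ =
      Real.logb 2 (Real.exp (∫ θ, Real.log (Sy θ) ∂circ) / Real.exp (∫ θ, Real.log (Sw θ) ∂circ)) := by
    rw [← Real.exp_sub, Real.logb, Real.log_exp, ← integral_sub hylog hwlog, ← integral_div]
    refine integral_congr_ae ?_
    filter_upwards [hwpos, hypos] with θ h1 h2
    rw [Real.logb, Real.log_div h2.ne' h1.ne']
  have hratio := ((hlim₀.div hlim₁ (Real.exp_pos _).ne').log
    (div_pos (Real.exp_pos _) (Real.exp_pos _)).ne').div_const (Real.log 2)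
  rw [hval]
  refine (hratio.const_mul (1 / 2)).cesaro.congr fun T ↦ ?_
  rw [hdir, ENNReal.toReal_ofReal (Finset.sum_nonneg fun n _ ↦ hnn n), one_div (T : ℝ)]
  rfl

end GaussianFeedback

end

/-! ### The closed loop: spectra of input and output, information rate and power -/

theorem mainTheorem8 {Ω : Type*} [MeasurableSpace Ω] (P : Measure Ω) [IsProbabilityMeasure P]
    (H Q Qv : RatFunc ℝ) (Sv : ℝ → ℝ) (W V U Y : ℤ → Ω → ℝ)
    (hH : GaussianFeedback.IsRHInf H)
    (hSw : ∀ θ ∈ Set.Ico (-Real.pi) Real.pi, 0 < GaussianFeedback.gainSq H θ)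
    (hQ : GaussianFeedback.IsRHInf Q) (hQsp : GaussianFeedback.IsStrictlyProper Q)
    (hQv : GaussianFeedback.IsRHInf Qv)
    (hW : GaussianFeedback.IsFilteredGaussianNoise P H W)
    (hV : GaussianFeedback.IsGaussianWithPSD P Sv V)
    (hVW : IndepFun (fun ω (t : ℤ) ↦ V t ω) (fun ω (t : ℤ) ↦ W t ω) P)
    (hloop : GaussianFeedback.IsYoulaLoop P Q Qv W V U Y) :
    ((∀ T : ℕ, GaussianFeedback.directedInfo P U Y T ≠ ∞) ∧
      IntervalIntegrable
        (fun θ ↦ Real.logb 2 (GaussianFeedback.gainSq Qv θ * Sv θ / GaussianFeedback.gainSq H θ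
          + ‖1 + GaussianFeedback.freqResp Q θ‖ ^ 2)) volume (-Real.pi) Real.pi ∧
      Tendsto (fun T : ℕ ↦ (1 / (T : ℝ)) * (GaussianFeedback.directedInfo P U Y T).toReal) atTop
        (𝓝 ((1 / (4 * Real.pi)) * ∫ θ in (-Real.pi)..Real.pi,
          Real.logb 2 (GaussianFeedback.gainSq Qv θ * Sv θ / GaussianFeedback.gainSq H θ
            + ‖1 + GaussianFeedback.freqResp Q θ‖ ^ 2)))) ∧
    (IntervalIntegrable
        (fun θ ↦ GaussianFeedback.gainSq Q θ * GaussianFeedback.gainSq H θ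
          + GaussianFeedback.gainSq Qv θ * Sv θ) volume (-Real.pi) Real.pi ∧
      (∀ᵐ ω ∂P, Tendsto (fun T : ℕ ↦ (1 / (T : ℝ)) * ∑ t ∈ Finset.Icc 1 T, U (t : ℤ) ω ^ 2) atTop
        (𝓝 ((1 / (2 * Real.pi)) * ∫ θ in (-Real.pi)..Real.pi,
          (GaussianFeedback.gainSq Q θ * GaussianFeedback.gainSq H θ
            + GaussianFeedback.gainSq Qv θ * Sv θ)))) ∧
      (∀ t : ℤ, Integrable (fun ω ↦ U t ω ^ 2) P) ∧
      Tendsto (fun T : ℕ ↦ (1 / (T : ℝ)) * ∑ t ∈ Finset.Icc 1 T, ∫ ω, U (t : ℤ) ω ^ 2 ∂P) atTop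
        (𝓝 ((1 / (2 * Real.pi)) * ∫ θ in (-Real.pi)..Real.pi,
          (GaussianFeedback.gainSq Q θ * GaussianFeedback.gainSq H θ
            + GaussianFeedback.gainSq Qv θ * Sv θ)))) := by
  have hSw' := GaussianFeedback.gainSq_pos_of_forall_Ico hSw
  obtain ⟨K, f, g, w, hK, hfK, hgK, hwK, hwW, hfU, hf, hw, hg, horth⟩ :=
    hloop.exists_signals hH hQ hQv hW hV hVW
  have hgorth : ∀ s t, inner ℝ (f s) (g t) = 0 := fun s t ↦ by
    have h := (hg t).mapL (innerSL ℝ (f s))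
    simp only [map_smul, innerSL_apply_apply, horth, smul_zero] at h
    exact h.unique hasSum_zero
  have hu : GaussianFeedback.HasSpectrum (fun t ↦ f t + g t) fun θ ↦
      GaussianFeedback.gainSq Qv θ * Sv θ + GaussianFeedback.gainSq Q θ * GaussianFeedback.gainSq H θ :=
    hf.add (hw.filter hQ.summable_impulse hQ.hasSum_freqResp hg) hgorth
  have hy : GaussianFeedback.HasSpectrum (fun t ↦ f t + g t + w t) fun θ ↦
      GaussianFeedback.gainSq Qv θ * Sv θ +
        ‖1 + GaussianFeedback.freqResp Q θ‖ ^ 2 * GaussianFeedback.gainSq H θ := by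
    -- Feedback and noise are both driven by w, hence not orthogonal; they are grouped as (1 + Q) w
    -- before the orthogonal part f is added.
    simp only [add_assoc]
    refine hf.add (hw.one_add_filter hQ hg) fun s t ↦ ?_
    rw [inner_add_right, hgorth, horth, add_zero]
  have hwpos : ∀ᵐ θ ∂GaussianFeedback.circ, 0 < GaussianFeedback.gainSq H θ :=
    GaussianFeedback.ae_circ_of_forall fun θ hθ ↦ hSw' θ ⟨hθ.1.le, hθ.2⟩
  have hvnn : ∀ᵐ θ ∂GaussianFeedback.circ, 0 ≤ Sv θ :=
    GaussianFeedback.ae_circ_of_forall fun θ hθ ↦ hV.psd_nonneg θ ⟨hθ.1.le, hθ.2⟩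
  have hwlog := hH.integrable_log_gainSq hSw'
  obtain ⟨hQpos, hQlog⟩ := hQ.one_add_freqResp_ae hQsp
  have hRpos : ∀ᵐ θ ∂GaussianFeedback.circ,
      0 < ‖1 + GaussianFeedback.freqResp Q θ‖ ^ 2 * GaussianFeedback.gainSq H θ := by
    filter_upwards [hQpos, hwpos] with θ h1 h2 using mul_pos h1 h2
  have hRlog : Integrable (fun θ ↦ Real.log (‖1 + GaussianFeedback.freqResp Q θ‖ ^ 2 *
      GaussianFeedback.gainSq H θ)) GaussianFeedback.circ := by
    refine (hQlog.add hwlog).congr ?_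
    filter_upwards [hQpos, hwpos] with θ h1 h2
    rw [Real.log_mul h1.ne' h2.ne', Pi.add_apply]
  -- The message term is nonnegative, so the output density dominates |1+Q|² S_w. This bounds its
  -- logarithm below by an integrable function even where S_v vanishes.
  have hRle : ∀ᵐ θ ∂GaussianFeedback.circ,
      ‖1 + GaussianFeedback.freqResp Q θ‖ ^ 2 * GaussianFeedback.gainSq H θ ≤
        GaussianFeedback.gainSq Qv θ * Sv θ +
          ‖1 + GaussianFeedback.freqResp Q θ‖ ^ 2 * GaussianFeedback.gainSq H θ := by
    filter_upwards [hvnn] with θ h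
    exact le_add_of_nonneg_left (mul_nonneg (sq_nonneg _) h)
  have hypos : ∀ᵐ θ ∂GaussianFeedback.circ, 0 < GaussianFeedback.gainSq Qv θ * Sv θ +
      ‖1 + GaussianFeedback.freqResp Q θ‖ ^ 2 * GaussianFeedback.gainSq H θ := by
    filter_upwards [hRpos, hRle] with θ h1 h2 using h1.trans_le h2
  have hylog := GaussianFeedback.integrable_log_of_le hy.integrable hRlog hRpos hRle
  have hYU : ∀ t, (f t + g t + w t : Lp ℝ 2 P) =ᵐ[P] Y t := fun t ↦ by
    filter_upwards [Lp.coeFn_add (f t + g t) (w t), hfU t, hwW t] with ω h1 h2 h3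
    rw [h1, Pi.add_apply, h2, h3, hloop.channel]
  have hYm : ∀ t, Measurable (Y t) := fun t ↦ by
    rw [funext (hloop.channel t)]
    exact (hloop.measurable_input t).add (hW.1 t)
  obtain ⟨hfin, hlim⟩ := hK.tendsto_directedInfo hfK hgK hwK hloop.measurable_input hYm hfU hYU
    hQsp.impulse_zero hg horth hw hy hwpos hypos hwlog hylog
  have hcongr : (fun θ ↦ Real.logb 2 ((GaussianFeedback.gainSq Qv θ * Sv θ +
        ‖1 + GaussianFeedback.freqResp Q θ‖ ^ 2 * GaussianFeedback.gainSq H θ) /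
          GaussianFeedback.gainSq H θ)) =ᵐ[GaussianFeedback.circ]
      fun θ ↦ Real.logb 2 (GaussianFeedback.gainSq Qv θ * Sv θ / GaussianFeedback.gainSq H θ +
        ‖1 + GaussianFeedback.freqResp Q θ‖ ^ 2) := by
    filter_upwards [hwpos] with θ h
    rw [add_div, mul_div_cancel_right₀ _ h.ne']
  have hpower : ∫ θ, (GaussianFeedback.gainSq Qv θ * Sv θ +
        GaussianFeedback.gainSq Q θ * GaussianFeedback.gainSq H θ) ∂GaussianFeedback.circ =
      (1 / (2 * Real.pi)) * ∫ θ in (-Real.pi)..Real.pi,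
        (GaussianFeedback.gainSq Q θ * GaussianFeedback.gainSq H θ
          + GaussianFeedback.gainSq Qv θ * Sv θ) := by
    rw [GaussianFeedback.integral_circ, smul_eq_mul]
    simp only [add_comm]
  refine ⟨⟨hfin, ?_, ?_⟩, ?_, ?_, fun t ↦ ?_, ?_⟩
  · rw [← GaussianFeedback.integrable_circ_iff]
    refine ((hylog.sub hwlog).div_const (Real.log 2)).congr (EventuallyEq.trans ?_ hcongr)
    filter_upwards [hwpos, hypos] with θ h1 h2
    rw [Real.logb, Real.log_div h2.ne' h1.ne', Pi.sub_apply]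
  · convert hlim using 2
    rw [integral_congr_ae hcongr, GaussianFeedback.integral_circ, smul_eq_mul]
    ring
  · rw [← GaussianFeedback.integrable_circ_iff]
    simpa only [add_comm] using hu.integrable
  · rw [← hpower]
    exact hK.ae_tendsto_average_sq (fun t ↦ K.add_mem (hfK t) (hgK t)) hfU
      hloop.measurable_input hu
  · exact (hK.memLp (K.add_mem (hfK t) (hgK t)) (hfU t) (by simp)).integrable_sq
  · rw [← hpower]
    -- By stationarity the expected power is the same at every time, so the averages are constant
    -- from T = 1 on.
    refine tendsto_const_nhds.congr' ?_
    filter_upwards [eventually_gt_atTop 0] with T hT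
    have hT' : (T : ℝ) ≠ 0 := by exact_mod_cast hT.ne'
    have h : ∀ t : ℤ, ∫ ω, U t ω ^ 2 ∂P = ∫ θ, (GaussianFeedback.gainSq Qv θ * Sv θ +
        GaussianFeedback.gainSq Q θ * GaussianFeedback.gainSq H θ) ∂GaussianFeedback.circ := fun t ↦ by
      rw [← hu.norm_sq t, GaussianFeedback.norm_sq_eq_integral_sq (hfU t)]
    simp only [h, Finset.sum_const, Nat.card_Icc, nsmul_eq_mul, Nat.add_sub_cancel]
    field_simp
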